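/- All manifolds are smooth, Hausdorff, without boundary and modelled on Banach spaces (finite-dimensional manifolds included), and $C_k, Z_k$ denote smooth singular chains and cycles with integer coefficients. Let $\mathcal G$ be a Lie group acting on a connected manifold $N$ with $H_1(N,\mathbb Z)=0$ (homology of smooth singular chains) in such a way that $\pi\colon N\to N/\mathcal G$ is a smooth principal $\mathcal G$-bundle. Let $\chi$ be a differential character of order $2$ on $N/\mathcal G$ with curvature $\omega\in\Omega^2(N/\mathcal G)$, i.e. a homomorphism $\chi\colon Z_1(N/\mathcal G)\to\mathbb R/\mathbb Z$ with $\chi(\partial u)=\int_u\omega \bmod \mathbb Z$ for every $u\in C_2(N/\mathcal G)$, and let $\lambda\in\Omega^1(N)$ satisfy $\pi^*\omega=d\lambda$. Let $\theta=u^{-1}du$ be the Maurer–Cartan form of $U(1)$ and $\Theta=\theta-2\pi i\lambda\in\Omega^1(N\times U(1),i\mathbb R)$. Then there is a unique lift $\Phi$ of the action of $\mathcal G$ on $N$ to a smooth action on $N\times U(1)$ by automorphisms of the trivial principal $U(1)$-bundle $N\times U(1)\to N$ such that the quotient $\mathcal U=(N\times U(1))/\mathcal G$ is a smooth manifold for which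 $N\times U(1)\to\mathcal U$ is a principal $\mathcal G$-bundle and $\mathcal U\to N/\mathcal G$ is a principal $U(1)$-bundle, and $\Theta$ projects onto a connection form $\underline\Theta$ on $\mathcal U\to N/\mathcal G$ whose log-holonomy is $\chi$. Here the log-holonomy of a closed curve $\gamma$ is defined by $\bar\gamma(1)=\bar\gamma(0)\cdot\exp(2\pi i\,\log\mathrm{hol}_{\underline\Theta}(\gamma))$ for a horizontal lift $\bar\gamma$ of $\gamma$, and it is extended to $Z_1(N/\mathcal G)$ by parallel transport. Moreover this action is $\Phi_\phi(x,u)=(\phi x,\exp(2\pi i\,\alpha_\phi(x))\cdot u)$ for $\phi\in\mathcal G$, $x\in N$, $u\in U(1)$, where $\alpha_\phi\colon N\to\mathbb R/\mathbb Z$ is given by $$\alpha_\phi(x)=\int_\gamma\lambda-\chi(\pi\circ\gamma)$$ for any smooth curve $\gamma$ on $N$ joining $x$ to $\phi x$ (such curves exist), and more generally for any $\gamma\in C_1(N)$ with $\partial\gamma=[\phi x]-[x]$, for which $\pi\circ\gamma$ is always a cycle. -/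

import Mathlib

open Set Function MeasureTheory
open scoped Manifold ContDiff Topology

noncomputable section

namespace CharLift

/-! ## Differential forms on manifolds -/

section Forms

variable {E : Type*} [NormedAddCommGroup E] [NormedSpace ℝ E]
  {H : Type*} [TopologicalSpace H] (I : ModelWithCorners ℝ E H)
  (N : Type*) [TopologicalSpace N] [ChartedSpace H N]
  {E' : Type*} [NormedAddCommGroup E'] [NormedSpace ℝ E']
  {H' : Type*} [TopologicalSpace H'] (I' : ModelWithCorners ℝ E' H')
  {N' : Type*} [TopologicalSpace N'] [ChartedSpace H' N']
  (F : Type*) [NormedAddCommGroup F] [NormedSpace ℝ F]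

/-- Fields of continuous alternating `k`-linear forms on the tangent spaces of `N`, with values
in `F`. The differential forms are those satisfying `IsSmoothForm`. -/
abbrev Form (k : ℕ) := ∀ x : N, (TangentSpace I x) [⋀^Fin k]→L[ℝ] F

variable {N F} {k : ℕ}

/-- Pullback `f^* η` of a form along a map `f`. -/
def pullback (f : N' → N) (η : Form I N F k) : Form I' N' F k := fun x =>
  (η (f x)).compContinuousLinearMap (mfderiv I' I f x)

/-- The expression of `η` in the preferred chart at `x₀` (meaningful on the target of the chart;
the manifolds considered have no boundary). -/
def chartRep (η : Form I N F k) (x₀ : N) : E → E [⋀^Fin k]→L[ℝ] F := fun y =>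
  (η ((extChartAt I x₀).symm y)).compContinuousLinearMap
    (mfderiv 𝓘(ℝ, E) I (extChartAt I x₀).symm y)

/-- `η` is a smooth differential form. -/
def IsSmoothForm (η : Form I N F k) : Prop :=
  ∀ x₀ : N, ContDiffOn ℝ ∞ (chartRep I η x₀) (extChartAt I x₀).target

/-- The exterior derivative, computed at `x` in the preferred chart at `x`. -/
def dForm (η : Form I N F k) : Form I N F (k + 1) := fun x =>
  (extDeriv (chartRep I η x) (extChartAt I x x)).compContinuousLinearMap
    (mfderiv I 𝓘(ℝ, E) (extChartAt I x) x)

end Forms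

/-! ## Smooth singular chains in degrees at most two -/

section Chains

/-- A smooth map `K → N` from a subset `K` of a normed space: a map on `K` that extends to a smooth
map on an open neighbourhood of `K`. -/
structure SmoothMapOn {V : Type*} [NormedAddCommGroup V] [NormedSpace ℝ V] (K : Set V)
    {E : Type*} [NormedAddCommGroup E] [NormedSpace ℝ E]
    {H : Type*} [TopologicalSpace H] (I : ModelWithCorners ℝ E H)
    (N : Type*) [TopologicalSpace N] [ChartedSpace H N] where
  toFun : K → N
  exists_ext : ∃ f : V → N, (∃ W : Set V, IsOpen W ∧ K ⊆ W ∧ ContMDiffOn 𝓘(ℝ, V) I ∞ f W) ∧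
    ∀ p : K, f p = toFun p

namespace SmoothMapOn

variable {V : Type*} [NormedAddCommGroup V] [NormedSpace ℝ V] {K : Set V}
  {V' : Type*} [NormedAddCommGroup V'] [NormedSpace ℝ V'] {K' : Set V'}
  {E : Type*} [NormedAddCommGroup E] [NormedSpace ℝ E]
  {H : Type*} [TopologicalSpace H] {I : ModelWithCorners ℝ E H}
  {N : Type*} [TopologicalSpace N] [ChartedSpace H N]
  {E' : Type*} [NormedAddCommGroup E'] [NormedSpace ℝ E']
  {H' : Type*} [TopologicalSpace H'] {I' : ModelWithCorners ℝ E' H'}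
  {N' : Type*} [TopologicalSpace N'] [ChartedSpace H' N']

/-- A chosen smooth extension to a neighbourhood of `K`. Its derivatives at the points of `K`
do not depend on the choice when `K` is contained in the closure of its interior. -/
def ext (σ : SmoothMapOn K I N) : V → N := σ.exists_ext.choose

/-- Composition `f ∘ σ` with a smooth map of manifolds. -/
def postcomp (f : N → N') (hf : ContMDiff I I' ∞ f) (σ : SmoothMapOn K I N) :
    SmoothMapOn K I' N' where
  toFun p := f (σ.toFun p)
  exists_ext := by
    obtain ⟨g, ⟨W, hW, hKW, hg⟩, hgσ⟩ := σ.exists_ext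
    exact ⟨f ∘ g, ⟨W, hW, hKW, hf.comp_contMDiffOn hg⟩, fun p => congrArg f (hgσ p)⟩

/-- Composition `σ ∘ a` with a smooth map `a` of the ambient spaces carrying `K'` into `K`. -/
def precomp (a : V' → V) (ha : ContDiff ℝ ∞ a) (hm : MapsTo a K' K) (σ : SmoothMapOn K I N) :
    SmoothMapOn K' I N where
  toFun p := σ.toFun ⟨a p, hm p.2⟩
  exists_ext := by
    obtain ⟨g, ⟨W, hW, hKW, hg⟩, hgσ⟩ := σ.exists_ext
    exact ⟨g ∘ a, ⟨a ⁻¹' W, hW.preimage ha.continuous, fun p hp => hKW (hm hp),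
      hg.comp ha.contMDiff.contMDiffOn (fun p hp => hp)⟩, fun p => hgσ ⟨a p, hm p.2⟩⟩

end SmoothMapOn

/-- The standard triangle, with vertices `(0,0)`, `(1,0)`, `(0,1)`. -/
def triangle : Set (ℝ × ℝ) := {p | 0 ≤ p.1 ∧ 0 ≤ p.2 ∧ p.1 + p.2 ≤ 1}

variable {E : Type*} [NormedAddCommGroup E] [NormedSpace ℝ E]
  {H : Type*} [TopologicalSpace H] (I : ModelWithCorners ℝ E H)
  (N : Type*) [TopologicalSpace N] [ChartedSpace H N]
  {E' : Type*} [NormedAddCommGroup E'] [NormedSpace ℝ E']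
  {H' : Type*} [TopologicalSpace H'] (I' : ModelWithCorners ℝ E' H')
  {N' : Type*} [TopologicalSpace N'] [ChartedSpace H' N']

/-- Smooth curves `[0,1] → N`, which are the smooth singular 1-simplices. -/
abbrev Curve := SmoothMapOn (Icc (0 : ℝ) 1) I N

/-- Smooth singular 2-simplices. -/
abbrev Triangle := SmoothMapOn triangle I N

variable {I N}

/-- Initial point of a curve. -/
def Curve.source (γ : Curve I N) : N := γ.toFun ⟨0, left_mem_Icc.2 zero_le_one⟩

/-- Final point of a curve. -/
def Curve.target (γ : Curve I N) : N := γ.toFun ⟨1, right_mem_Icc.2 zero_le_one⟩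

/-- The face `v₁ → v₂`. -/
def Triangle.face0 (σ : Triangle I N) : Curve I N :=
  σ.precomp (fun t : ℝ => (1 - t, t)) (by fun_prop)
    (fun t ht => show _ ∧ _ ∧ _ from ⟨sub_nonneg.2 ht.2, ht.1, by simp⟩)

/-- The face `v₀ → v₂`. -/
def Triangle.face1 (σ : Triangle I N) : Curve I N :=
  σ.precomp (fun t : ℝ => (0, t)) (by fun_prop) (fun t ht =>
    show _ ∧ _ ∧ _ from ⟨le_rfl, ht.1, by simpa using ht.2⟩)

/-- The face `v₀ → v₁`. -/
def Triangle.face2 (σ : Triangle I N) : Curve I N :=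
  σ.precomp (fun t : ℝ => (t, 0)) (by fun_prop) (fun t ht =>
    show _ ∧ _ ∧ _ from ⟨ht.1, le_rfl, by simpa using ht.2⟩)

variable (I N)

/-- Smooth singular 1-chains with integer coefficients. -/
abbrev C1 := Curve I N →₀ ℤ

/-- Smooth singular 2-chains with integer coefficients. -/
abbrev C2 := Triangle I N →₀ ℤ

/-- The boundary of 1-chains. -/
def bdry1 : C1 I N →ₗ[ℤ] (N →₀ ℤ) :=
  Finsupp.linearCombination ℤ fun γ =>
    Finsupp.single (Curve.target γ) 1 - Finsupp.single (Curve.source γ) 1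

/-- The boundary of 2-chains. -/
def bdry2 : C2 I N →ₗ[ℤ] C1 I N :=
  Finsupp.linearCombination ℤ fun σ =>
    Finsupp.single (Triangle.face0 σ) 1 - Finsupp.single (Triangle.face1 σ) 1
      + Finsupp.single (Triangle.face2 σ) 1

/-- The group of smooth 1-cycles. -/
abbrev Z1 : Submodule ℤ (C1 I N) := LinearMap.ker (bdry1 I N)

theorem bdry1_bdry2 (u : C2 I N) : bdry1 I N (bdry2 I N u) = 0 := by
  suffices h : (bdry1 I N).comp (bdry2 I N) = 0 from LinearMap.congr_fun h u
  refine Finsupp.lhom_ext' fun σ => LinearMap.ext_ring ?_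
  simp [bdry1, bdry2, Curve.source, Curve.target, Triangle.face0, Triangle.face1, Triangle.face2,
    SmoothMapOn.precomp]

/-- The boundary of 2-chains, with values in the 1-cycles. -/
def bdry2Z : C2 I N →ₗ[ℤ] Z1 I N :=
  (bdry2 I N).codRestrict (Z1 I N) (fun u => bdry1_bdry2 I N u)

/-- The first integral homology group (of smooth singular chains). -/
abbrev H1 := Z1 I N ⧸ LinearMap.range (bdry2Z I N)

variable {I N}

/-- Integral of a 1-form over a curve. -/
def curveIntegral (lam : Form I N ℝ 1) (γ : Curve I N) : ℝ :=
  ∫ t in (0 : ℝ)..1, lam (γ.ext t) (fun _ => mfderiv 𝓘(ℝ, ℝ) I γ.ext t (1 : ℝ))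

/-- Integral of a 2-form over a smooth singular triangle. -/
def triangleIntegral (η : Form I N ℝ 2) (σ : Triangle I N) : ℝ :=
  ∫ p in triangle, η (σ.ext p) ![mfderiv 𝓘(ℝ, ℝ × ℝ) I σ.ext p ((1, 0) : ℝ × ℝ),
    mfderiv 𝓘(ℝ, ℝ × ℝ) I σ.ext p ((0, 1) : ℝ × ℝ)]

/-- Integral of a 1-form over 1-chains. -/
def chainIntegral1 (lam : Form I N ℝ 1) : C1 I N →ₗ[ℤ] ℝ :=
  Finsupp.linearCombination ℤ (curveIntegral lam)

/-- Integral of a 2-form over 2-chains. -/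
def chainIntegral2 (η : Form I N ℝ 2) : C2 I N →ₗ[ℤ] ℝ :=
  Finsupp.linearCombination ℤ (triangleIntegral η)

/-- Push-forward of 1-chains along a smooth map. -/
def mapC1 (f : N → N') (hf : ContMDiff I I' ∞ f) : C1 I N →ₗ[ℤ] C1 I' N' :=
  Finsupp.lmapDomain ℤ ℤ (SmoothMapOn.postcomp f hf)

/-- `χ : Z₁(N) → ℝ/ℤ` is a differential character of order two with curvature `η ∈ Ω²(N)`. -/
structure IsDiffCharacter (χ : Z1 I N →+ UnitAddCircle) (η : Form I N ℝ 2) : Prop where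
  smooth : IsSmoothForm I η
  bdry : ∀ u : C2 I N, χ (bdry2Z I N u) = (chainIntegral2 η u : UnitAddCircle)

end Chains

/-! ## Principal bundles, connections and holonomy -/

section Principal

variable {EG : Type*} [NormedAddCommGroup EG] [NormedSpace ℝ EG]
  {HG : Type*} [TopologicalSpace HG] (IG : ModelWithCorners ℝ EG HG)
  {G : Type*} [TopologicalSpace G] [ChartedSpace HG G] [Group G]
  {EP : Type*} [NormedAddCommGroup EP] [NormedSpace ℝ EP]
  {HP : Type*} [TopologicalSpace HP] (IP : ModelWithCorners ℝ EP HP)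
  {P : Type*} [TopologicalSpace P] [ChartedSpace HP P]
  {EM : Type*} [NormedAddCommGroup EM] [NormedSpace ℝ EM]
  {HM : Type*} [TopologicalSpace HM] (IM : ModelWithCorners ℝ EM HM)
  {M : Type*} [TopologicalSpace M] [ChartedSpace HM M]

/-- `π : P → M` is a (smooth) principal `G`-bundle for the action `ρ` of `G` on `P`: the action is
smooth and preserves the fibres of the smooth map `π`, and every point of `M` has an open
neighbourhood `V` with a `G`-equivariant diffeomorphism `π⁻¹(V) ≅ V × G` over `V`. -/
structure IsPrincipalBundle (ρ : G →* Equiv.Perm P) (π : P → M) : Prop where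
  smooth_action : ContMDiff (IG.prod IP) IP ∞ (fun q : G × P => ρ q.1 q.2)
  smooth_proj : ContMDiff IP IM ∞ π
  proj_action : ∀ g p, π (ρ g p) = π p
  locally_trivial : ∀ m : M, ∃ (V : Set M) (e : OpenPartialHomeomorph P (M × G)),
    IsOpen V ∧ m ∈ V ∧ e.source = π ⁻¹' V ∧ e.target = V ×ˢ univ ∧
    ContMDiffOn IP (IM.prod IG) ∞ e e.source ∧
    ContMDiffOn (IM.prod IG) IP ∞ e.symm e.target ∧
    ∀ p ∈ π ⁻¹' V, (e p).1 = π p ∧ ∀ g, (e (ρ g p)).2 = g * (e p).2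

/-- `Ξ ∈ Ω¹(P, iℝ)` is a connection form for the action `ρ` of `U(1)` on `P`: it is smooth,
`iℝ`-valued, invariant, and takes the value `i` on the velocity of `t ↦ p · exp(it)`. -/
structure IsConnection (ρ : Circle →* Equiv.Perm P) (Ξ : Form IP P ℂ 1) : Prop where
  smooth : IsSmoothForm IP Ξ
  imaginary : ∀ p v, (Ξ p v).re = 0
  invariant : ∀ z : Circle, pullback IP IP (ρ z) Ξ = Ξ
  fundamental : ∀ p : P, Ξ (ρ (Circle.exp 0) p)
    (fun _ => mfderiv 𝓘(ℝ, ℝ) IP (fun t : ℝ => ρ (Circle.exp t) p) 0 (1 : ℝ)) = Complex.I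

/-- The curve `γ` is horizontal for `Ξ`. -/
def IsHorizontal {IP : ModelWithCorners ℝ EP HP} (Ξ : Form IP P ℂ 1) (γ : Curve IP P) : Prop :=
  ∀ t ∈ Icc (0 : ℝ) 1, Ξ (γ.ext t) (fun _ => mfderiv 𝓘(ℝ, ℝ) IP γ.ext t (1 : ℝ)) = 0

/-- `χ` is the log-holonomy `Z₁(M) → ℝ/ℤ` of the connection `Ξ` on the `U(1)`-bundle `p : P → M`.
Given any choice of a point `s m` in every fibre, the parallel transport along a curve `γ` sends
`s (γ 0)` to `s (γ 1) · exp (2πi h(γ))`, and the log-holonomy of a cycle `∑ nᵢ γᵢ` is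
`∑ nᵢ h(γᵢ)` (which does not depend on `s`). For a closed curve `γ` this says that the horizontal
lifts of `γ` satisfy `γ̄ 1 = γ̄ 0 · exp (2πi χ(γ))`. -/
def IsLogHolonomy (ρ : Circle →* Equiv.Perm P) (p : P → M) (Ξ : Form IP P ℂ 1)
    (χ : Z1 IM M →+ UnitAddCircle) : Prop :=
  ∀ s : M → P, (∀ m, p (s m) = m) → ∃ h : Curve IM M → UnitAddCircle,
    (∀ γ : Curve IM M, ∃ γ' : Curve IP P, (∀ t, p (γ'.toFun t) = γ.toFun t) ∧
      IsHorizontal Ξ γ' ∧ Curve.source γ' = s (Curve.source γ) ∧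
      Curve.target γ' = ρ (AddCircle.toCircle (h γ)) (s (Curve.target γ))) ∧
    ∀ z : Z1 IM M, χ z = Finsupp.linearCombination ℤ h (z : C1 IM M)

end Principal

/-! ## Lifts of an action to the trivial circle bundle -/

section Lift

variable {EG : Type*} [NormedAddCommGroup EG] [NormedSpace ℝ EG]
  {HG : Type*} [TopologicalSpace HG] (IG : ModelWithCorners ℝ EG HG)
  {G : Type*} [TopologicalSpace G] [ChartedSpace HG G] [Group G]
  {EN : Type*} [NormedAddCommGroup EN] [NormedSpace ℝ EN]
  {HN : Type*} [TopologicalSpace HN] (IN : ModelWithCorners ℝ EN HN)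
  {N : Type*} [TopologicalSpace N] [ChartedSpace HN N] [MulAction G N]
  {EM : Type*} [NormedAddCommGroup EM] [NormedSpace ℝ EM]
  {HM : Type*} [TopologicalSpace HM] (IM : ModelWithCorners ℝ EM HM)
  {M : Type*} [TopologicalSpace M] [ChartedSpace HM M]

/-- The Maurer–Cartan form `θ = u⁻¹ du` of `U(1)`. -/
def maurerCartan : Form (𝓡 1) Circle ℂ 1 := fun u =>
  ContinuousAlternatingMap.ofSubsingleton ℝ (TangentSpace (𝓡 1) u) ℂ (0 : Fin 1)
    ((ContinuousLinearMap.mul ℝ ℂ ((u⁻¹ : Circle) : ℂ)).comp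
      (mfderiv (𝓡 1) 𝓘(ℝ, ℂ) (fun z : Circle => (z : ℂ)) u))

/-- The connection form `Θ = θ - 2πiλ` on `N × U(1)`. -/
def connTheta (lam : Form IN N ℝ 1) : Form (IN.prod (𝓡 1)) (N × Circle) ℂ 1 := fun q =>
  pullback (𝓡 1) (IN.prod (𝓡 1)) Prod.snd maurerCartan q -
    (2 * Real.pi * Complex.I) • (Complex.ofRealCLM.compContinuousAlternatingMap
      (pullback IN (IN.prod (𝓡 1)) Prod.fst lam q))

/-- `Φ` is a lift of the action of `G` on `N` to a smooth action on `N × U(1)` by automorphisms of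
the principal `U(1)`-bundle `N × U(1) → N`. -/
structure IsLift (Φ : G →* Equiv.Perm (N × Circle)) : Prop where
  smooth : ContMDiff (IG.prod (IN.prod (𝓡 1))) (IN.prod (𝓡 1)) ∞
    (fun q : G × (N × Circle) => Φ q.1 q.2)
  covers : ∀ g q, (Φ g q).1 = g • q.1
  equivariant : ∀ g x u z, Φ g (x, u * z) = ((Φ g (x, u)).1, (Φ g (x, u)).2 * z)

/-- The orbit relation of an action on `N × U(1)`. -/
def orbitSetoid (Φ : G →* Equiv.Perm (N × Circle)) : Setoid (N × Circle) where
  r p q := ∃ g, Φ g p = q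
  iseqv :=
    { refl := fun p => ⟨1, by simp⟩
      symm := by
        rintro p q ⟨g, rfl⟩
        exact ⟨g⁻¹, by simp⟩
      trans := by
        rintro p q r ⟨g, rfl⟩ ⟨g', rfl⟩
        exact ⟨g' * g, by simp⟩ }

/-- The quotient `(N × U(1)) / G`, with the quotient topology. -/
abbrev LiftQuot (Φ : G →* Equiv.Perm (N × Circle)) := Quotient (orbitSetoid Φ)

/-- The quotient map `N × U(1) → (N × U(1)) / G`. -/
def toQuot (Φ : G →* Equiv.Perm (N × Circle)) : N × Circle → LiftQuot Φ := Quotient.mk _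

variable {IG IN}

/-- The map `(N × U(1)) / G → M` induced by a `G`-invariant map `π : N → M`. -/
def quotProj {Φ : G →* Equiv.Perm (N × Circle)} (hΦ : IsLift IG IN Φ) (π : N → M)
    (hπ : ∀ (g : G) x, π (g • x) = π x) : LiftQuot Φ → M :=
  Quotient.lift (fun q : N × Circle => π q.1) (by
    rintro p _ ⟨g, rfl⟩
    rw [hΦ.covers, hπ])

/-- The action of `U(1)` on `(N × U(1)) / G`, `[x, u] · z = [x, u z]`. -/
def quotCircleAction {Φ : G →* Equiv.Perm (N × Circle)} (hΦ : IsLift IG IN Φ) :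
    Circle →* Equiv.Perm (LiftQuot Φ) :=
  have key : ∀ (z : Circle) (p q : N × Circle), orbitSetoid Φ p q →
      orbitSetoid Φ (p.1, p.2 * z) (q.1, q.2 * z) := by
    rintro z ⟨x, u⟩ _ ⟨g, rfl⟩
    exact ⟨g, hΦ.equivariant g x u z⟩
  have mul_mk : ∀ (x : N) (u v : Circle), u = v →
      (Quotient.mk (orbitSetoid Φ) (x, u)) = Quotient.mk (orbitSetoid Φ) (x, v) := by
    rintro x u _ rfl
    rfl
  { toFun := fun z =>
      { toFun := Quotient.map (fun q : N × Circle => (q.1, q.2 * z)) (key z)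
        invFun := Quotient.map (fun q : N × Circle => (q.1, q.2 * z⁻¹)) (key z⁻¹)
        left_inv := fun a => Quotient.inductionOn a fun q => mul_mk q.1 _ _ (by simp)
        right_inv := fun a => Quotient.inductionOn a fun q => mul_mk q.1 _ _ (by simp) }
    map_one' := Equiv.ext fun a => Quotient.inductionOn a fun q => mul_mk q.1 _ _ (by simp)
    map_mul' := fun z w => Equiv.ext fun a => Quotient.inductionOn a fun q =>
      mul_mk q.1 _ _ (by rw [mul_comm z w, mul_assoc]) }

variable (IG IN)

/-- The lift `Φ` has the required property: `𝒰 = (N × U(1)) / G` is a manifold, with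
`N × U(1) → 𝒰` a principal `G`-bundle and `𝒰 → M` a principal `U(1)`-bundle, and `Θ = θ - 2πiλ`
projects onto a connection `Ξ` on `𝒰 → M` whose log-holonomy is `χ`. -/
def ProjectsToHolonomy (π : N → M) (hπ : ∀ (g : G) x, π (g • x) = π x) (lam : Form IN N ℝ 1)
    (χ : Z1 IM M →+ UnitAddCircle) (Φ : G →* Equiv.Perm (N × Circle))
    (hΦ : IsLift IG IN Φ) : Prop :=
  ∃ _ : ChartedSpace (ModelProd HM (EuclideanSpace ℝ (Fin 1))) (LiftQuot Φ),
    IsManifold (IM.prod (𝓡 1)) ∞ (LiftQuot Φ) ∧ T2Space (LiftQuot Φ) ∧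
    IsPrincipalBundle IG (IN.prod (𝓡 1)) (IM.prod (𝓡 1)) Φ (toQuot Φ) ∧
    IsPrincipalBundle (𝓡 1) (IM.prod (𝓡 1)) IM (quotCircleAction hΦ) (quotProj hΦ π hπ) ∧
    ∃ Ξ : Form (IM.prod (𝓡 1)) (LiftQuot Φ) ℂ 1,
      IsConnection (IM.prod (𝓡 1)) (quotCircleAction hΦ) Ξ ∧
      pullback (IM.prod (𝓡 1)) (IN.prod (𝓡 1)) (toQuot Φ) Ξ = connTheta IN lam ∧
      IsLogHolonomy (IM.prod (𝓡 1)) IM (quotCircleAction hΦ) (quotProj hΦ π hπ) Ξ χ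

end Lift

end CharLift

end

open CharLift

/-! Assign to a chain `c` in `N` from `x` to `φ x` the phase `∫_c λ - χ(π_* c)`. Two such chains
differ by a cycle, which bounds some `u` because `H₁(N) = 0`; Stokes and `π^*ω = dλ` give `∫_{∂u} λ
= ∫_{π_* u} ω = χ(π_* ∂u)` modulo `ℤ` (`IsDiffCharacter.cycleCompatible`). Hence the phase is a
function `α_φ(x)`, and adding chains gives the cocycle identity `α_{φψ}(x) = α_φ(ψ x) + α_ψ(x)`,
which makes the formula for `Φ` an action.

Smoothness and invariance of `Θ` come from one computation. A curve in `𝒢 × N` has two images in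
`N`, under the action and under the projection, lying over the same curve in `N/𝒢`. Adding their
difference to a chain leaves its image in `N/𝒢` unchanged, so along the curve `α` changes by the
integral of `a^*λ - pr^*λ`, where `a` is the action map and `pr` the projection
(`IsPhase.transport`, `PhaseData.toCircle_target`). Thus `exp(2πiα)` is smooth with logarithmic
derivative `2πi(a^*λ - pr^*λ)`, and this term compensates the change of `λ` in `Θ`
(`PhaseData.connTheta_lift`), even when the group element varies with the point. So `Θ` is basic.
Local sections of `N → N/𝒢` trivialize the quotient `𝒰`, and pulling `Θ` back along the resulting
sections of `N × U(1) → 𝒰` defines the connection.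

For the holonomy, lift a curve `γ` of `N/𝒢` to `N`; the path with circle component `exp(2πi ∫ λ)` is
horizontal. Comparing its end point with a chosen point of the fibre gives `∫ λ` minus a phase.
Correcting the lifts of the curves of a cycle by chains inside the comparison turns that cycle into
a cycle of `N`, where `χ ∘ π_*` is `∫ λ`; the corrections produce exactly the phases
(`CycleCompatible.eq_linearCombination`).

Uniqueness uses the holonomy condition alone on closed curves. If `γ` joins `x` to `φ x`, the
horizontal lift of `π ∘ γ` from `[x, u]` is represented by a `Θ`-horizontal path over `γ`, ending at
`(φ x, exp(2πi ∫_γ λ) u)`. It also ends at `[x, u] · exp(2πi χ(π ∘ γ))`. Freeness of the action then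
forces the value of `Φ_φ(x, u)` (`ProjectsToHolonomy.lift_apply`). -/

namespace CharLift

/-! ### Differential forms in charts and smoothness of pullbacks of 1-forms. -/

section FormsInCharts

variable {E : Type*} [NormedAddCommGroup E] [NormedSpace ℝ E]
  {H : Type*} [TopologicalSpace H] {I : ModelWithCorners ℝ E H}
  {N : Type*} [TopologicalSpace N] [ChartedSpace H N]
  {E' : Type*} [NormedAddCommGroup E'] [NormedSpace ℝ E']
  {H' : Type*} [TopologicalSpace H'] {I' : ModelWithCorners ℝ E' H'}
  {N' : Type*} [TopologicalSpace N'] [ChartedSpace H' N']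
  {F : Type*} [NormedAddCommGroup F] [NormedSpace ℝ F] {k : ℕ}

theorem isOpen_extChartAt_target_of_boundaryless [I.Boundaryless] (x₀ : N) :
    IsOpen (extChartAt I x₀).target := isOpen_extChartAt_target x₀

theorem contMDiffAt_extChartAt_symm [I.Boundaryless] [IsManifold I ∞ N] {x₀ : N} {y : E}
    (hy : y ∈ (extChartAt I x₀).target) :
    ContMDiffAt 𝓘(ℝ, E) I ∞ (extChartAt I x₀).symm y :=
  (contMDiffOn_extChartAt_symm x₀).contMDiffAt
    ((isOpen_extChartAt_target_of_boundaryless x₀).mem_nhds hy)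

theorem contMDiffAt_extChartAt_of_mem [IsManifold I ∞ N] {x₀ x : N}
    (hx : x ∈ (extChartAt I x₀).source) :
    ContMDiffAt I 𝓘(ℝ, E) ∞ (extChartAt I x₀) x :=
  contMDiffAt_extChartAt' (by rwa [extChartAt_source] at hx)

theorem mfderiv_extChartAt_symm_mfderiv_extChartAt [I.Boundaryless] [IsManifold I ∞ N]
    {x₀ x : N} (hx : x ∈ (extChartAt I x₀).source) (v : TangentSpace I x) :
    mfderiv 𝓘(ℝ, E) I (extChartAt I x₀).symm (extChartAt I x₀ x)
      (mfderiv I 𝓘(ℝ, E) (extChartAt I x₀) x v) = v := by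
  have : IsManifold I 1 N := IsManifold.of_le (n := ∞) (by simp)
  have := mfderivWithin_extChartAt_symm_comp_mfderiv_extChartAt' (I := I) hx
  rw [I.range_eq_univ, mfderivWithin_univ] at this
  exact DFunLike.congr_fun this v

theorem form_congr_point (η : Form I N F k) {x y : N} (h : x = y) (v : Fin k → E) :
    (η x : E [⋀^Fin k]→L[ℝ] F) v = (η y : E [⋀^Fin k]→L[ℝ] F) v := by
  subst h; rfl

/-- A form evaluated in terms of its expression in a chart. -/
theorem form_eq_chartRep [I.Boundaryless] [IsManifold I ∞ N] (η : Form I N F k)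
    {x₀ x : N} (hx : x ∈ (extChartAt I x₀).source) (v : Fin k → TangentSpace I x) :
    η x v = chartRep I η x₀ (extChartAt I x₀ x)
      (fun i => mfderiv I 𝓘(ℝ, E) (extChartAt I x₀) x (v i)) := by
  have h2 : chartRep I η x₀ (extChartAt I x₀ x)
      (fun i => mfderiv I 𝓘(ℝ, E) (extChartAt I x₀) x (v i)) =
      (η ((extChartAt I x₀).symm (extChartAt I x₀ x)) : E [⋀^Fin k]→L[ℝ] F) v := by
    unfold chartRep
    refine congrArg (η ((extChartAt I x₀).symm (extChartAt I x₀ x)) : E [⋀^Fin k]→L[ℝ] F) ?_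
    funext i
    exact mfderiv_extChartAt_symm_mfderiv_extChartAt hx (v i)
  rw [h2]
  exact form_congr_point η ((extChartAt I x₀).left_inv hx).symm v

theorem mdifferentiableAt_extChartAt_of_mem [IsManifold I ∞ N] {x₀ x : N}
    (hx : x ∈ (extChartAt I x₀).source) :
    MDifferentiableAt I 𝓘(ℝ, E) (extChartAt I x₀) x :=
  (contMDiffAt_extChartAt_of_mem hx).mdifferentiableAt (by simp)

/-- The pullback of a form expressed through a chart. -/
theorem form_mfderiv_eq_chartRep [I.Boundaryless] [IsManifold I ∞ N] (η : Form I N F k)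
    {f : N' → N} {p : N'} (hf : MDifferentiableAt I' I f p) {x₀ : N}
    (hx : f p ∈ (extChartAt I x₀).source) (v : Fin k → TangentSpace I' p) :
    η (f p) (fun i => mfderiv I' I f p (v i)) = chartRep I η x₀ (extChartAt I x₀ (f p))
      (fun i => mfderiv I' 𝓘(ℝ, E) (extChartAt I x₀ ∘ f) p (v i)) := by
  rw [form_eq_chartRep η hx, mfderiv_comp p (mdifferentiableAt_extChartAt_of_mem hx) hf]
  rfl

theorem chartRep_pullback_apply [I.Boundaryless] [IsManifold I ∞ N] [I'.Boundaryless]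
    [IsManifold I' ∞ N'] (η : Form I N F k) {f : N' → N} {p₀ : N'} {y : E'}
    (hy : y ∈ (extChartAt I' p₀).target)
    (hf : MDifferentiableAt I' I f ((extChartAt I' p₀).symm y)) {x₀ : N}
    (hx : f ((extChartAt I' p₀).symm y) ∈ (extChartAt I x₀).source) :
    chartRep I' (pullback I I' f η) p₀ y =
      (chartRep I η x₀ (extChartAt I x₀ (f ((extChartAt I' p₀).symm y)))).compContinuousLinearMap
        (fderiv ℝ (extChartAt I x₀ ∘ f ∘ (extChartAt I' p₀).symm) y) := by
  ext v
  have hs : MDifferentiableAt 𝓘(ℝ, E') I' (extChartAt I' p₀).symm y :=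
    (contMDiffAt_extChartAt_symm hy).mdifferentiableAt (by simp)
  have := form_mfderiv_eq_chartRep η (hf.comp y hs) hx v
  rw [mfderiv_comp y hf hs, mfderiv_eq_fderiv] at this
  exact this

/-- A form is smooth at the point `x`, in every chart around it. -/
def SmoothFormAt (I : ModelWithCorners ℝ E H) (η : Form I N F k) (x : N) : Prop :=
  ∀ x₀ : N, x ∈ (extChartAt I x₀).source → ContDiffAt ℝ ∞ (chartRep I η x₀) (extChartAt I x₀ x)

theorem isSmoothForm_iff [I.Boundaryless] {η : Form I N F k} :
    IsSmoothForm I η ↔ ∀ x, SmoothFormAt I η x := by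
  constructor
  · intro h x x₀ hx
    exact (h x₀).contDiffAt ((isOpen_extChartAt_target_of_boundaryless x₀).mem_nhds
      ((extChartAt I x₀).map_source hx))
  · intro h x₀ y hy
    have := h _ x₀ ((extChartAt I x₀).map_target hy)
    rw [(extChartAt I x₀).right_inv hy] at this
    exact this.contDiffWithinAt

/-- Alternating forms of degree one are isometric to covectors, and there the pullback is a
composition of continuous linear maps, which is smooth in both arguments. -/
theorem contDiffAt_compContinuousLinearMap_one {V : Type*} [NormedAddCommGroup V]
    [NormedSpace ℝ V] {ζ : V → E [⋀^Fin 1]→L[ℝ] F} {g : V → E' →L[ℝ] E} {y : V}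
    (hζ : ContDiffAt ℝ ∞ ζ y) (hg : ContDiffAt ℝ ∞ g y) :
    ContDiffAt ℝ ∞ (fun y => (ζ y).compContinuousLinearMap (g y)) y := by
  let e := ContinuousAlternatingMap.ofSubsingletonLIE (𝕜 := ℝ) (E := E) (F := F) (0 : Fin 1)
  let e' := ContinuousAlternatingMap.ofSubsingletonLIE (𝕜 := ℝ) (E := E') (F := F) (0 : Fin 1)
  have h : ContDiffAt ℝ ∞ (fun y => e' ((e.symm (ζ y)).comp (g y))) y :=
    e'.contDiff.contDiffAt.comp y
      (((e.symm.contDiff.contDiffAt.comp y hζ)).clm_comp hg)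
  convert h using 1
  funext z
  ext v
  have : v = fun _ => v 0 := by funext i; rw [Subsingleton.elim i 0]
  rw [this]
  rfl

/-- The pullback of a smooth 1-form is smooth. -/
theorem SmoothFormAt.pullback [I.Boundaryless] [IsManifold I ∞ N] [I'.Boundaryless]
    [IsManifold I' ∞ N'] {η : Form I N F 1} {f : N' → N} {p : N'}
    (hη : SmoothFormAt I η (f p)) (hf : ContMDiffAt I' I ∞ f p) {ξ : Form I' N' F 1}
    (hξ : ∀ᶠ q in 𝓝 p, ξ q = pullback I I' f η q) : SmoothFormAt I' ξ p := by
  intro p₀ hp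
  set φ := extChartAt I' p₀
  have hy : φ p ∈ φ.target := φ.map_source hp
  have hsymm : ContMDiffAt 𝓘(ℝ, E') I' ∞ φ.symm (φ p) := contMDiffAt_extChartAt_symm hy
  have hφp : φ.symm (φ p) = p := φ.left_inv hp
  have htend : Filter.Tendsto φ.symm (𝓝 (φ p)) (𝓝 p) := by
    have := hsymm.continuousAt.tendsto
    rwa [hφp] at this
  -- Smoothness of infinite order at a point gives a neighbourhood for each finite order only; order
  -- one suffices for `f` to be differentiable near `p`.
  obtain ⟨W, hW, hWf⟩ := 
    (contMDiffAt_iff_contMDiffOn_nhds (n := 1) (by simp)).1 (hf.of_le (by simp))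
  have hW' : ∀ᶠ q in 𝓝 p, MDifferentiableAt I' I f q := by
    filter_upwards [eventually_mem_nhds_iff.2 hW] with q hq
    exact (hWf.contMDiffAt hq).mdifferentiableAt (by simp)
  have hchart : ∀ᶠ q in 𝓝 p, f q ∈ (extChartAt I (f p)).source :=
    hf.continuousAt (extChartAt_source_mem_nhds (f p))
  have hev : ∀ᶠ y in 𝓝 (φ p), chartRep I' ξ p₀ y =
      (chartRep I η (f p) (extChartAt I (f p) (f (φ.symm y)))).compContinuousLinearMap
        (fderiv ℝ (extChartAt I (f p) ∘ f ∘ φ.symm) y) := by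
    filter_upwards [htend.eventually hW', htend.eventually hchart, htend.eventually hξ,
      (isOpen_extChartAt_target_of_boundaryless p₀).mem_nhds hy] with y h1 h2 h3 h4
    rw [← chartRep_pullback_apply η h4 h1 h2]
    unfold chartRep
    rw [h3]
  have hcomp : ContDiffAt ℝ ∞ (extChartAt I (f p) ∘ f ∘ φ.symm) (φ p) := by
    rw [← contMDiffAt_iff_contDiffAt]
    refine ContMDiffAt.comp (I' := I) (φ p) ?_ (ContMDiffAt.comp (I' := I') (φ p) ?_ hsymm)
    · simp only [comp_apply, hφp]
      exact contMDiffAt_extChartAt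
    · rwa [hφp]
  refine ContDiffAt.congr_of_eventuallyEq ?_ hev
  have h1 := hη (f p) (mem_extChartAt_source (f p))
  have h2 : ContDiffAt ℝ ∞ (chartRep I η (f p))
      ((extChartAt I (f p) ∘ f ∘ φ.symm) (φ p)) := by
    simpa only [comp_apply, hφp] using h1
  exact contDiffAt_compContinuousLinearMap_one (h2.comp (φ p) hcomp)
    (hcomp.fderiv_right (m := ∞) (by simp))

theorem IsSmoothForm.pullback [I.Boundaryless] [IsManifold I ∞ N] [I'.Boundaryless]
    [IsManifold I' ∞ N'] {η : Form I N F 1} {f : N' → N}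
    (hη : IsSmoothForm I η) (hf : ContMDiff I' I ∞ f) :
    IsSmoothForm I' (CharLift.pullback I I' f η) :=
  isSmoothForm_iff.2 fun p => (isSmoothForm_iff.1 hη (f p)).pullback (hf p)
    (Filter.Eventually.of_forall fun _ => rfl)

theorem IsSmoothForm.sub {η ξ : Form I N F 1}
    (hη : IsSmoothForm I η) (hξ : IsSmoothForm I ξ) : IsSmoothForm I (η - ξ) := fun x₀ =>
  (ContDiffOn.sub (hη x₀) (hξ x₀)).congr fun y _ => by ext v; rfl

theorem IsSmoothForm.clm_comp {F' : Type*} [NormedAddCommGroup F'] [NormedSpace ℝ F']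
    {η : Form I N F 1} (hη : IsSmoothForm I η) (L : F →L[ℝ] F') :
    IsSmoothForm I (fun x => L.compContinuousAlternatingMap (η x)) := fun x₀ => by
  have := (ContinuousLinearMap.compContinuousAlternatingMapCLM ℝ E F F' (Fin 1) L).contDiff.comp_contDiffOn (hη x₀)
  exact this.congr fun y _ => by ext v; rfl

end FormsInCharts

end CharLift

namespace CharLift

/-! ### Fubini and Stokes on the standard triangle. -/

section PlaneStokes

theorem isCompact_triangle : IsCompact triangle := by
  refine (isCompact_Icc (a := ((0, 0) : ℝ × ℝ)) (b := (1, 1))).of_isClosed_subset ?_ ?_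
  · have h1 : IsClosed {p : ℝ × ℝ | 0 ≤ p.1} := isClosed_le continuous_const continuous_fst
    have h2 : IsClosed {p : ℝ × ℝ | 0 ≤ p.2} := isClosed_le continuous_const continuous_snd
    have h3 : IsClosed {p : ℝ × ℝ | p.1 + p.2 ≤ 1} :=
      isClosed_le (continuous_fst.add continuous_snd) continuous_const
    exact h1.inter (h2.inter h3)
  · rintro ⟨x, y⟩ ⟨h1, h2, h3⟩
    simp only at h1 h2 h3
    exact ⟨⟨h1, h2⟩, ⟨by simp only; linarith, by simp only; linarith⟩⟩

theorem integrableOn_triangle {g : ℝ × ℝ → ℝ} (hg : ContinuousOn g triangle) :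
    IntegrableOn g triangle :=
  hg.integrableOn_compact isCompact_triangle

theorem setIntegral_triangle {g : ℝ × ℝ → ℝ} (hg : ContinuousOn g triangle) :
    ∫ p in triangle, g p = ∫ x in (0 : ℝ)..1, ∫ y in (0 : ℝ)..(1 - x), g (x, y) := by
  have hm : MeasurableSet triangle := isCompact_triangle.isClosed.measurableSet
  rw [← integral_indicator hm, Measure.volume_eq_prod, integral_prod]
  · rw [intervalIntegral.integral_of_le zero_le_one, ← integral_Icc_eq_integral_Ioc,
      ← integral_indicator measurableSet_Icc]
    refine integral_congr_ae (Filter.Eventually.of_forall fun x => ?_)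
    by_cases hx : x ∈ Icc (0 : ℝ) 1
    · rw [indicator_of_mem hx, intervalIntegral.integral_of_le (by linarith [hx.2]),
        ← integral_Icc_eq_integral_Ioc, ← integral_indicator measurableSet_Icc]
      refine integral_congr_ae (Filter.Eventually.of_forall fun y => ?_)
      by_cases hy : y ∈ Icc 0 (1 - x)
      · simp only
        rw [indicator_of_mem hy, indicator_of_mem]
        exact ⟨hx.1, hy.1, by simp only; linarith [hy.2]⟩
      · simp only
        rw [indicator_of_notMem hy, indicator_of_notMem]
        rintro ⟨h1, h2, h3⟩
        exact hy ⟨h2, by simp only at h3; linarith⟩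
    · rw [indicator_of_notMem hx]
      have : ∀ y, triangle.indicator g (x, y) = 0 := fun y => by
        rw [indicator_of_notMem]
        rintro ⟨h1, h2, h3⟩
        simp only at h1 h2 h3
        exact hx ⟨h1, by linarith⟩
      simp [this]
  · rw [← Measure.volume_eq_prod]
    exact (integrable_indicator_iff hm).2 (integrableOn_triangle hg)

theorem swap_preimage_triangle : (Prod.swap : ℝ × ℝ → ℝ × ℝ) ⁻¹' triangle = triangle := by
  ext ⟨x, y⟩
  constructor <;> rintro ⟨h1, h2, h3⟩ <;> simp only [Prod.swap_prod_mk] at h1 h2 h3 <;>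
    exact ⟨h2, h1, by simp only [Prod.swap_prod_mk]; linarith⟩

theorem setIntegral_triangle_symm {g : ℝ × ℝ → ℝ} (hg : ContinuousOn g triangle) :
    ∫ p in triangle, g p = ∫ y in (0 : ℝ)..1, ∫ x in (0 : ℝ)..(1 - y), g (x, y) := by
  have h := (Measure.measurePreserving_swap (μ := (volume : Measure ℝ))
    (ν := (volume : Measure ℝ))).setIntegral_preimage_emb
      (MeasurableEquiv.prodComm : ℝ × ℝ ≃ᵐ ℝ × ℝ).measurableEmbedding g triangle
  have h2 := swap_preimage_triangle
  rw [h2] at h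
  rw [Measure.volume_eq_prod, ← h, ← Measure.volume_eq_prod]
  refine setIntegral_triangle (hg.comp continuous_swap.continuousOn ?_)
  intro p hp
  exact h2.symm.subset hp

/-- Stokes' theorem on the standard triangle. -/
theorem stokes_triangle_plane {W : Set (ℝ × ℝ)} (hW : IsOpen W) (hWt : triangle ⊆ W)
    {a : ℝ × ℝ → (ℝ × ℝ) →L[ℝ] ℝ} (ha : ContDiffOn ℝ 1 a W) :
    ∫ p in triangle, (fderiv ℝ a p (1, 0) (0, 1) - fderiv ℝ a p (0, 1) (1, 0)) =
      (∫ t in (0 : ℝ)..1, a (1 - t, t) (-1, 1)) - (∫ t in (0 : ℝ)..1, a (0, t) (0, 1)) +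
        ∫ t in (0 : ℝ)..1, a (t, 0) (1, 0) := by
  have hd : ContinuousOn (fderiv ℝ a) triangle := (ha.continuousOn_fderiv_of_isOpen hW le_rfl).mono hWt
  have hac : ContinuousOn a triangle := ha.continuousOn.mono hWt
  have hdc : ∀ v w : ℝ × ℝ, ContinuousOn (fun p => fderiv ℝ a p v w) triangle := fun v w =>
    (hd.clm_apply continuousOn_const).clm_apply continuousOn_const
  have hda : ∀ p ∈ triangle, ∀ w, HasFDerivAt (fun p => a p w)
      ((ContinuousLinearMap.apply ℝ ℝ w).comp (fderiv ℝ a p)) p := fun p hp w =>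
    (ContinuousLinearMap.apply ℝ ℝ w).hasFDerivAt.comp p
      ((ha.contDiffAt (hW.mem_nhds (hWt hp))).differentiableAt (by simp)).hasFDerivAt
  -- Each of the two terms is integrated first in the variable of its partial derivative, so that
  -- the inner integral is a difference of boundary values.
  rw [integral_sub (integrableOn_triangle (hdc _ _)) (integrableOn_triangle (hdc _ _)),
    setIntegral_triangle_symm (hdc _ _), setIntegral_triangle (hdc _ _)]
  have hmk : ∀ u ∈ Icc (0 : ℝ) 1, ∀ s ∈ Icc (0 : ℝ) (1 - u), (s, u) ∈ triangle ∧ (u, s) ∈ triangle :=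
    fun u hu s hs => ⟨⟨hs.1, hu.1, by simp only; linarith [hs.2]⟩,
      ⟨hu.1, hs.1, by simp only; linarith [hs.2]⟩⟩
  have h1 : ∀ y ∈ Icc (0 : ℝ) 1, ∫ x in (0 : ℝ)..(1 - y), fderiv ℝ a (x, y) (1, 0) (0, 1) =
      a (1 - y, y) (0, 1) - a (0, y) (0, 1) := by
    intro y hy
    have hsub : uIcc (0 : ℝ) (1 - y) = Icc 0 (1 - y) := uIcc_of_le (by linarith [hy.2])
    refine intervalIntegral.integral_eq_sub_of_hasDerivAt (f := fun x => a (x, y) (0, 1)) ?_ ?_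
    · intro x hx
      rw [hsub] at hx
      have h := (hda _ (hmk y hy x hx).1 (0, 1)).comp_hasDerivAt x
        ((hasDerivAt_id x).prodMk (hasDerivAt_const x y))
      exact h
    · refine ContinuousOn.intervalIntegrable ?_
      rw [hsub]
      exact (hdc (1, 0) (0, 1)).comp (by fun_prop) fun x hx => (hmk y hy x hx).1
  have h2 : ∀ x ∈ Icc (0 : ℝ) 1, ∫ y in (0 : ℝ)..(1 - x), fderiv ℝ a (x, y) (0, 1) (1, 0) =
      a (x, 1 - x) (1, 0) - a (x, 0) (1, 0) := by
    intro x hx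
    have hsub : uIcc (0 : ℝ) (1 - x) = Icc 0 (1 - x) := uIcc_of_le (by linarith [hx.2])
    refine intervalIntegral.integral_eq_sub_of_hasDerivAt (f := fun y => a (x, y) (1, 0)) ?_ ?_
    · intro y hy
      rw [hsub] at hy
      have h := (hda _ (hmk x hx y hy).2 (1, 0)).comp_hasDerivAt y
        ((hasDerivAt_const y x).prodMk (hasDerivAt_id y))
      exact h
    · refine ContinuousOn.intervalIntegrable ?_
      rw [hsub]
      exact (hdc (0, 1) (1, 0)).comp (by fun_prop) fun y hy => (hmk x hx y hy).2
  have huI : uIcc (0 : ℝ) 1 = Icc 0 1 := uIcc_of_le zero_le_one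
  rw [intervalIntegral.integral_congr (g := fun y => a (1 - y, y) (0, 1) - a (0, y) (0, 1))
      fun y hy => h1 y (huI ▸ hy),
    intervalIntegral.integral_congr (g := fun x => a (x, 1 - x) (1, 0) - a (x, 0) (1, 0))
      fun x hx => h2 x (huI ▸ hx)]
  have hint : ∀ (c : ℝ → ℝ × ℝ) (w : ℝ × ℝ), Continuous c → (∀ t ∈ Icc (0 : ℝ) 1, c t ∈ triangle) →
      IntervalIntegrable (fun t => a (c t) w) volume 0 1 := fun c w hc hct => by
    refine ContinuousOn.intervalIntegrable ?_
    rw [huI]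
    exact (hac.comp hc.continuousOn hct).clm_apply continuousOn_const
  have e0 : ∀ w, IntervalIntegrable (fun t : ℝ => a (1 - t, t) w) volume 0 1 := fun w =>
    hint _ w (by fun_prop) fun t ht => ⟨by simp only; linarith [ht.2], ht.1, by simp⟩
  have e1 : ∀ w, IntervalIntegrable (fun t : ℝ => a (0, t) w) volume 0 1 := fun w =>
    hint _ w (by fun_prop) fun t ht => ⟨le_rfl, ht.1, by simpa using ht.2⟩
  have e2 : ∀ w, IntervalIntegrable (fun t : ℝ => a (t, 0) w) volume 0 1 := fun w =>
    hint _ w (by fun_prop) fun t ht => ⟨ht.1, le_rfl, by simpa using ht.2⟩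
  have e3 : ∀ w, IntervalIntegrable (fun t : ℝ => a (t, 1 - t) w) volume 0 1 := fun w =>
    hint _ w (by fun_prop) fun t ht => ⟨ht.1, by simp only; linarith [ht.2], by simp⟩
  -- The two orders of integration run through the hypotenuse in opposite directions.
  have hflip : ∫ t in (0 : ℝ)..1, a (t, 1 - t) (1, 0) = ∫ t in (0 : ℝ)..1, a (1 - t, t) (1, 0) := by
    have := intervalIntegral.integral_comp_sub_left (a := (0 : ℝ)) (b := 1)
      (fun t => a (1 - t, t) (1, 0)) 1
    simpa using this
  rw [intervalIntegral.integral_sub (e0 _) (e1 _), intervalIntegral.integral_sub (e3 _) (e2 _), hflip]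
  have hsplit : ∫ t in (0 : ℝ)..1, a (1 - t, t) (-1, 1) =
      (∫ t in (0 : ℝ)..1, a (1 - t, t) (0, 1)) - ∫ t in (0 : ℝ)..1, a (1 - t, t) (1, 0) := by
    rw [← intervalIntegral.integral_sub (e0 _) (e0 _)]
    refine intervalIntegral.integral_congr fun t _ => ?_
    rw [← map_sub]
    simp
  rw [hsplit]
  ring

end PlaneStokes

end CharLift

namespace CharLift

/-! ### Independence of the chosen extension of a smooth simplex. -/

section SmoothMapsOnConvexSets

variable {V : Type*} [NormedAddCommGroup V] [NormedSpace ℝ V] {K : Set V}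
  {E : Type*} [NormedAddCommGroup E] [NormedSpace ℝ E]
  {H : Type*} [TopologicalSpace H] {I : ModelWithCorners ℝ E H}
  {N : Type*} [TopologicalSpace N] [ChartedSpace H N]
  {E' : Type*} [NormedAddCommGroup E'] [NormedSpace ℝ E']
  {H' : Type*} [TopologicalSpace H'] {I' : ModelWithCorners ℝ E' H'}
  {N' : Type*} [TopologicalSpace N'] [ChartedSpace H' N']

namespace SmoothMapOn

/-- The extension enters a simplex only as an existence statement, so simplices with the same values
are equal. This makes the cancellation of simplices in free abelian groups meaningful. -/
theorem toFun_injective : Injective (toFun : SmoothMapOn K I N → K → N) := by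
  rintro ⟨f, hf⟩ ⟨g, hg⟩ h
  cases h
  rfl

theorem ext_apply (σ : SmoothMapOn K I N) (p : K) : σ.ext p = σ.toFun p :=
  σ.exists_ext.choose_spec.2 p

theorem exists_open_contMDiffOn_ext (σ : SmoothMapOn K I N) :
    ∃ W : Set V, IsOpen W ∧ K ⊆ W ∧ ContMDiffOn 𝓘(ℝ, V) I ∞ σ.ext W :=
  σ.exists_ext.choose_spec.1

theorem contMDiffAt_ext (σ : SmoothMapOn K I N) {p : V} (hp : p ∈ K) :
    ContMDiffAt 𝓘(ℝ, V) I ∞ σ.ext p := by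
  obtain ⟨W, hW, hKW, h⟩ := σ.exists_open_contMDiffOn_ext
  exact h.contMDiffAt (hW.mem_nhds (hKW hp))

theorem mdifferentiableAt_ext (σ : SmoothMapOn K I N) {p : V} (hp : p ∈ K) :
    MDifferentiableAt 𝓘(ℝ, V) I σ.ext p :=
  (σ.contMDiffAt_ext hp).mdifferentiableAt (by simp)

/-- The restriction to `K` of a map smooth near `K`. -/
def ofContMDiffOn (f : V → N) (W : Set V) (hW : IsOpen W) (hKW : K ⊆ W)
    (hf : ContMDiffOn 𝓘(ℝ, V) I ∞ f W) : SmoothMapOn K I N where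
  toFun p := f p
  exists_ext := ⟨f, ⟨W, hW, hKW, hf⟩, fun _ => rfl⟩

end SmoothMapOn

/-- A convex set with interior points has unique derivatives at all its points, those of the
boundary included, so the values on `K` determine the full derivative. -/
theorem mfderiv_eq_of_eqOn_convex (hK : Convex ℝ K) (hK' : (interior K).Nonempty) {f g : V → N}
    {p : V} (hp : p ∈ K) (hf : MDifferentiableAt 𝓘(ℝ, V) I f p)
    (hg : MDifferentiableAt 𝓘(ℝ, V) I g p) (hfg : EqOn f g K) (v : V) :
    (mfderiv 𝓘(ℝ, V) I f p v : E) = mfderiv 𝓘(ℝ, V) I g p v := by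
  have hu : UniqueMDiffWithinAt 𝓘(ℝ, V) K p :=
    (uniqueDiffOn_convex hK hK' p hp).uniqueMDiffWithinAt
  rw [← mfderivWithin_eq_mfderiv hu hf, ← mfderivWithin_eq_mfderiv hu hg,
    mfderivWithin_congr (I := 𝓘(ℝ, V)) (I' := I) hfg (hfg hp)]
  rfl

/-- The type of the vectors depends on the base point, which blocks rewriting the latter alone. With
the vectors read in the model space `E`, both can be replaced at once. -/
theorem form_congr {k : ℕ} {F : Type*} [NormedAddCommGroup F] [NormedSpace ℝ F]
    (η : Form I N F k) {x y : N} (h : x = y) {v w : Fin k → E}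
    (hv : v = w) : (η x : E [⋀^Fin k]→L[ℝ] F) v = (η y : E [⋀^Fin k]→L[ℝ] F) w := by
  subst h hv; rfl

theorem convex_triangle : Convex ℝ triangle := by
  rintro ⟨a, b⟩ ⟨h1, h2, h3⟩ ⟨c, d⟩ ⟨h4, h5, h6⟩ s t hs ht hst
  simp only at h1 h2 h3 h4 h5 h6
  refine ⟨?_, ?_, ?_⟩ <;> simp only [Prod.fst_add, Prod.smul_fst, Prod.snd_add, Prod.smul_snd,
    smul_eq_mul]
  · positivity
  · positivity
  · nlinarith

theorem interior_triangle_nonempty : (interior triangle).Nonempty := by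
  refine ⟨(1 / 4, 1 / 4), mem_interior_iff_mem_nhds.2 ?_⟩
  refine Filter.mem_of_superset (prod_mem_nhds (Icc_mem_nhds (show (0 : ℝ) < 1 / 4 by norm_num)
    (show (1 / 4 : ℝ) < 1 / 2 by norm_num)) (Icc_mem_nhds (show (0 : ℝ) < 1 / 4 by norm_num)
    (show (1 / 4 : ℝ) < 1 / 2 by norm_num))) ?_
  rintro ⟨x, y⟩ ⟨hx, hy⟩
  exact ⟨hx.1, hy.1, by linarith [hx.2, hy.2]⟩

theorem interior_unit_Icc_nonempty : (interior (Icc (0 : ℝ) 1)).Nonempty := by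
  rw [interior_Icc]; exact ⟨1 / 2, by norm_num, by norm_num⟩

/-- The velocity of a curve computed with any extension. -/
theorem Curve.mfderiv_ext_eq (γ : Curve I N) {f : ℝ → N}
    (h : ∀ t : Icc (0 : ℝ) 1, f t = γ.toFun t) {t : ℝ} (ht : t ∈ Icc (0 : ℝ) 1)
    (hf : MDifferentiableAt 𝓘(ℝ, ℝ) I f t) :
    (mfderiv 𝓘(ℝ, ℝ) I γ.ext t (1 : ℝ) : E) = mfderiv 𝓘(ℝ, ℝ) I f t (1 : ℝ) :=
  mfderiv_eq_of_eqOn_convex (convex_Icc 0 1) interior_unit_Icc_nonempty ht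
    (γ.mdifferentiableAt_ext ht) hf (fun s hs => (γ.ext_apply ⟨s, hs⟩).trans (h ⟨s, hs⟩).symm) _

/-- Needed because the chosen extension of a composite curve need not be the composite of the chosen
extensions. -/
theorem curveIntegral_eq (lam : Form I N ℝ 1) (γ : Curve I N) {f : ℝ → N}
    (hf : ∀ t ∈ Icc (0 : ℝ) 1, MDifferentiableAt 𝓘(ℝ, ℝ) I f t)
    (h : ∀ t : Icc (0 : ℝ) 1, f t = γ.toFun t) :
    curveIntegral lam γ = ∫ t in (0 : ℝ)..1, lam (f t) (fun _ => mfderiv 𝓘(ℝ, ℝ) I f t (1 : ℝ)) := by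
  refine intervalIntegral.integral_congr fun t ht => ?_
  rw [uIcc_of_le zero_le_one] at ht
  exact form_congr lam ((γ.ext_apply ⟨t, ht⟩).trans (h ⟨t, ht⟩).symm)
    (funext fun _ => γ.mfderiv_ext_eq h ht (hf t ht))

theorem triangleIntegral_eq (η : Form I N ℝ 2) (σ : Triangle I N) {f : ℝ × ℝ → N}
    (hf : ∀ p ∈ triangle, MDifferentiableAt 𝓘(ℝ, ℝ × ℝ) I f p)
    (h : ∀ p : triangle, f p = σ.toFun p) :
    triangleIntegral η σ = ∫ p in triangle, η (f p) ![mfderiv 𝓘(ℝ, ℝ × ℝ) I f p ((1, 0) : ℝ × ℝ),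
    mfderiv 𝓘(ℝ, ℝ × ℝ) I f p ((0, 1) : ℝ × ℝ)] := by
  refine setIntegral_congr_fun isCompact_triangle.isClosed.measurableSet fun p hp => ?_
  have hd : ∀ v : ℝ × ℝ, (mfderiv 𝓘(ℝ, ℝ × ℝ) I σ.ext p v : E) = mfderiv 𝓘(ℝ, ℝ × ℝ) I f p v :=
    mfderiv_eq_of_eqOn_convex convex_triangle interior_triangle_nonempty hp
      (σ.mdifferentiableAt_ext hp) (hf p hp)
      (fun s hs => (σ.ext_apply ⟨s, hs⟩).trans (h ⟨s, hs⟩).symm)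
  refine form_congr η ((σ.ext_apply ⟨p, hp⟩).trans (h ⟨p, hp⟩).symm) ?_
  funext i
  fin_cases i
  exacts [hd _, hd _]

theorem curveIntegral_postcomp (lam : Form I N ℝ 1) (γ : Curve I' N') (f : N' → N)
    (hf : ContMDiff I' I ∞ f) :
    curveIntegral lam (γ.postcomp f hf) = curveIntegral (pullback I I' f lam) γ := by
  have hd : ∀ x, MDifferentiableAt I' I f x := fun x => (hf x).mdifferentiableAt (by simp)
  rw [curveIntegral_eq lam (γ.postcomp f hf) (f := f ∘ γ.ext)]
  · refine intervalIntegral.integral_congr fun t ht => ?_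
    rw [uIcc_of_le zero_le_one] at ht
    refine form_congr lam rfl (funext fun _ => ?_)
    rw [mfderiv_comp t (hd _) (γ.mdifferentiableAt_ext ht)]
    rfl
  · exact fun t ht => (hd _).comp t (γ.mdifferentiableAt_ext ht)
  · exact fun t => congrArg f (γ.ext_apply t)

theorem triangleIntegral_postcomp (η : Form I N ℝ 2) (σ : Triangle I' N') (f : N' → N)
    (hf : ContMDiff I' I ∞ f) :
    triangleIntegral η (σ.postcomp f hf) = triangleIntegral (pullback I I' f η) σ := by
  have hd : ∀ x, MDifferentiableAt I' I f x := fun x => (hf x).mdifferentiableAt (by simp)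
  rw [triangleIntegral_eq η (σ.postcomp f hf) (f := f ∘ σ.ext)]
  · refine setIntegral_congr_fun isCompact_triangle.isClosed.measurableSet fun p hp => ?_
    refine form_congr η rfl (funext fun i => ?_)
    rw [mfderiv_comp p (hd _) (σ.mdifferentiableAt_ext hp)]
    fin_cases i <;> rfl
  · exact fun t ht => (hd _).comp t (σ.mdifferentiableAt_ext ht)
  · exact fun t => congrArg f (σ.ext_apply t)

end SmoothMapsOnConvexSets

/-! ### Stokes for smooth singular triangles. -/

section Stokes

set_option linter.unusedSectionVars false

variable {V : Type*} [NormedAddCommGroup V] [NormedSpace ℝ V]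
  {E : Type*} [NormedAddCommGroup E] [NormedSpace ℝ E]
  {H : Type*} [TopologicalSpace H] {I : ModelWithCorners ℝ E H} [I.Boundaryless]
  {N : Type*} [TopologicalSpace N] [ChartedSpace H N] [IsManifold I ∞ N]

/-- The pullback of a form to a normed space. -/
noncomputable def pullbackVec {k : ℕ} (s : V → N) (lam : Form I N ℝ k) (p : V) : V [⋀^Fin k]→L[ℝ] ℝ :=
  pullback I 𝓘(ℝ, V) s lam p

theorem chartRep_vectorSpace {F : Type*} [NormedAddCommGroup F] [NormedSpace ℝ F] {k : ℕ}
    (a : Form 𝓘(ℝ, V) V F k) (x₀ y : V) :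
    chartRep 𝓘(ℝ, V) a x₀ y = (a y : V [⋀^Fin k]→L[ℝ] F) := by
  ext v
  simp only [chartRep, mfld_simps]
  refine congrArg (a y : V [⋀^Fin k]→L[ℝ] F) (funext fun i => ?_)
  have : mfderiv 𝓘(ℝ, V) 𝓘(ℝ, V) (fun x : V => x) y = ContinuousLinearMap.id ℝ V := mfderiv_id
  exact DFunLike.congr_fun this (v i)

theorem contDiffAt_pullbackVec {lam : Form I N ℝ 1} (hlam : IsSmoothForm I lam) {s : V → N} {p : V}
    (hs : ContMDiffAt 𝓘(ℝ, V) I ∞ s p) : ContDiffAt ℝ ∞ (pullbackVec s lam) p := by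
  have h := (isSmoothForm_iff.1 hlam (s p)).pullback hs (Filter.Eventually.of_forall fun _ => rfl) p
    (mem_extChartAt_source p)
  simp only [mfld_simps] at h
  exact h.congr_of_eventuallyEq (Filter.Eventually.of_forall fun y =>
    (chartRep_vectorSpace (pullback I 𝓘(ℝ, V) s lam) p y).symm)

/-- The single chart at `s p` expresses the pullback on a whole neighbourhood, so the formula may be
differentiated at `p`. -/
theorem pullbackVec_eventuallyEq {k : ℕ} {lam : Form I N ℝ k} {s : V → N} {p : V}
    (hs : ContMDiffAt 𝓘(ℝ, V) I ∞ s p) :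
    pullbackVec s lam =ᶠ[𝓝 p] fun q =>
      (chartRep I lam (s p) ((extChartAt I (s p) ∘ s) q)).compContinuousLinearMap
        (fderiv ℝ (extChartAt I (s p) ∘ s) q) := by
  obtain ⟨W, hW, hWs⟩ :=
    (contMDiffAt_iff_contMDiffOn_nhds (n := 1) (by simp)).1 (hs.of_le (by simp))
  filter_upwards [eventually_mem_nhds_iff.2 hW,
    hs.continuousAt (extChartAt_source_mem_nhds (I := I) (s p))] with q hq hq'
  ext v
  have := form_mfderiv_eq_chartRep lam ((hWs.contMDiffAt hq).mdifferentiableAt (by simp)) hq' v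
  rw [mfderiv_eq_fderiv] at this
  exact this

/-- The exterior derivative commutes with pullback to a normed space. -/
theorem dForm_mfderiv {lam : Form I N ℝ 1} (hlam : IsSmoothForm I lam) {s : V → N} {p : V}
    (hs : ContMDiffAt 𝓘(ℝ, V) I ∞ s p) (v : Fin 2 → V) :
    dForm I lam (s p) (fun i => mfderiv 𝓘(ℝ, V) I s p (v i)) = extDeriv (pullbackVec s lam) p v := by
  have hc : ContDiffAt ℝ ∞ (extChartAt I (s p) ∘ s) p := by
    rw [← contMDiffAt_iff_contDiffAt]
    exact contMDiffAt_extChartAt.comp p hs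
  have hl : DifferentiableAt ℝ (chartRep I lam (s p)) ((extChartAt I (s p) ∘ s) p) :=
    ((isSmoothForm_iff.1 hlam (s p)) (s p) (mem_extChartAt_source _)).differentiableAt (by simp)
  -- `dForm` at `s p` is defined through the chart at `s p`, the same one as on the other side; the
  -- claim becomes the compatibility of `extDeriv` with pullback between normed spaces.
  rw [(pullbackVec_eventuallyEq (lam := lam) hs).extDeriv_eq,
    extDeriv_pullback hl (hc.of_le (m := 2) (WithTop.coe_le_coe.2 (le_top : (2 : ℕ∞) ≤ ⊤))) (by simp)]
  unfold dForm
  simp only [ContinuousAlternatingMap.compContinuousLinearMap_apply]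
  refine congrArg (extDeriv (chartRep I lam (s p)) (extChartAt I (s p) (s p))) (funext fun i => ?_)
  have := mfderiv_comp p (mdifferentiableAt_extChartAt_of_mem (mem_extChartAt_source (I := I) (s p)))
    (hs.mdifferentiableAt (by simp))
  rw [mfderiv_eq_fderiv] at this
  exact (DFunLike.congr_fun this (v i)).symm

theorem curveIntegral_precomp_triangle (lam : Form I N ℝ 1) (σ : Triangle I N) (a : ℝ → ℝ × ℝ)
    (ha : ContDiff ℝ ∞ a) (hm : MapsTo a (Icc 0 1) triangle) (w : ℝ × ℝ)
    (hw : ∀ t, HasDerivAt a w t) :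
    curveIntegral lam (σ.precomp a ha hm) =
      ∫ t in (0 : ℝ)..1, pullbackVec σ.ext lam (a t) (fun _ => w) := by
  have hd : ∀ t, MDifferentiableAt 𝓘(ℝ, ℝ) 𝓘(ℝ, ℝ × ℝ) a t := fun t =>
    (hw t).differentiableAt.mdifferentiableAt
  rw [curveIntegral_eq lam (σ.precomp a ha hm) (f := σ.ext ∘ a)]
  · refine intervalIntegral.integral_congr fun t ht => ?_
    rw [uIcc_of_le zero_le_one] at ht
    refine form_congr lam rfl (funext fun _ => ?_)
    rw [mfderiv_comp t (σ.mdifferentiableAt_ext (hm ht)) (hd t), mfderiv_eq_fderiv]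
    have : fderiv ℝ a t (1 : ℝ) = w := by
      rw [(hw t).hasFDerivAt.fderiv]; simp
    exact congrArg (mfderiv 𝓘(ℝ, ℝ × ℝ) I σ.ext (a t)) this
  · exact fun t ht => (σ.mdifferentiableAt_ext (hm ht)).comp t (hd t)
  · exact fun t => σ.ext_apply ⟨a t, hm t.2⟩

/-- Stokes' theorem for smooth singular triangles. -/
theorem triangleIntegral_dForm {lam : Form I N ℝ 1} (hlam : IsSmoothForm I lam) (σ : Triangle I N) :
    triangleIntegral (dForm I lam) σ =
      curveIntegral lam σ.face0 - curveIntegral lam σ.face1 + curveIntegral lam σ.face2 := by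
  obtain ⟨W, hW, hWt, hs⟩ := σ.exists_open_contMDiffOn_ext
  let e := ContinuousAlternatingMap.ofSubsingletonLIE (𝕜 := ℝ) (E := ℝ × ℝ) (F := ℝ) (0 : Fin 1)
  have hb : ∀ p ∈ W, ContDiffAt ℝ ∞ (pullbackVec σ.ext lam) p := fun p hp =>
    contDiffAt_pullbackVec hlam (hs.contMDiffAt (hW.mem_nhds hp))
  let a : ℝ × ℝ → (ℝ × ℝ) →L[ℝ] ℝ := fun p => e.symm (pullbackVec σ.ext lam p)
  have ha : ∀ p w, a p w = pullbackVec σ.ext lam p (fun _ => w) := fun p w => rfl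
  have hac : ∀ p ∈ W, ContDiffAt ℝ ∞ a p := fun p hp => e.symm.contDiff.contDiffAt.comp p (hb p hp)
  have hst := stokes_triangle_plane hW hWt (a := a)
    (fun p hp => ((hac p hp).of_le (by simp)).contDiffWithinAt)
  have h0 : curveIntegral lam σ.face0 = ∫ t in (0 : ℝ)..1, a (1 - t, t) (-1, 1) :=
    curveIntegral_precomp_triangle lam σ _ _ _ (-1, 1) fun t =>
      ((hasDerivAt_id t).const_sub 1).prodMk (hasDerivAt_id t)
  have h1 : curveIntegral lam σ.face1 = ∫ t in (0 : ℝ)..1, a (0, t) (0, 1) :=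
    curveIntegral_precomp_triangle lam σ _ _ _ (0, 1) fun t =>
      (hasDerivAt_const t 0).prodMk (hasDerivAt_id t)
  have h2 : curveIntegral lam σ.face2 = ∫ t in (0 : ℝ)..1, a (t, 0) (1, 0) :=
    curveIntegral_precomp_triangle lam σ _ _ _ (1, 0) fun t =>
      (hasDerivAt_id t).prodMk (hasDerivAt_const t 0)
  rw [h0, h1, h2, ← hst]
  refine setIntegral_congr_fun isCompact_triangle.isClosed.measurableSet fun p hp => ?_
  have key := dForm_mfderiv hlam (hs.contMDiffAt (hW.mem_nhds (hWt hp)))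
    ![((1, 0) : ℝ × ℝ), (0, 1)]
  rw [extDeriv_apply ((hb p (hWt hp)).differentiableAt (by simp))] at key
  have hda := (hac p (hWt hp)).differentiableAt (by simp)
  -- The exterior derivative is an alternating sum in which one vector gives the direction of
  -- differentiation and the remaining one is inserted in the form; `r` is that one-entry tuple.
  have hfd : ∀ w : ℝ × ℝ, ∀ r : Fin 1 → ℝ × ℝ, r = (fun _ => w) → ∀ v,
      fderiv ℝ (fun q => pullbackVec σ.ext lam q r) p v = fderiv ℝ a p v w := by
    rintro w _ rfl v
    change fderiv ℝ (fun q => a q w) p v = _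
    have : HasFDerivAt (fun q => a q w)
      ((ContinuousLinearMap.apply ℝ ℝ w).comp (fderiv ℝ a p)) p :=
      (ContinuousLinearMap.apply ℝ ℝ w).hasFDerivAt.comp p hda.hasFDerivAt
    rw [this.fderiv]
    rfl
  rw [Fin.sum_univ_two, hfd (0, 1) _ (by funext i; fin_cases i; rfl),
    hfd (1, 0) _ (by funext i; fin_cases i; rfl)] at key
  simp only [Fin.val_zero, pow_zero, one_smul, Fin.val_one, pow_one, neg_smul] at key
  rw [sub_eq_add_neg]
  refine Eq.trans ?_ key
  refine form_congr (dForm I lam) rfl (funext fun i => ?_)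
  fin_cases i <;> rfl

end Stokes

end CharLift

namespace CharLift

/-! ### Chains, phases, and the value of the character on cycles. -/

section Chains

variable {E : Type*} [NormedAddCommGroup E] [NormedSpace ℝ E]
  {H : Type*} [TopologicalSpace H] {I : ModelWithCorners ℝ E H}
  {N : Type*} [TopologicalSpace N] [ChartedSpace H N]
  {E' : Type*} [NormedAddCommGroup E'] [NormedSpace ℝ E']
  {H' : Type*} [TopologicalSpace H'] {I' : ModelWithCorners ℝ E' H'}
  {M : Type*} [TopologicalSpace M] [ChartedSpace H' M]

@[simp] theorem bdry1_single (γ : Curve I N) (n : ℤ) :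
    bdry1 I N (Finsupp.single γ n) =
      n • (Finsupp.single γ.target (1 : ℤ) - Finsupp.single γ.source 1) := by
  simp [bdry1]

@[simp] theorem chainIntegral1_single (lam : Form I N ℝ 1) (γ : Curve I N) (n : ℤ) :
    chainIntegral1 lam (Finsupp.single γ n) = n • curveIntegral lam γ := by
  simp [chainIntegral1]

@[simp] theorem mapC1_single (f : N → M) (hf : ContMDiff I I' ∞ f) (γ : Curve I N) (n : ℤ) :
    mapC1 I' f hf (Finsupp.single γ n) = Finsupp.single (γ.postcomp f hf) n := by
  simp [mapC1, Finsupp.lmapDomain_apply, Finsupp.mapDomain_single]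

theorem bdry1_mapC1 (f : N → M) (hf : ContMDiff I I' ∞ f) (c : C1 I N) :
    bdry1 I' M (mapC1 I' f hf c) = Finsupp.mapDomain f (bdry1 I N c) := by
  suffices h : (bdry1 I' M).comp (mapC1 I' f hf) = (Finsupp.lmapDomain ℤ ℤ f).comp (bdry1 I N) from
    LinearMap.congr_fun h c
  refine Finsupp.lhom_ext' fun γ => LinearMap.ext_ring ?_
  simp only [LinearMap.comp_apply, Finsupp.lsingle_apply, mapC1_single, bdry1_single, one_smul,
    map_sub, Finsupp.lmapDomain_apply, Finsupp.mapDomain_single]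
  rfl

theorem mapC1_mem_Z1 (f : N → M) (hf : ContMDiff I I' ∞ f) {c : C1 I N} {p q : N}
    (hc : bdry1 I N c = Finsupp.single q 1 - Finsupp.single p 1) (hpq : f p = f q) :
    mapC1 I' f hf c ∈ Z1 I' M := by
  rw [LinearMap.mem_ker, bdry1_mapC1, hc]
  have : Finsupp.mapDomain f (Finsupp.single q (1 : ℤ) - Finsupp.single p 1) =
      Finsupp.lmapDomain ℤ ℤ f (Finsupp.single q (1 : ℤ) - Finsupp.single p 1) := rfl
  rw [this, map_sub]
  simp [hpq]

theorem mapC1_mem_Z1_of_mem (f : N → M) (hf : ContMDiff I I' ∞ f) {c : C1 I N}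
    (hc : c ∈ Z1 I N) : mapC1 I' f hf c ∈ Z1 I' M := by
  rw [LinearMap.mem_ker] at hc ⊢
  rw [bdry1_mapC1, hc, Finsupp.mapDomain_zero]

/-- Push-forward of 2-chains along a smooth map. -/
noncomputable def mapC2 (f : N → M) (hf : ContMDiff I I' ∞ f) : C2 I N →ₗ[ℤ] C2 I' M :=
  Finsupp.lmapDomain ℤ ℤ (SmoothMapOn.postcomp f hf)

theorem bdry2_mapC2 (f : N → M) (hf : ContMDiff I I' ∞ f) (u : C2 I N) :
    bdry2 I' M (mapC2 f hf u) = mapC1 I' f hf (bdry2 I N u) := by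
  suffices h : (bdry2 I' M).comp (mapC2 f hf) = (mapC1 I' f hf).comp (bdry2 I N) from
    LinearMap.congr_fun h u
  refine Finsupp.lhom_ext' fun σ => LinearMap.ext_ring ?_
  simp only [LinearMap.comp_apply, Finsupp.lsingle_apply, mapC2, bdry2, Finsupp.lmapDomain_apply,
    Finsupp.mapDomain_single, Finsupp.linearCombination_single, one_smul, map_add, map_sub,
    mapC1_single]
  rfl

theorem chainIntegral2_mapC2 (η : Form I' M ℝ 2) (f : N → M) (hf : ContMDiff I I' ∞ f)
    (u : C2 I N) : chainIntegral2 η (mapC2 f hf u) = chainIntegral2 (pullback I' I f η) u := by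
  suffices h : (chainIntegral2 η).comp (mapC2 f hf) = chainIntegral2 (pullback I' I f η) from
    LinearMap.congr_fun h u
  refine Finsupp.lhom_ext' fun σ => LinearMap.ext_ring ?_
  simp only [LinearMap.comp_apply, Finsupp.lsingle_apply, mapC2, chainIntegral2,
    Finsupp.lmapDomain_apply, Finsupp.mapDomain_single, Finsupp.linearCombination_single, one_smul]
  exact triangleIntegral_postcomp η σ f hf

/-- Stokes' theorem for chains. -/
theorem chainIntegral2_dForm [I.Boundaryless] [IsManifold I ∞ N] {lam : Form I N ℝ 1}
    (hlam : IsSmoothForm I lam) (u : C2 I N) :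
    chainIntegral2 (dForm I lam) u = chainIntegral1 lam (bdry2 I N u) := by
  suffices h : chainIntegral2 (dForm I lam) = (chainIntegral1 lam).comp (bdry2 I N) from
    LinearMap.congr_fun h u
  refine Finsupp.lhom_ext' fun σ => LinearMap.ext_ring ?_
  simp only [LinearMap.comp_apply, Finsupp.lsingle_apply, bdry2, chainIntegral2,
    Finsupp.linearCombination_single, one_smul, map_add, map_sub, chainIntegral1_single]
  exact triangleIntegral_dForm hlam σ

/-- On cycles, `χ ∘ π_*` is the integral of `λ` modulo `ℤ`. -/
def CycleCompatible (lam : Form I N ℝ 1) (f : N → M) (hf : ContMDiff I I' ∞ f)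
    (χ : Z1 I' M →+ UnitAddCircle) : Prop :=
  ∀ z (hz : z ∈ Z1 I N),
    (chainIntegral1 lam z : UnitAddCircle) = χ ⟨mapC1 I' f hf z, mapC1_mem_Z1_of_mem f hf hz⟩

/-- Every cycle of `N` is some `∂u`. Then `∫_{∂u} λ = ∫_u dλ = ∫_u f^*η = ∫_{f_* u} η`, and modulo
`ℤ` the last integral is `χ(∂ f_* u)`. The later arguments use the homology of `N` and the curvature
of `χ` through this conclusion only. -/
theorem IsDiffCharacter.cycleCompatible [I.Boundaryless] [IsManifold I ∞ N]
    (hH1 : Subsingleton (H1 I N)) {χ : Z1 I' M →+ UnitAddCircle} {η : Form I' M ℝ 2}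
    (hχ : IsDiffCharacter χ η) {lam : Form I N ℝ 1} (hlam : IsSmoothForm I lam) (f : N → M)
    (hf : ContMDiff I I' ∞ f) (hη : pullback I' I f η = dForm I lam) :
    CycleCompatible lam f hf χ := by
  intro z hz
  have hz' : (⟨z, hz⟩ : Z1 I N) ∈ LinearMap.range (bdry2Z I N) := by
    rw [← Submodule.Quotient.mk_eq_zero]
    exact Subsingleton.elim _ _
  obtain ⟨u, hu⟩ := hz'
  have hu' : bdry2 I N u = z := congrArg Subtype.val hu
  have h1 : (⟨mapC1 I' f hf z, mapC1_mem_Z1_of_mem f hf hz⟩ : Z1 I' M) =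
      bdry2Z I' M (mapC2 f hf u) := by
    apply Subtype.ext
    change mapC1 I' f hf z = bdry2 I' M (mapC2 f hf u)
    rw [bdry2_mapC2, hu']
  rw [h1, hχ.bdry, chainIntegral2_mapC2, hη, chainIntegral2_dForm hlam, hu']

/-- `a = ∫_c λ - χ(π_* c)` for a chain `c` from `p` to `q`. -/
def IsPhase (lam : Form I N ℝ 1) (f : N → M) (hf : ContMDiff I I' ∞ f)
    (χ : Z1 I' M →+ UnitAddCircle) (p q : N) (a : UnitAddCircle) : Prop :=
  ∃ c : C1 I N, bdry1 I N c = Finsupp.single q 1 - Finsupp.single p 1 ∧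
    ∃ hc : mapC1 I' f hf c ∈ Z1 I' M,
      a = (chainIntegral1 lam c : UnitAddCircle) - χ ⟨mapC1 I' f hf c, hc⟩

variable {lam : Form I N ℝ 1} {f : N → M} {hf : ContMDiff I I' ∞ f} {χ : Z1 I' M →+ UnitAddCircle}

/-- Two chains with the same end points differ by a cycle of `N`, on which `∫ λ` and `χ ∘ f_*`
agree. -/
theorem IsPhase.unique (h : CycleCompatible lam f hf χ) {p q : N} {a b : UnitAddCircle}
    (ha : IsPhase lam f hf χ p q a) (hb : IsPhase lam f hf χ p q b) : a = b := by
  obtain ⟨c, hc, hcz, rfl⟩ := ha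
  obtain ⟨d, hd, hdz, rfl⟩ := hb
  have hz : c - d ∈ Z1 I N := by
    rw [LinearMap.mem_ker, map_sub, hc, hd, sub_self]
  have h1 := h _ hz
  have h2 : (⟨mapC1 I' f hf (c - d), mapC1_mem_Z1_of_mem f hf hz⟩ : Z1 I' M) =
      ⟨mapC1 I' f hf c, hcz⟩ - ⟨mapC1 I' f hf d, hdz⟩ := Subtype.ext (map_sub _ _ _)
  rw [h2, map_sub, map_sub, AddCircle.coe_sub] at h1
  rw [sub_eq_sub_iff_sub_eq_sub]
  exact h1

theorem IsPhase.trans {p q r : N} {a b : UnitAddCircle}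
    (ha : IsPhase lam f hf χ p q a) (hb : IsPhase lam f hf χ q r b) :
    IsPhase lam f hf χ p r (a + b) := by
  obtain ⟨c, hc, hcz, rfl⟩ := ha
  obtain ⟨d, hd, hdz, rfl⟩ := hb
  refine ⟨c + d, by rw [map_add, hc, hd]; abel, by rw [map_add]; exact add_mem hcz hdz, ?_⟩
  have h2 : ∀ h, (⟨mapC1 I' f hf (c + d), h⟩ : Z1 I' M) =
      ⟨mapC1 I' f hf c, hcz⟩ + ⟨mapC1 I' f hf d, hdz⟩ := fun h => Subtype.ext (map_add _ _ _)
  rw [h2, map_add, map_add, AddCircle.coe_add]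
  abel

/-- Two curves over the same base curve: the phases at the end points differ by the difference of
the integrals. -/
theorem IsPhase.transport (h : CycleCompatible lam f hf χ) {γ₁ γ₂ : Curve I N}
    (hγ : γ₁.postcomp f hf = γ₂.postcomp f hf) {a b : UnitAddCircle}
    (ha : IsPhase lam f hf χ γ₁.source γ₂.source a)
    (hb : IsPhase lam f hf χ γ₁.target γ₂.target b) :
    b = a + ((curveIntegral lam γ₂ - curveIntegral lam γ₁ : ℝ) : UnitAddCircle) := by
  refine hb.unique h ?_
  obtain ⟨c, hc, hcz, rfl⟩ := ha
  -- The chain runs back along `γ₁`, through `c`, and forward along `γ₂`. The added curves have the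
  -- same image and cancel downstairs, so only the integral of `λ` sees them.
  have hm : mapC1 I' f hf (c + (Finsupp.single γ₂ 1 - Finsupp.single γ₁ 1)) = mapC1 I' f hf c := by
    rw [map_add, map_sub, mapC1_single, mapC1_single, hγ, sub_self, add_zero]
  refine ⟨c + (Finsupp.single γ₂ 1 - Finsupp.single γ₁ 1), ?_, by rw [hm]; exact hcz, ?_⟩
  · rw [map_add, map_sub, bdry1_single, bdry1_single, hc]
    simp only [one_smul]
    abel
  · have h2 : ∀ h', (⟨mapC1 I' f hf (c + (Finsupp.single γ₂ 1 - Finsupp.single γ₁ 1)), h'⟩ :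
        Z1 I' M) = ⟨mapC1 I' f hf c, hcz⟩ := fun h' => Subtype.ext hm
    rw [h2, map_add, map_sub, chainIntegral1_single, chainIntegral1_single, AddCircle.coe_add]
    simp only [one_smul]
    abel

theorem isPhase_of_curve (γ : Curve I N) (h : f γ.source = f γ.target) :
    ∃ a, IsPhase lam f hf χ γ.source γ.target a := by
  have hb : bdry1 I N (Finsupp.single γ 1) = Finsupp.single γ.target 1 - Finsupp.single γ.source 1 := by
    simp
  exact ⟨_, Finsupp.single γ 1, hb, mapC1_mem_Z1 f hf hb h, rfl⟩

/-- The values of a character on cycles in terms of lifts of the curves and of phases. -/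
theorem CycleCompatible.eq_linearCombination (h : CycleCompatible lam f hf χ)
    (L : Curve I' M → Curve I N) (hL : ∀ γ, (L γ).postcomp f hf = γ) (s : M → N)
    (hs : ∀ γ, (L γ).source = s γ.source) (a : Curve I' M → UnitAddCircle)
    (ha : ∀ γ, IsPhase lam f hf χ (s γ.target) (L γ).target (a γ)) (z : Z1 I' M) :
    χ z = Finsupp.linearCombination ℤ
      (fun γ => (curveIntegral lam (L γ) : UnitAddCircle) - a γ) (z : C1 I' M) := by
  choose c hc hcz hca using ha
  -- The chain `L γ - c γ` goes from `s γ.source` to `s γ.target`: the lift of `γ`, corrected within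
  -- the comparison to end at the chosen point.
  let T : C1 I' M →ₗ[ℤ] C1 I N :=
    Finsupp.linearCombination ℤ fun γ => Finsupp.single (L γ) 1 - c γ
  -- On boundaries `T` acts through the set-theoretic section `s`, so it carries cycles to cycles
  -- although single lifts do not close up.
  have hT : (bdry1 I N).comp T = (Finsupp.lmapDomain ℤ ℤ s).comp (bdry1 I' M) := by
    refine Finsupp.lhom_ext' fun γ => LinearMap.ext_ring ?_
    simp only [LinearMap.comp_apply, Finsupp.lsingle_apply, T, Finsupp.linearCombination_single,
      one_smul, map_sub, bdry1_single, hc, hs, Finsupp.lmapDomain_apply, Finsupp.mapDomain_single]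
    abel
  have hTz : T z ∈ Z1 I N := by
    rw [LinearMap.mem_ker]
    have := LinearMap.congr_fun hT z
    rw [LinearMap.comp_apply, LinearMap.comp_apply, (LinearMap.mem_ker.1 z.2), map_zero] at this
    exact this
  -- The image of `T z` downstairs is `z - D z`. Each correction projects to a cycle on its own, so
  -- `χ (D z)` splits over the curves.
  let D : C1 I' M →ₗ[ℤ] Z1 I' M := Finsupp.linearCombination ℤ fun γ => ⟨mapC1 I' f hf (c γ), hcz γ⟩
  have hD : (mapC1 I' f hf).comp T = LinearMap.id - (Z1 I' M).subtype.comp D := by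
    refine Finsupp.lhom_ext' fun γ => LinearMap.ext_ring ?_
    simp [T, D, hL]
  have h1 := h _ hTz
  have h2 : (⟨mapC1 I' f hf (T z), mapC1_mem_Z1_of_mem f hf hTz⟩ : Z1 I' M) = z - D z :=
    Subtype.ext (LinearMap.congr_fun hD z)
  rw [h2, map_sub] at h1
  rw [← sub_add_cancel (χ z) (χ (D z)), ← h1]
  -- Reduction modulo `ℤ` as a linear map: both sides are now linear on all 1-chains and can be
  -- compared on single curves.
  let Q : ℝ →ₗ[ℤ] UnitAddCircle := (QuotientAddGroup.mk' (AddSubgroup.zmultiples (1 : ℝ))).toIntLinearMap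
  suffices hk : Q.comp ((chainIntegral1 lam).comp T) + χ.toIntLinearMap.comp D =
      Finsupp.linearCombination ℤ (fun γ => (curveIntegral lam (L γ) : UnitAddCircle) - a γ) from
    LinearMap.congr_fun hk z
  refine Finsupp.lhom_ext' fun γ => LinearMap.ext_ring ?_
  simp only [LinearMap.comp_apply, Finsupp.lsingle_apply, T, D, Finsupp.linearCombination_single,
      one_smul, LinearMap.add_apply, map_sub, chainIntegral1_single, hca]
  change ((curveIntegral lam (L γ) : ℝ) : UnitAddCircle) - (chainIntegral1 lam (c γ) : UnitAddCircle)
    + χ _ = _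
  abel

end Chains

end CharLift

namespace CharLift

/-! ### Segments in charts and smooth paths in connected manifolds. -/

section ChartSegments

set_option linter.unusedSectionVars false

variable {E : Type*} [NormedAddCommGroup E] [NormedSpace ℝ E]
  {H : Type*} [TopologicalSpace H] {I : ModelWithCorners ℝ E H} [I.Boundaryless]
  {N : Type*} [TopologicalSpace N] [ChartedSpace H N] [IsManifold I ∞ N]

/-- The curve that is a straight segment in a chart. -/
theorem exists_chartSegment {x₀ : N} {B : Set E} (hB : IsOpen B) (hBc : Convex ℝ B)
    (hBt : B ⊆ (extChartAt I x₀).target) {y z : E} (hy : y ∈ B) (hz : z ∈ B) :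
    ∃ γ : Curve I N, γ.source = (extChartAt I x₀).symm y ∧ γ.target = (extChartAt I x₀).symm z ∧
      ∀ lam : Form I N ℝ 1, curveIntegral lam γ =
        ∫ t in (0 : ℝ)..1, chartRep I lam x₀ (y + t • (z - y)) (fun _ => z - y) := by
  let c : ℝ → E := fun t => y + t • (z - y)
  have hc : ContDiff ℝ ∞ c := by fun_prop
  have hcB : ∀ t ∈ Icc (0 : ℝ) 1, c t ∈ B := fun t ht => by
    have := hBc hy hz (sub_nonneg.2 ht.2) ht.1 (by ring)
    convert this using 1
    simp only [c]
    module
  let W := c ⁻¹' B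
  have hW : IsOpen W := hB.preimage hc.continuous
  have hsm : ContMDiffOn 𝓘(ℝ, ℝ) I ∞ ((extChartAt I x₀).symm ∘ c) W := fun t ht =>
    ((contMDiffAt_extChartAt_symm (hBt ht)).comp t hc.contMDiff.contMDiffAt).contMDiffWithinAt
  refine ⟨.ofContMDiffOn _ W hW hcB hsm, ?_, ?_, fun lam => ?_⟩
  · simp [Curve.source, SmoothMapOn.ofContMDiffOn, c]
  · simp [Curve.target, SmoothMapOn.ofContMDiffOn, c]
  · rw [curveIntegral_eq lam _ (f := (extChartAt I x₀).symm ∘ c)]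
    · refine intervalIntegral.integral_congr fun t ht => ?_
      rw [uIcc_of_le zero_le_one] at ht
      have hd : HasDerivAt c (z - y) t := by
        have := ((hasDerivAt_id t).smul_const (z - y)).const_add y
        rwa [one_smul] at this
      unfold chartRep
      refine form_congr lam rfl (funext fun _ => ?_)
      rw [mfderiv_comp (I' := 𝓘(ℝ, E)) t
        ((contMDiffAt_extChartAt_symm (hBt (hcB t ht))).mdifferentiableAt (by simp))
        hd.differentiableAt.mdifferentiableAt, mfderiv_eq_fderiv]
      have : fderiv ℝ c t (1 : ℝ) = z - y := by rw [hd.hasFDerivAt.fderiv]; simp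
      exact congrArg (mfderiv 𝓘(ℝ, E) I (extChartAt I x₀).symm (c t)) this
    · exact fun t ht => (hsm.contMDiffAt (hW.mem_nhds (hcB t ht))).mdifferentiableAt (by simp)
    · exact fun t => rfl

theorem exists_ball_subset_extChartAt_target (x₀ : N) :
    ∃ r > 0, Metric.ball (extChartAt I x₀ x₀) r ⊆ (extChartAt I x₀).target :=
  Metric.isOpen_iff.1 (isOpen_extChartAt_target_of_boundaryless x₀) _ (mem_extChartAt_target x₀)

/-- Concatenation of smooth curves, made smooth by a reparametrization. -/
theorem exists_curve_trans {γ₁ γ₂ : Curve I N} (h : γ₁.target = γ₂.source) :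
    ∃ γ : Curve I N, γ.source = γ₁.source ∧ γ.target = γ₂.target := by
  let τ := Real.smoothTransition
  have hτ : ∀ t, τ t ∈ Icc (0 : ℝ) 1 := fun t =>
    ⟨Real.smoothTransition.nonneg t, Real.smoothTransition.le_one t⟩
  have hτs : ContDiff ℝ ∞ τ := Real.smoothTransition.contDiff
  have hs : ∀ γ : Curve I N, ∀ a b : ℝ, ContMDiff 𝓘(ℝ, ℝ) I ∞ (fun t => γ.ext (τ (a * t + b))) :=
    fun γ a b t => ContMDiffAt.comp (I' := 𝓘(ℝ, ℝ)) t (γ.contMDiffAt_ext (hτ _))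
      (hτs.comp (by fun_prop : ContDiff ℝ ∞ fun t : ℝ => a * t + b)).contMDiff.contMDiffAt
  -- `τ (4t)` is `1` from `t = 1/4` on and `τ (4t - 3)` is `0` up to `t = 3/4`, so both pieces rest
  -- at the common point around the junction `1/2`.
  let F : ℝ → N := fun t => if t < 1 / 2 then γ₁.ext (τ (4 * t + 0)) else γ₂.ext (τ (4 * t + (-3)))
  have h1 : γ₁.ext 1 = γ₂.ext 0 :=
    ((γ₁.ext_apply ⟨1, right_mem_Icc.2 zero_le_one⟩).trans h).trans
      (γ₂.ext_apply ⟨0, left_mem_Icc.2 zero_le_one⟩).symm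
  have hF : ContMDiff 𝓘(ℝ, ℝ) I ∞ F := by
    intro t
    rcases lt_or_ge t (1 / 2) with ht | ht
    · refine (hs γ₁ 4 0 t).congr_of_eventuallyEq ?_
      filter_upwards [Iio_mem_nhds ht] with s hs
      exact if_pos hs
    · refine (hs γ₂ 4 (-3) t).congr_of_eventuallyEq ?_
      filter_upwards [Ioi_mem_nhds (show 1 / 4 < t by linarith)] with s hs
      by_cases hs' : s < 1 / 2
      · simp only [F, if_pos hs']
        rw [show τ (4 * s + 0) = 1 from Real.smoothTransition.one_of_one_le
            (by linarith [mem_Ioi.1 hs]),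
          show τ (4 * s + (-3)) = 0 from Real.smoothTransition.zero_of_nonpos (by linarith), h1]
      · exact if_neg hs'
  refine ⟨.ofContMDiffOn F univ isOpen_univ (subset_univ _) hF.contMDiffOn, ?_, ?_⟩
  · change F 0 = _
    simp only [F, if_pos (show (0 : ℝ) < 1 / 2 by norm_num)]
    rw [show τ (4 * 0 + 0) = 0 from Real.smoothTransition.zero_of_nonpos (by norm_num)]
    exact γ₁.ext_apply ⟨0, left_mem_Icc.2 zero_le_one⟩
  · change F 1 = _
    simp only [F, if_neg (show ¬ (1 : ℝ) < 1 / 2 by norm_num)]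
    rw [show τ (4 * 1 + (-3)) = 1 from Real.smoothTransition.one_of_one_le (by norm_num)]
    exact γ₂.ext_apply ⟨1, right_mem_Icc.2 zero_le_one⟩

/-- Points of a connected manifold are joined by smooth curves. -/
theorem exists_curve [PreconnectedSpace N] (x y : N) :
    ∃ γ : Curve I N, γ.source = x ∧ γ.target = y := by
  have hloc : ∀ p : N, ∃ U : Set N, IsOpen U ∧ p ∈ U ∧ ∀ q ∈ U, ∀ q' ∈ U,
      ∃ γ : Curve I N, γ.source = q ∧ γ.target = q' := by
    intro p
    obtain ⟨r, hr, hB⟩ := exists_ball_subset_extChartAt_target (I := I) p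
    refine ⟨(extChartAt I p).source ∩ extChartAt I p ⁻¹' Metric.ball (extChartAt I p p) r,
      (continuousOn_extChartAt p).isOpen_inter_preimage (isOpen_extChartAt_source p)
        Metric.isOpen_ball, ⟨mem_extChartAt_source p, Metric.mem_ball_self hr⟩, ?_⟩
    rintro q ⟨hq, hq'⟩ q' ⟨hq1, hq1'⟩
    obtain ⟨γ, h1, h2, -⟩ := exists_chartSegment Metric.isOpen_ball (convex_ball _ _) hB hq' hq1'
    exact ⟨γ, h1.trans ((extChartAt I p).left_inv hq), h2.trans ((extChartAt I p).left_inv hq1)⟩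
  let S : Set N := {y | ∃ γ : Curve I N, γ.source = x ∧ γ.target = y}
  -- Coordinate balls are joined by chart segments, so a ball meeting the set of reachable points
  -- lies in it.
  have hS : IsClopen S := by
    constructor
    · rw [← isOpen_compl_iff, isOpen_iff_forall_mem_open]
      intro p hp
      obtain ⟨U, hU, hpU, h⟩ := hloc p
      refine ⟨U, fun q hq hqS => hp ?_, hU, hpU⟩
      obtain ⟨γ, h1, h2⟩ := hqS
      obtain ⟨δ, h3, h4⟩ := h q hq p hpU
      obtain ⟨ε, h5, h6⟩ := exists_curve_trans (h2.trans h3.symm)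
      exact ⟨ε, h5.trans h1, h6.trans h4⟩
    · rw [isOpen_iff_forall_mem_open]
      rintro p ⟨γ, h1, h2⟩
      obtain ⟨U, hU, hpU, h⟩ := hloc p
      refine ⟨U, fun q hq => ?_, hU, hpU⟩
      obtain ⟨δ, h3, h4⟩ := h p hpU q hq
      obtain ⟨ε, h5, h6⟩ := exists_curve_trans (h2.trans h3.symm)
      exact ⟨ε, h5.trans h1, h6.trans h4⟩
  have hx : x ∈ S := by
    obtain ⟨U, hU, hpU, h⟩ := hloc x
    exact h x hpU x hpU
  exact (hS.eq_univ ⟨x, hx⟩).symm.subset (mem_univ y)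

end ChartSegments

/-! ### Functions whose variation along curves is the exponential of an integral. -/

section ExponentialsOfIntegrals

set_option linter.unusedSectionVars false

variable {E : Type*} [NormedAddCommGroup E] [NormedSpace ℝ E]

/-- The derivative is taken only at the common origin `y₀` of the segments, so continuity of `l`
suffices and no closedness is involved: the integrand differs from `l y₀ (y - y₀)` by at most `ε ‖y
- y₀‖`. -/
theorem hasFDerivAt_segment_integral {l : E → E →L[ℝ] ℝ} {y₀ : E} {r : ℝ} (hr : 0 < r)
    (hl : ContinuousOn l (Metric.ball y₀ r)) :
    HasFDerivAt (fun y => ∫ t in (0 : ℝ)..1, l (y₀ + t • (y - y₀)) (y - y₀)) (l y₀) y₀ := by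
  rw [hasFDerivAt_iff_isLittleO, Asymptotics.isLittleO_iff]
  intro ε hε
  have hc : ContinuousAt l y₀ := hl.continuousAt (Metric.ball_mem_nhds y₀ hr)
  obtain ⟨δ, hδ, h⟩ := Metric.continuousAt_iff.1 hc ε hε
  filter_upwards [Metric.ball_mem_nhds y₀ (lt_min hδ hr)] with y hy
  have hyd : ∀ t ∈ Icc (0 : ℝ) 1, dist (y₀ + t • (y - y₀)) y₀ < min δ r := fun t ht => by
    rw [dist_eq_norm, add_sub_cancel_left, norm_smul, Real.norm_of_nonneg ht.1]
    rw [Metric.mem_ball, dist_eq_norm] at hy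
    exact (mul_le_of_le_one_left (norm_nonneg _) ht.2).trans_lt hy
  have hint : IntervalIntegrable (fun t : ℝ => l (y₀ + t • (y - y₀)) (y - y₀)) volume 0 1 := by
    refine ContinuousOn.intervalIntegrable ?_
    rw [uIcc_of_le zero_le_one]
    refine ContinuousOn.clm_apply (hl.comp (by fun_prop) fun t ht => ?_) continuousOn_const
    exact (hyd t ht).trans_le (min_le_right _ _)
  have h1 : (∫ t in (0 : ℝ)..1, l (y₀ + t • (y - y₀)) (y - y₀)) -
      (∫ t in (0 : ℝ)..1, l (y₀ + t • (y₀ - y₀)) (y₀ - y₀)) - l y₀ (y - y₀) =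
      ∫ t in (0 : ℝ)..1, (l (y₀ + t • (y - y₀)) (y - y₀) - l y₀ (y - y₀)) := by
    rw [intervalIntegral.integral_sub hint intervalIntegrable_const]
    simp
  rw [h1]
  refine (intervalIntegral.norm_integral_le_of_norm_le_const (C := ε * ‖y - y₀‖) fun t ht => ?_).trans
    (by simp)
  rw [uIoc_of_le zero_le_one] at ht
  rw [← sub_apply]
  refine (ContinuousLinearMap.le_opNorm _ _).trans (mul_le_mul_of_nonneg_right ?_ (norm_nonneg _))
  have := h ((hyd t ⟨ht.1.le, ht.2⟩).trans_le (min_le_left _ _))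
  rw [dist_eq_norm] at this
  exact this.le

variable {H : Type*} [TopologicalSpace H] {I : ModelWithCorners ℝ E H} [I.Boundaryless]
  {X : Type*} [TopologicalSpace X] [ChartedSpace H X] [IsManifold I ∞ X]

/-- The expression of a 1-form in a chart, as a covector field. -/
noncomputable def chartCovector (μ : Form I X ℝ 1) (x₀ : X) (y : E) : E →L[ℝ] ℝ :=
  (ContinuousAlternatingMap.ofSubsingletonLIE (𝕜 := ℝ) (E := E) (F := ℝ) (0 : Fin 1)).symm
    (chartRep I μ x₀ y)

/-- Each point `y` serves as the origin of its own segments: near `y` the function is `exp(2πi ∫ μ)`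
over the segment times its value at `y`, which is differentiated at `y`. -/
theorem hasFDerivAt_of_curveIntegral {μ : Form I X ℝ 1} (hμ : IsSmoothForm I μ) {f : X → ℂ}
    (hf : ∀ γ : Curve I X, f γ.target =
      Complex.exp (2 * Real.pi * Complex.I * (curveIntegral μ γ : ℝ)) * f γ.source)
    {x₀ : X} {y : E} (hy : y ∈ (extChartAt I x₀).target) :
    HasFDerivAt (f ∘ (extChartAt I x₀).symm)
      ((2 * Real.pi * Complex.I * f ((extChartAt I x₀).symm y)) •
        (Complex.ofRealCLM.comp (chartCovector μ x₀ y))) y := by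
  obtain ⟨r, hr, hB⟩ := Metric.isOpen_iff.1 (isOpen_extChartAt_target_of_boundaryless x₀) y hy
  have hl : ContinuousOn (chartCovector μ x₀) (Metric.ball y r) :=
    (LinearIsometryEquiv.continuous _).comp_continuousOn ((hμ x₀).continuousOn.mono hB)
  have hJ := hasFDerivAt_segment_integral hr hl
  have hJ0 : (∫ t in (0 : ℝ)..1, chartCovector μ x₀ (y + t • (y - y)) (y - y)) = 0 := by simp
  have h1 : ∀ z ∈ Metric.ball y r, (f ∘ (extChartAt I x₀).symm) z =
      Complex.exp (2 * Real.pi * Complex.I *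
        ((∫ t in (0 : ℝ)..1, chartCovector μ x₀ (y + t • (z - y)) (z - y) : ℝ) : ℂ)) *
        f ((extChartAt I x₀).symm y) := fun z hz => by
    obtain ⟨γ, h2, h3, h4⟩ := exists_chartSegment Metric.isOpen_ball (convex_ball y r) hB
      (Metric.mem_ball_self hr) hz
    have := hf γ
    rw [h2, h3, h4] at this
    exact this
  have h2 := ((((Complex.ofRealCLM.hasFDerivAt.comp y hJ).const_mul
    (2 * Real.pi * Complex.I)).cexp).mul_const (f ((extChartAt I x₀).symm y)))
  refine (h2.congr_of_eventuallyEq ?_).congr_fderiv ?_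
  · filter_upwards [Metric.ball_mem_nhds y hr] with z hz
    exact h1 z hz
  · ext v
    simp only [comp_apply, hJ0, Complex.ofRealCLM_apply, Complex.ofReal_zero, mul_zero,
      Complex.exp_zero]
    simp only [one_smul, smul_apply, ContinuousLinearMap.comp_apply,
      smul_eq_mul]
    ring

/-- Bootstrapping in `df = 2πi f μ`: if `f` is of class `C^n`, so is the right side, hence `f` is of
class `C^(n+1)`. -/
theorem contDiffOn_of_curveIntegral {μ : Form I X ℝ 1} (hμ : IsSmoothForm I μ) {f : X → ℂ}
    (hf : ∀ γ : Curve I X, f γ.target =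
      Complex.exp (2 * Real.pi * Complex.I * (curveIntegral μ γ : ℝ)) * f γ.source) (x₀ : X) :
    ContDiffOn ℝ ∞ (f ∘ (extChartAt I x₀).symm) (extChartAt I x₀).target := by
  have ho := isOpen_extChartAt_target_of_boundaryless (I := I) x₀
  rw [contDiffOn_infty]
  intro n
  induction n with
  | zero => exact contDiffOn_zero.2 fun y hy =>
      (hasFDerivAt_of_curveIntegral hμ hf hy).continuousAt.continuousWithinAt
  | succ n ih =>
    rw [Nat.cast_add, Nat.cast_one, contDiffOn_succ_iff_fderiv_of_isOpen ho]
    refine ⟨fun y hy => (hasFDerivAt_of_curveIntegral hμ hf hy).differentiableAt.differentiableWithinAt,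
      by simp, ?_⟩
    have hl : ContDiffOn ℝ n (chartCovector μ x₀) (extChartAt I x₀).target :=
      (LinearIsometryEquiv.contDiff _).comp_contDiffOn ((hμ x₀).of_le (by exact_mod_cast le_top))
    refine ContDiffOn.congr (f := fun y => (2 * Real.pi * Complex.I *
      f ((extChartAt I x₀).symm y)) • (Complex.ofRealCLM.comp (chartCovector μ x₀ y))) ?_
      fun y hy => (hasFDerivAt_of_curveIntegral hμ hf hy).fderiv
    exact (contDiffOn_const.mul ih).smul (contDiffOn_const.clm_comp hl)

/-- A function that changes along curves by the exponential of the integral of a smooth 1-form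
is smooth. -/
theorem contMDiff_of_curveIntegral {μ : Form I X ℝ 1} (hμ : IsSmoothForm I μ) {f : X → ℂ}
    (hf : ∀ γ : Curve I X, f γ.target =
      Complex.exp (2 * Real.pi * Complex.I * (curveIntegral μ γ : ℝ)) * f γ.source) :
    ContMDiff I 𝓘(ℝ, ℂ) ∞ f := by
  intro x
  have h := (contDiffOn_of_curveIntegral hμ hf x).contDiffAt
    ((isOpen_extChartAt_target_of_boundaryless x).mem_nhds (mem_extChartAt_target x))
  refine (ContMDiffAt.comp (I' := 𝓘(ℝ, E)) x h.contMDiffAt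
    (contMDiffAt_extChartAt (I := I))).congr_of_eventuallyEq ?_
  filter_upwards [extChartAt_source_mem_nhds (I := I) x] with z hz
  exact congrArg f ((extChartAt I x).left_inv hz).symm

/-- The equation `df = 2πi f μ` without charts. Applied to the exponential of the phase it yields
the invariance of `Θ`. -/
theorem mvfderiv_of_curveIntegral {μ : Form I X ℝ 1} (hμ : IsSmoothForm I μ) {f : X → ℂ}
    (hf : ∀ γ : Curve I X, f γ.target =
      Complex.exp (2 * Real.pi * Complex.I * (curveIntegral μ γ : ℝ)) * f γ.source) (x : X)
    (v : TangentSpace I x) :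
    mvfderiv I f x v = 2 * Real.pi * Complex.I * ((μ x (fun _ => v) : ℝ) : ℂ) * f x := by
  have h := hasFDerivAt_of_curveIntegral hμ hf (mem_extChartAt_target (I := I) x)
  have h2 := HasMFDerivAt.comp (I := I) (I' := 𝓘(ℝ, E)) (I'' := 𝓘(ℝ, ℂ)) (M' := E)
    (g := f ∘ (extChartAt I x).symm) (f := extChartAt I x) x h.hasMFDerivAt
      (mdifferentiableAt_extChartAt_of_mem (mem_extChartAt_source (I := I) x)).hasMFDerivAt
  have h3 : f =ᶠ[𝓝 x] (f ∘ (extChartAt I x).symm) ∘ extChartAt I x := by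
    filter_upwards [extChartAt_source_mem_nhds (I := I) x] with z hz
    exact congrArg f ((extChartAt I x).left_inv hz).symm
  have h4 := DFunLike.congr_fun (h2.congr_of_eventuallyEq h3).mfderiv v
  rw [extChartAt_to_inv] at h4
  rw [form_eq_chartRep μ (mem_extChartAt_source (I := I) x)]
  refine Eq.trans h4 ?_
  change (2 * Real.pi * Complex.I * f x) * ((chartRep I μ x (extChartAt I x x)
    (fun _ => mfderiv I 𝓘(ℝ, E) (extChartAt I x) x v) : ℝ) : ℂ) = _
  ring

end ExponentialsOfIntegrals

end CharLift

namespace CharLift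

/-! ### Smooth maps to the circle. -/

section CircleMaps

variable {E : Type*} [NormedAddCommGroup E] [NormedSpace ℝ E]
  {H : Type*} [TopologicalSpace H] {I : ModelWithCorners ℝ E H}
  {X : Type*} [TopologicalSpace X] [ChartedSpace H X]

theorem contMDiff_circle_coe : ContMDiff (𝓡 1) 𝓘(ℝ, ℂ) ∞ (fun z : Circle => (z : ℂ)) := by
  have := finrank_real_complex_fact'
  exact contMDiff_coe_sphere (E := ℂ) (n := 1)

theorem contMDiff_circle_of_coe [IsManifold I ∞ X] {f : X → Circle}
    (hf : ContMDiff I 𝓘(ℝ, ℂ) ∞ (fun x => (f x : ℂ))) : ContMDiff I (𝓡 1) ∞ f := by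
  have := finrank_real_complex_fact'
  exact ContMDiff.codRestrict_sphere (n := 1) hf fun x => (f x).2

theorem mdifferentiable_circle_coe : MDifferentiable (𝓡 1) 𝓘(ℝ, ℂ) (fun z : Circle => (z : ℂ)) :=
  contMDiff_circle_coe.mdifferentiable (by simp)

theorem mvfderiv_comp_apply' {E' : Type*} [NormedAddCommGroup E'] [NormedSpace ℝ E']
    {H' : Type*} [TopologicalSpace H'] {I' : ModelWithCorners ℝ E' H'}
    {Y : Type*} [TopologicalSpace Y] [ChartedSpace H' Y]
    {F : Type*} [NormedAddCommGroup F] [NormedSpace ℝ F] {f : X → Y} {g : Y → F} {x : X}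
    (hg : MDifferentiableAt I' 𝓘(ℝ, F) g (f x)) (hf : MDifferentiableAt I I' f x)
    (v : TangentSpace I x) :
    mvfderiv I (fun x => g (f x)) x v = mvfderiv I' g (f x) (mfderiv I I' f x v) :=
  mfderiv_comp_apply x hg hf v

theorem toCircle_coe (r : ℝ) :
    ((AddCircle.toCircle (r : UnitAddCircle) : Circle) : ℂ) =
      Complex.exp (2 * Real.pi * Complex.I * (r : ℝ)) := by
  rw [AddCircle.toCircle_apply_mk, Circle.coe_exp]
  congr 1
  push_cast
  ring

/-- Differentiating `|f|² = 1` shows that `f⁻¹ df`, which is the conjugate of `f` times `df`, is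
purely imaginary. -/
theorem norm_sq_circle_deriv {f : X → Circle} {x : X}
    (hf : MDifferentiableAt I 𝓘(ℝ, ℂ) (fun x => (f x : ℂ)) x) (v : TangentSpace I x) :
    ((((f x)⁻¹ : Circle) : ℂ) * mvfderiv I (fun x => (f x : ℂ)) x v).re = 0 := by
  let c : ℂ → ℝ := fun z => z.re * z.re + z.im * z.im
  have hc : ∀ z w : ℂ, HasFDerivAt c
      ((2 * z.re) • Complex.reCLM + (2 * z.im) • Complex.imCLM) z := by
    intro z w
    have h1 := (Complex.reCLM.hasFDerivAt (x := z)).mul (Complex.reCLM.hasFDerivAt (x := z))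
    have h2 := (Complex.imCLM.hasFDerivAt (x := z)).mul (Complex.imCLM.hasFDerivAt (x := z))
    refine (h1.add h2).congr_fderiv ?_
    ext w
    simp
    ring
  have h1 : (fun x => c (f x)) = fun _ => (1 : ℝ) := by
    funext y
    have := Circle.normSq_coe (f y)
    rwa [Complex.normSq_apply] at this
  have h2 := mvfderiv_comp_apply' (I := I) (g := c) (f := fun x => (f x : ℂ)) (x := x)
    (hc _ 0).differentiableAt.mdifferentiableAt hf v
  rw [h1, mvfderiv_const] at h2
  have h3 : mvfderiv 𝓘(ℝ, ℂ) c (f x) = (2 * (f x : ℂ).re) • Complex.reCLM +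
      (2 * (f x : ℂ).im) • Complex.imCLM := by
    refine Eq.trans ?_ (hc (f x) 0).fderiv
    exact mfderiv_eq_fderiv
  rw [h3] at h2
  rw [Circle.coe_inv_eq_conj, Complex.mul_re, Complex.conj_re, Complex.conj_im]
  have h4 : (0 : ℝ) = 2 * (f x : ℂ).re * (mvfderiv I (fun x => (f x : ℂ)) x v).re +
    2 * (f x : ℂ).im * (mvfderiv I (fun x => (f x : ℂ)) x v).im := h2
  linarith

end CircleMaps

/-! ### The form `Θ` on `N × U(1)`. -/

section ConnTheta

variable {EN : Type*} [NormedAddCommGroup EN] [NormedSpace ℝ EN]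
  {HN : Type*} [TopologicalSpace HN] {IN : ModelWithCorners ℝ EN HN}
  {N : Type*} [TopologicalSpace N] [ChartedSpace HN N]
  {E : Type*} [NormedAddCommGroup E] [NormedSpace ℝ E]
  {H : Type*} [TopologicalSpace H] {I : ModelWithCorners ℝ E H}
  {X : Type*} [TopologicalSpace X] [ChartedSpace H X]

/-- The form `Θ` pulled back along a map to `N × U(1)`. -/
theorem connTheta_mfderiv (lam : Form IN N ℝ 1) {f : X → N × Circle} {x : X}
    (hf : MDifferentiableAt I (IN.prod (𝓡 1)) f x) (v : TangentSpace I x) :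
    connTheta IN lam (f x) (fun _ => mfderiv I (IN.prod (𝓡 1)) f x v) =
      (((f x).2⁻¹ : Circle) : ℂ) * mvfderiv I (fun y => ((f y).2 : ℂ)) x v -
        2 * Real.pi * Complex.I *
          ((lam (f x).1 (fun _ => mfderiv I IN (fun y => (f y).1) x v) : ℝ) : ℂ) := by
  have h2 : mfderiv I (𝓡 1) (fun y => (f y).2) x v =
      mfderiv (IN.prod (𝓡 1)) (𝓡 1) Prod.snd (f x) (mfderiv I (IN.prod (𝓡 1)) f x v) :=
    mfderiv_comp_apply x mdifferentiableAt_snd hf v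
  have h1 : mfderiv I IN (fun y => (f y).1) x v =
      mfderiv (IN.prod (𝓡 1)) IN Prod.fst (f x) (mfderiv I (IN.prod (𝓡 1)) f x v) :=
    mfderiv_comp_apply x mdifferentiableAt_fst hf v
  rw [mvfderiv_comp_apply' (f := fun y => (f y).2) (g := fun z : Circle => (z : ℂ))
    (mdifferentiable_circle_coe _) hf.snd v, h2, h1]
  rfl

/-- The 1-form `z̄ dz` on `ℂ`. -/
noncomputable def conjForm : Form 𝓘(ℝ, ℂ) ℂ ℂ 1 := fun z =>
  (ContinuousAlternatingMap.ofSubsingletonLIE (𝕜 := ℝ) (E := ℂ) (F := ℂ) (0 : Fin 1))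
    (ContinuousLinearMap.mul ℝ ℂ (starRingEnd ℂ z))

theorem isSmoothForm_conjForm : IsSmoothForm 𝓘(ℝ, ℂ) conjForm := by
  intro x₀
  have h : ContDiff ℝ ∞ (fun z : ℂ => (ContinuousAlternatingMap.ofSubsingletonLIE (𝕜 := ℝ) (E := ℂ)
      (F := ℂ) (0 : Fin 1)) (ContinuousLinearMap.mul ℝ ℂ (starRingEnd ℂ z))) :=
    (LinearIsometryEquiv.contDiff _).comp
      ((ContinuousLinearMap.mul ℝ ℂ).contDiff.comp Complex.conjCLE.contDiff)
  exact h.contDiffOn.congr fun y _ => chartRep_vectorSpace conjForm x₀ y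

/-- On the circle the inverse is the conjugate, so the Maurer–Cartan form is restricted from a
smooth form on `ℂ`; its smoothness follows without charts of the circle. -/
theorem maurerCartan_eq_pullback :
    maurerCartan = pullback 𝓘(ℝ, ℂ) (𝓡 1) (fun z : Circle => (z : ℂ)) conjForm := by
  funext u
  ext v
  have : v = fun _ => v 0 := by funext i; rw [Subsingleton.elim i 0]
  rw [this]
  change ((u⁻¹ : Circle) : ℂ) * _ = (starRingEnd ℂ (u : ℂ)) * _
  rw [Circle.coe_inv_eq_conj]
  rfl

theorem isSmoothForm_connTheta [IN.Boundaryless] [IsManifold IN ∞ N] {lam : Form IN N ℝ 1}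
    (hlam : IsSmoothForm IN lam) : IsSmoothForm (IN.prod (𝓡 1)) (connTheta IN lam) := by
  have : IsManifold (𝓡 1) ∞ Circle := IsManifold.of_le (n := ω) le_top
  have h1 : IsSmoothForm (𝓡 1) maurerCartan := by
    rw [maurerCartan_eq_pullback]
    exact isSmoothForm_conjForm.pullback contMDiff_circle_coe
  have h2 : IsSmoothForm (IN.prod (𝓡 1))
      (pullback (𝓡 1) (IN.prod (𝓡 1)) (Prod.snd : N × Circle → Circle) maurerCartan) :=
    h1.pullback contMDiff_snd
  have h3 : IsSmoothForm (IN.prod (𝓡 1))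
      (pullback IN (IN.prod (𝓡 1)) (Prod.fst : N × Circle → N) lam) :=
    hlam.pullback contMDiff_fst
  exact h2.sub (h3.clm_comp ((2 * Real.pi * Complex.I) • Complex.ofRealCLM))

theorem connTheta_re (lam : Form IN N ℝ 1) (q : N × Circle)
    (v : Fin 1 → TangentSpace (IN.prod (𝓡 1)) q) : (connTheta IN lam q v).re = 0 := by
  have hv : v = fun _ => v 0 := by funext i; rw [Subsingleton.elim i 0]
  have h := connTheta_mfderiv (I := IN.prod (𝓡 1)) lam (f := id) (x := q) mdifferentiableAt_id (v 0)
  rw [mfderiv_id] at h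
  rw [hv]
  have h5 : connTheta IN lam q (fun _ => v 0) = _ := h
  rw [h5, Complex.sub_re]
  have hs : MDifferentiableAt (IN.prod (𝓡 1)) 𝓘(ℝ, ℂ) (fun y : N × Circle => (y.2 : ℂ)) q :=
    (mdifferentiable_circle_coe _).comp q mdifferentiableAt_snd
  have h6 := norm_sq_circle_deriv (f := fun y : N × Circle => y.2) hs (v 0)
  simp only [id] at h6 ⊢
  rw [h6]
  simp

/-- Two maps to `N × U(1)` that differ by a constant in `U(1)` pull back `Θ` to the same form. -/
theorem connTheta_mfderiv_mul_const (lam : Form IN N ℝ 1) {f f' : X → N × Circle} {x : X} (z : Circle)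
    (hf : MDifferentiableAt I (IN.prod (𝓡 1)) f x)
    (hf' : MDifferentiableAt I (IN.prod (𝓡 1)) f' x) (h1 : ∀ y, (f' y).1 = (f y).1)
    (h2 : ∀ y, (f' y).2 = (f y).2 * z) (v : TangentSpace I x) :
    connTheta IN lam (f' x) (fun _ => mfderiv I (IN.prod (𝓡 1)) f' x v) =
      connTheta IN lam (f x) (fun _ => mfderiv I (IN.prod (𝓡 1)) f x v) := by
  rw [connTheta_mfderiv lam hf v, connTheta_mfderiv lam hf' v]
  have e1 : (fun y => (f' y).1) = fun y => (f y).1 := funext h1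
  have e2 : (fun y => ((f' y).2 : ℂ)) = fun y => (ContinuousLinearMap.mul ℝ ℂ (z : ℂ)) ((f y).2 : ℂ) := by
    funext y; rw [h2]; simp [mul_comm]
  have hs : MDifferentiableAt I 𝓘(ℝ, ℂ) (fun y => ((f y).2 : ℂ)) x :=
    (mdifferentiable_circle_coe _).comp x hf.snd
  have e3 : mvfderiv I (fun y => ((f' y).2 : ℂ)) x v =
      z * mvfderiv I (fun y => ((f y).2 : ℂ)) x v := by
    rw [e2, mvfderiv_comp_apply' (f := fun y => ((f y).2 : ℂ))
      (g := (ContinuousLinearMap.mul ℝ ℂ (z : ℂ)))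
      (ContinuousLinearMap.mul ℝ ℂ (z : ℂ)).differentiableAt.mdifferentiableAt hs v]
    have : mvfderiv 𝓘(ℝ, ℂ) (ContinuousLinearMap.mul ℝ ℂ (z : ℂ)) ((f x).2 : ℂ) =
        ContinuousLinearMap.mul ℝ ℂ (z : ℂ) :=
      Eq.trans mfderiv_eq_fderiv (ContinuousLinearMap.fderiv _)
    rw [this]
    rfl
  rw [e3, h2]
  congr 1
  · rw [mul_inv, Circle.coe_mul, ← mul_assoc, mul_assoc _ _ (z : ℂ), ← Circle.coe_mul z⁻¹ z]
    simp
  · congr 2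
    refine form_congr lam (h1 x) (funext fun _ => ?_)
    rw [e1]
    rfl

end ConnTheta

end CharLift

namespace CharLift

/-! ### The phase cocycle, the lifted action, and the invariance of `Θ`. -/

section CurveIntegralSub

variable {E : Type*} [NormedAddCommGroup E] [NormedSpace ℝ E]
  {H : Type*} [TopologicalSpace H] {I : ModelWithCorners ℝ E H} [I.Boundaryless]
  {X : Type*} [TopologicalSpace X] [ChartedSpace H X] [IsManifold I ∞ X]

theorem continuousAt_curveIntegrand {lam : Form I X ℝ 1} (hlam : IsSmoothForm I lam) {c : ℝ → X}
    {t : ℝ} (hc : ContMDiffAt 𝓘(ℝ, ℝ) I ∞ c t) :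
    ContinuousAt (fun t => lam (c t) (fun _ => mfderiv 𝓘(ℝ, ℝ) I c t (1 : ℝ))) t := by
  have h := (contDiffAt_pullbackVec hlam hc).continuousAt
  let e := ContinuousAlternatingMap.ofSubsingletonLIE (𝕜 := ℝ) (E := ℝ) (F := ℝ) (0 : Fin 1)
  have h2 : ContinuousAt (fun t => e.symm (pullbackVec c lam t)) t :=
    e.symm.continuous.continuousAt.comp h
  exact h2.clm_apply (continuousAt_const (y := (1 : ℝ)))

theorem intervalIntegrable_curveIntegrand {lam : Form I X ℝ 1} (hlam : IsSmoothForm I lam)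
    (γ : Curve I X) : IntervalIntegrable
      (fun t => lam (γ.ext t) (fun _ => mfderiv 𝓘(ℝ, ℝ) I γ.ext t (1 : ℝ))) volume 0 1 := by
  refine ContinuousOn.intervalIntegrable fun t ht => ?_
  rw [uIcc_of_le zero_le_one] at ht
  exact (continuousAt_curveIntegrand hlam (γ.contMDiffAt_ext ht)).continuousWithinAt

theorem curveIntegral_sub {lam μ : Form I X ℝ 1} (hlam : IsSmoothForm I lam)
    (hμ : IsSmoothForm I μ) (γ : Curve I X) :
    curveIntegral (lam - μ) γ = curveIntegral lam γ - curveIntegral μ γ :=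
  intervalIntegral.integral_sub (intervalIntegrable_curveIntegrand hlam γ)
    (intervalIntegrable_curveIntegrand hμ γ)

end CurveIntegralSub

section PhaseData

variable {EG : Type*} [NormedAddCommGroup EG] [NormedSpace ℝ EG]
  {HG : Type*} [TopologicalSpace HG] {IG : ModelWithCorners ℝ EG HG} [IG.Boundaryless]
  {G : Type*} [TopologicalSpace G] [ChartedSpace HG G] [Group G] [LieGroup IG ∞ G]
  {EN : Type*} [NormedAddCommGroup EN] [NormedSpace ℝ EN]
  {HN : Type*} [TopologicalSpace HN] {IN : ModelWithCorners ℝ EN HN} [IN.Boundaryless]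
  {N : Type*} [TopologicalSpace N] [ChartedSpace HN N] [IsManifold IN ∞ N]
  {EM : Type*} [NormedAddCommGroup EM] [NormedSpace ℝ EM]
  {HM : Type*} [TopologicalSpace HM] {IM : ModelWithCorners ℝ EM HM}
  {M : Type*} [TopologicalSpace M] [ChartedSpace HM M]
  [MulAction G N] {π : N → M}
  {χ : Z1 IM M →+ UnitAddCircle} {lam : Form IN N ℝ 1} {α : G → N → UnitAddCircle}

/-- `α` is the phase `∫ λ - χ` of chains from `x` to `g • x`. -/
structure PhaseData (IG : ModelWithCorners ℝ EG HG) (π : N → M)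
    (hπ : IsPrincipalBundle IG IN IM (MulAction.toPermHom G N) π)
    (χ : Z1 IM M →+ UnitAddCircle) (lam : Form IN N ℝ 1) (α : G → N → UnitAddCircle) : Prop where
  smooth : IsSmoothForm IN lam
  compat : CycleCompatible lam π hπ.smooth_proj χ
  phase : ∀ g x, IsPhase lam π hπ.smooth_proj χ x (g • x) (α g x)

variable {hπ : IsPrincipalBundle IG IN IM (MulAction.toPermHom G N) π}

namespace PhaseData

set_option linter.unusedSectionVars false

/-- The cocycle identity: a chain from `x` to `g' • x` followed by one from there to `(g * g') • x`
is admissible for the product. -/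
theorem map_mul (h : PhaseData IG π hπ χ lam α) (g g' : G) (x : N) :
    α (g * g') x = α g (g' • x) + α g' x := by
  have h1 := (h.phase g' x).trans (h.phase g (g' • x))
  rw [smul_smul] at h1
  rw [(h.phase (g * g') x).unique h.compat h1, add_comm]

theorem map_one (h : PhaseData IG π hπ χ lam α) (x : N) : α 1 x = 0 := by
  have := h.map_mul 1 1 x
  rw [one_smul, mul_one] at this
  exact left_eq_add.1 this

theorem contMDiff_smul (hπ : IsPrincipalBundle IG IN IM (MulAction.toPermHom G N) π) :
    ContMDiff (IG.prod IN) IN ∞ (fun p : G × N => p.1 • p.2) := hπ.smooth_action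

/-- The change of the phase along curves in `G × N`. -/
noncomputable def phaseForm (IG : ModelWithCorners ℝ EG HG) (G : Type*) [TopologicalSpace G]
    [ChartedSpace HG G] [Group G] [MulAction G N] (lam : Form IN N ℝ 1) :
    Form (IG.prod IN) (G × N) ℝ 1 :=
  pullback IN (IG.prod IN) (fun p : G × N => p.1 • p.2) lam - pullback IN (IG.prod IN) Prod.snd lam

theorem isSmoothForm_phaseForm (h : PhaseData IG π hπ χ lam α) :
    IsSmoothForm (IG.prod IN) (phaseForm IG G lam) :=
  (h.smooth.pullback (contMDiff_smul hπ)).sub (h.smooth.pullback contMDiff_snd)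

/-- The projection of `γ` to `N` and its image under the action lie over one curve of `M`, and the
phase at each time joins their points, so `IsPhase.transport` applies. This gives smoothness of the
phase jointly in the group element and the point. -/
theorem toCircle_target (h : PhaseData IG π hπ χ lam α) (γ : Curve (IG.prod IN) (G × N)) :
    ((AddCircle.toCircle (α γ.target.1 γ.target.2) : Circle) : ℂ) =
      Complex.exp (2 * Real.pi * Complex.I * (curveIntegral (phaseForm IG G lam) γ : ℝ)) *
        (AddCircle.toCircle (α γ.source.1 γ.source.2) : Circle) := by
  let γ₁ : Curve IN N := γ.postcomp Prod.snd contMDiff_snd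
  let γ₂ : Curve IN N := γ.postcomp (fun p : G × N => p.1 • p.2) (contMDiff_smul hπ)
  have hγ : γ₁.postcomp π hπ.smooth_proj = γ₂.postcomp π hπ.smooth_proj :=
    SmoothMapOn.toFun_injective (funext fun t => (hπ.proj_action _ _).symm)
  have h1 : IsPhase lam π hπ.smooth_proj χ γ₁.source γ₂.source (α γ.source.1 γ.source.2) :=
    h.phase _ _
  have h2 : IsPhase lam π hπ.smooth_proj χ γ₁.target γ₂.target (α γ.target.1 γ.target.2) :=
    h.phase _ _
  have h3 := h1.transport h.compat hγ h2
  have h4 : curveIntegral (phaseForm IG G lam) γ = curveIntegral lam γ₂ - curveIntegral lam γ₁ := by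
    rw [phaseForm, curveIntegral_sub (h.smooth.pullback (contMDiff_smul hπ))
      (h.smooth.pullback contMDiff_snd), ← curveIntegral_postcomp, ← curveIntegral_postcomp]
  rw [h3, AddCircle.toCircle_add, Circle.coe_mul, toCircle_coe, h4, mul_comm]

theorem contMDiff_phase_coe (h : PhaseData IG π hπ χ lam α) :
    ContMDiff (IG.prod IN) 𝓘(ℝ, ℂ) ∞
      (fun p : G × N => ((AddCircle.toCircle (α p.1 p.2) : Circle) : ℂ)) :=
  contMDiff_of_curveIntegral h.isSmoothForm_phaseForm h.toCircle_target

theorem contMDiff_phase (h : PhaseData IG π hπ χ lam α) :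
    ContMDiff (IG.prod IN) (𝓡 1) ∞ (fun p : G × N => AddCircle.toCircle (α p.1 p.2)) :=
  contMDiff_circle_of_coe h.contMDiff_phase_coe

/-- The lift `(x, u) ↦ (g x, exp (2πi α_g(x)) u)` of the action. -/
noncomputable def lift (h : PhaseData IG π hπ χ lam α) : G →* Equiv.Perm (N × Circle) where
  toFun g :=
    { toFun := fun q => (g • q.1, AddCircle.toCircle (α g q.1) * q.2)
      invFun := fun q => (g⁻¹ • q.1, AddCircle.toCircle (α g⁻¹ q.1) * q.2)
      left_inv := fun q => by
        have := h.map_mul g⁻¹ g q.1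
        rw [inv_mul_cancel, h.map_one] at this
        ext1
        · simp
        · simp only
          rw [← mul_assoc, ← AddCircle.toCircle_add, ← this, AddCircle.toCircle_zero, one_mul]
      right_inv := fun q => by
        have := h.map_mul g g⁻¹ q.1
        rw [mul_inv_cancel, h.map_one] at this
        ext1
        · simp
        · simp only
          rw [← mul_assoc, ← AddCircle.toCircle_add, ← this, AddCircle.toCircle_zero, one_mul] }
  map_one' := by
    ext1 q
    change ((1 : G) • q.1, AddCircle.toCircle (α 1 q.1) * q.2) = q
    rw [h.map_one, AddCircle.toCircle_zero, one_mul, one_smul]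
  map_mul' g g' := by
    ext1 q
    change ((g * g') • q.1, AddCircle.toCircle (α (g * g') q.1) * q.2) =
      (g • g' • q.1, AddCircle.toCircle (α g (g' • q.1)) * (AddCircle.toCircle (α g' q.1) * q.2))
    rw [h.map_mul, AddCircle.toCircle_add, mul_assoc, mul_smul]

theorem lift_apply (h : PhaseData IG π hπ χ lam α) (g : G) (q : N × Circle) :
    h.lift g q = (g • q.1, AddCircle.toCircle (α g q.1) * q.2) := rfl

theorem isLift (h : PhaseData IG π hπ χ lam α) : IsLift IG IN h.lift where
  smooth := by
    have : LieGroup (𝓡 1) ∞ Circle := LieGroup.of_le (n := ω) le_top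
    have h1 : ContMDiff (IG.prod (IN.prod (𝓡 1))) (IG.prod IN) ∞
        (fun q : G × (N × Circle) => (q.1, q.2.1)) :=
      contMDiff_fst.prodMk (contMDiff_fst.comp contMDiff_snd)
    exact ((contMDiff_smul hπ).comp h1).prodMk
      ((h.contMDiff_phase.comp h1).mul (contMDiff_snd.comp contMDiff_snd))
  covers g q := rfl
  equivariant g x u z := by
    rw [h.lift_apply, h.lift_apply]
    simp only [mul_assoc]

variable {E : Type*} [NormedAddCommGroup E] [NormedSpace ℝ E]
  {H : Type*} [TopologicalSpace H] {I : ModelWithCorners ℝ E H}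
  {X : Type*} [TopologicalSpace X] [ChartedSpace H X]

/-- The form `Θ` is invariant under the lifted action, also for variable group elements. -/
theorem connTheta_lift (h : PhaseData IG π hπ χ lam α) {k : X → G} {w : X → N × Circle} {x : X}
    (hk : MDifferentiableAt I IG k x) (hw : MDifferentiableAt I (IN.prod (𝓡 1)) w x)
    (v : TangentSpace I x) :
    connTheta IN lam (h.lift (k x) (w x))
        (fun _ => mfderiv I (IN.prod (𝓡 1)) (fun y => h.lift (k y) (w y)) x v) =
      connTheta IN lam (w x) (fun _ => mfderiv I (IN.prod (𝓡 1)) w x v) := by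
  have hF : MDifferentiableAt I (IN.prod (𝓡 1)) (fun y => h.lift (k y) (w y)) x :=
    MDifferentiableAt.comp (I' := IG.prod (IN.prod (𝓡 1)))
      (g := fun q : G × (N × Circle) => h.lift q.1 q.2) (f := fun y => (k y, w y)) x
      ((h.isLift.smooth _).mdifferentiableAt (by simp)) (hk.prodMk hw)
  rw [connTheta_mfderiv lam hF v, connTheta_mfderiv lam hw v]
  have hka : MDifferentiableAt I (IG.prod IN) (fun y => (k y, (w y).1)) x := hk.prodMk hw.fst
  let Ec : G × N → ℂ := fun p => ((AddCircle.toCircle (α p.1 p.2) : Circle) : ℂ)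
  have hE : MDifferentiableAt (IG.prod IN) 𝓘(ℝ, ℂ) Ec (k x, (w x).1) :=
    (h.contMDiff_phase_coe _).mdifferentiableAt (by simp)
  -- The logarithmic derivative of the phase is `2πi` times the difference of `λ` on the moved and
  -- on the original velocity; in `Θ` the first part cancels the new `λ`-term and the second
  -- restores the old one.
  have hdE : mvfderiv I (fun y => Ec (k y, (w y).1)) x v = 2 * Real.pi * Complex.I *
      ((lam (k x • (w x).1) (fun _ => mfderiv I IN (fun y => k y • (w y).1) x v) -
        lam (w x).1 (fun _ => mfderiv I IN (fun y => (w y).1) x v) : ℝ) : ℂ) *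
        Ec (k x, (w x).1) := by
    rw [mvfderiv_comp_apply' (f := fun y => (k y, (w y).1)) (g := Ec) hE hka v,
      mvfderiv_of_curveIntegral h.isSmoothForm_phaseForm h.toCircle_target]
    have e1 : mfderiv I IN (fun y => k y • (w y).1) x v =
        mfderiv (IG.prod IN) IN (fun p : G × N => p.1 • p.2) (k x, (w x).1)
          (mfderiv I (IG.prod IN) (fun y => (k y, (w y).1)) x v) :=
      mfderiv_comp_apply (I' := IG.prod IN) (g := fun p : G × N => p.1 • p.2) x
        ((contMDiff_smul hπ _).mdifferentiableAt (by simp)) hka v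
    have e2 : mfderiv I IN (fun y => (w y).1) x v =
        mfderiv (IG.prod IN) IN Prod.snd (k x, (w x).1)
          (mfderiv I (IG.prod IN) (fun y => (k y, (w y).1)) x v) :=
      mfderiv_comp_apply (I' := IG.prod IN) (g := (Prod.snd : G × N → N)) x
        mdifferentiableAt_snd hka v
    rw [e1, e2]
    rfl
  have hEk : MDifferentiableAt I 𝓘(ℝ, ℂ) (fun y => Ec (k y, (w y).1)) x :=
    MDifferentiableAt.comp (I' := IG.prod IN) (g := Ec) (f := fun y => (k y, (w y).1)) x hE hka
  have hu : MDifferentiableAt I 𝓘(ℝ, ℂ) (fun y => ((w y).2 : ℂ)) x :=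
    (mdifferentiable_circle_coe _).comp x hw.snd
  have hmul := DFunLike.congr_fun (hEk.hasMFDerivAt.mul hu.hasMFDerivAt).mfderiv v
  have hmul' : mvfderiv I (fun y => ((h.lift (k y) (w y)).2 : ℂ)) x v =
      Ec (k x, (w x).1) * mvfderiv I (fun y => ((w y).2 : ℂ)) x v +
        (w x).2 * mvfderiv I (fun y => Ec (k y, (w y).1)) x v := hmul
  rw [hmul', hdE]
  have e3 : (((h.lift (k x) (w x)).2⁻¹ : Circle) : ℂ) =
      (Ec (k x, (w x).1))⁻¹ * ((w x).2 : ℂ)⁻¹ := by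
    rw [h.lift_apply]
    simp only [Circle.coe_inv, Circle.coe_mul, Ec]
    rw [mul_inv]
  have e4 : (lam (h.lift (k x) (w x)).1
      (fun _ => mfderiv I IN (fun y => (h.lift (k y) (w y)).1) x v) : ℝ) =
      lam (k x • (w x).1) (fun _ => mfderiv I IN (fun y => k y • (w y).1) x v) := rfl
  rw [e3, e4, Circle.coe_inv]
  have n1 : Ec (k x, (w x).1) ≠ 0 := Circle.coe_ne_zero _
  have n2 : ((w x).2 : ℂ) ≠ 0 := Circle.coe_ne_zero _
  push_cast
  field_simp
  ring

end PhaseData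

end PhaseData

end CharLift

namespace CharLift

/-! ### Gluing a manifold structure from local homeomorphisms. -/

section Gluing

variable {E : Type*} [NormedAddCommGroup E] [NormedSpace ℝ E]
  {H : Type*} [TopologicalSpace H] {I : ModelWithCorners ℝ E H}
  {X : Type*} [TopologicalSpace X] [ChartedSpace H X]
  {U : Type*} [TopologicalSpace U] {ι : Type*}

/-- The charted space structure on `U` glued from local homeomorphisms to a charted space `X`. -/
@[reducible] def gluedChartedSpace (T : ι → OpenPartialHomeomorph U X) (idx : U → ι)
    (hidx : ∀ q, q ∈ (T (idx q)).source) : ChartedSpace H U where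
  atlas := {e | ∃ i, ∃ c ∈ atlas H X, e = (T i).trans c}
  chartAt q := (T (idx q)).trans (chartAt H (T (idx q) q))
  mem_chart_source q := by simp [hidx q]
  chart_mem_atlas q := ⟨_, _, chart_mem_atlas _ _, rfl⟩

variable {T : ι → OpenPartialHomeomorph U X} {idx : U → ι} {hidx : ∀ q, q ∈ (T (idx q)).source}

theorem isManifold_gluedChartedSpace [IsManifold I ∞ X]
    (hT : ∀ i j, ContMDiffOn I I ∞ ((T i).symm.trans (T j)) ((T i).symm.trans (T j)).source) :
    letI := gluedChartedSpace (H := H) T idx hidx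
    IsManifold I ∞ U := by
  let _ := gluedChartedSpace (H := H) T idx hidx
  refine isManifold_of_contDiffOn I ∞ U ?_
  rintro _ _ ⟨i, c, hc, rfl⟩ ⟨j, c', hc', rfl⟩
  rw [← contMDiffOn_iff_contDiffOn]
  have h1 := contMDiffOn_of_mem_maximalAtlas (I := I) (n := ∞)
    (IsManifold.subset_maximalAtlas hc')
  have h2 := contMDiffOn_symm_of_mem_maximalAtlas (I := I) (n := ∞)
    (IsManifold.subset_maximalAtlas hc)
  refine I.contMDiff.comp_contMDiffOn (ContMDiffOn.comp (t := (((T i).trans c).symm ≫ₕ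
    ((T j).trans c')).source) ?_ (I.contMDiffOn_symm.mono inter_subset_right) fun y hy => hy.1)
  refine (h1.comp ((hT i j).comp (h2.mono ?_) ?_) ?_)
  · intro y hy
    simp only [mfld_simps] at hy ⊢
    exact hy.1.1
  · intro y hy
    simp only [mfld_simps] at hy ⊢
    exact ⟨hy.1.2, hy.2.1⟩
  · intro y hy
    simp only [mfld_simps] at hy ⊢
    exact hy.2.2

/-- The chart at `q` is `T j` followed by a chart `c` of `X`, with `j = idx q`. Hence near `q` the
map `T i` is that chart, then `c.symm`, then the transition from `T j` to `T i`, all smooth. -/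
theorem contMDiffOn_gluedChartedSpace [IsManifold I ∞ X]
    (hT : ∀ i j, ContMDiffOn I I ∞ ((T i).symm.trans (T j)) ((T i).symm.trans (T j)).source) (i : ι) :
    letI := gluedChartedSpace (H := H) T idx hidx
    ContMDiffOn I I ∞ (T i) (T i).source ∧ ContMDiffOn I I ∞ (T i).symm (T i).target := by
  let _ := gluedChartedSpace (H := H) T idx hidx
  have : IsManifold I ∞ U := isManifold_gluedChartedSpace hT
  have key : ∀ q ∈ (T i).source, ContMDiffAt I I ∞ (T i) q ∧ ContMDiffAt I I ∞ (T i).symm (T i q) := by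
    intro q hq
    set j := idx q with hj
    set c := chartAt H (T j q)
    have hqj : q ∈ (T j).source := hidx q
    have hqc : T j q ∈ c.source := mem_chart_source H (T j q)
    set e := (T j).trans c with he
    have hqe : q ∈ e.source := by simp [he, hqj, hqc]
    have hea : e ∈ IsManifold.maximalAtlas I ∞ U :=
      IsManifold.subset_maximalAtlas ⟨j, c, chart_mem_atlas _ _, rfl⟩
    have hca : c ∈ IsManifold.maximalAtlas I ∞ X := IsManifold.chart_mem_maximalAtlas _
    have c1 : ContMDiffAt I I ∞ e q := contMDiffAt_of_mem_maximalAtlas hea hqe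
    have c2 : ContMDiffAt I I ∞ c.symm (e q) :=
      contMDiffAt_symm_of_mem_maximalAtlas hca (by simpa [he] using c.map_source hqc)
    have hce : c.symm (e q) = T j q := by simp [he, hqc]
    have c3 : ContMDiffAt I I ∞ ((T j).symm.trans (T i)) (T j q) :=
      (hT j i).contMDiffAt (((T j).symm.trans (T i)).open_source.mem_nhds (by
        simp [hqj, hq]))
    have d1 : ContMDiffAt I I ∞ c (T j q) := contMDiffAt_of_mem_maximalAtlas hca hqc
    have d2 : ContMDiffAt I I ∞ e.symm (c (T j q)) :=
      contMDiffAt_symm_of_mem_maximalAtlas hea (e.map_source hqe)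
    have d3 : ContMDiffAt I I ∞ ((T i).symm.trans (T j)) (T i q) :=
      (hT i j).contMDiffAt (((T i).symm.trans (T j)).open_source.mem_nhds (by
        simp [hqj, hq]))
    have hd3 : ((T i).symm.trans (T j)) (T i q) = T j q := by simp [hq]
    constructor
    · rw [← hce] at c3
      refine (c3.comp q (c2.comp q c1)).congr_of_eventuallyEq ?_
      filter_upwards [e.open_source.mem_nhds hqe] with z hz
      simp only [he, mfld_simps] at hz
      simp [he, hz.1, hz.2]
    · have d4 : ContMDiffAt I I ∞ (c ∘ ((T i).symm.trans (T j))) (T i q) :=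
        ContMDiffAt.comp (T i q) (by rw [hd3]; exact d1) d3
      have hd4 : (c ∘ ((T i).symm.trans (T j))) (T i q) = c (T j q) := congrArg c hd3
      refine (ContMDiffAt.comp (T i q) (by rw [hd4]; exact d2) d4).congr_of_eventuallyEq ?_
      have hs : (T i).target ∩ (T i).symm ⁻¹' e.source ∈ 𝓝 (T i q) :=
        ((T i).symm.isOpen_inter_preimage e.open_source).mem_nhds (by
          refine ⟨(T i).map_source hq, ?_⟩
          simpa [hq] using hqe)
      filter_upwards [hs] with z hz
      have hz2 := hz.2
      simp only [he, mfld_simps] at hz2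
      simp [he, hz2.1, hz2.2]
  refine ⟨fun q hq => (key q hq).1.contMDiffWithinAt, fun z hz => ?_⟩
  have := (key _ ((T i).map_target hz)).2
  rw [(T i).right_inv hz] at this
  exact this.contMDiffWithinAt

end Gluing

/-! ### Principal bundles in terms of local sections. -/

section LocalSections

variable {EG : Type*} [NormedAddCommGroup EG] [NormedSpace ℝ EG]
  {HG : Type*} [TopologicalSpace HG] {IG : ModelWithCorners ℝ EG HG}
  {G : Type*} [TopologicalSpace G] [ChartedSpace HG G] [Group G]
  {EP : Type*} [NormedAddCommGroup EP] [NormedSpace ℝ EP]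
  {HP : Type*} [TopologicalSpace HP] {IP : ModelWithCorners ℝ EP HP}
  {P : Type*} [TopologicalSpace P] [ChartedSpace HP P]
  {EM : Type*} [NormedAddCommGroup EM] [NormedSpace ℝ EM]
  {HM : Type*} [TopologicalSpace HM] {IM : ModelWithCorners ℝ EM HM}
  {M : Type*} [TopologicalSpace M] [ChartedSpace HM M]

/-- A local section `σ` over `V`, with the smooth map `k` measuring the position with respect
to it. -/
structure LocalSection (IG : ModelWithCorners ℝ EG HG) (IP : ModelWithCorners ℝ EP HP)
    (IM : ModelWithCorners ℝ EM HM) (ρ : G →* Equiv.Perm P) (π : P → M) where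
  V : Set M
  σ : M → P
  k : P → G
  isOpen : IsOpen V
  smooth_σ : ContMDiffOn IM IP ∞ σ V
  smooth_k : ContMDiffOn IP IG ∞ k (π ⁻¹' V)
  proj_σ : ∀ m ∈ V, π (σ m) = m
  k_smul_σ : ∀ p, π p ∈ V → ρ (k p) (σ (π p)) = p
  k_smul : ∀ g p, π p ∈ V → k (ρ g p) = g * k p

variable {ρ : G →* Equiv.Perm P} {π : P → M}

theorem LocalSection.k_σ (s : LocalSection IG IP IM ρ π) {m : M} (hm : m ∈ s.V) :
    s.k (s.σ m) = 1 := by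
  have hp : π (s.σ m) ∈ s.V := by rwa [s.proj_σ m hm]
  have h1 := s.k_smul_σ (s.σ m) hp
  have h2 := s.k_smul (s.k (s.σ m)) (s.σ m) hp
  rw [s.proj_σ m hm] at h1
  rw [h1] at h2
  exact left_eq_mul.1 h2

/-- A trivialization gives the section through the unit of `G`, and its group component is `k`.
Conversely `isPrincipalBundle_of_localSections` recovers a trivialization, so bundles can be handled
through such pairs. -/
theorem IsPrincipalBundle.exists_localSection (h : IsPrincipalBundle IG IP IM ρ π) (m : M) :
    ∃ s : LocalSection IG IP IM ρ π, m ∈ s.V := by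
  obtain ⟨V, e, hV, hm, hes, het, hesm, hetm, he⟩ := h.locally_trivial m
  have htar : ∀ m' ∈ V, ∀ g : G, ((m', g) : M × G) ∈ e.target := fun m' hm' g => by
    rw [het]; exact ⟨hm', mem_univ _⟩
  have hsrc : ∀ m' ∈ V, ∀ g : G, e.symm (m', g) ∈ π ⁻¹' V := fun m' hm' g => by
    rw [← hes]; exact e.map_target (htar m' hm' g)
  have hproj : ∀ m' ∈ V, ∀ g : G, π (e.symm (m', g)) = m' := fun m' hm' g => by
    rw [← (he _ (hsrc m' hm' g)).1, e.right_inv (htar m' hm' g)]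
  refine ⟨⟨V, fun m' => e.symm (m', 1), fun p => (e p).2, hV, ?_, ?_, fun m' hm' => hproj m' hm' 1,
    fun p hp => ?_, fun g p hp => (he p hp).2 g⟩, hm⟩
  · exact hetm.comp (contMDiff_id.prodMk contMDiff_const).contMDiffOn fun m' hm' => htar m' hm' 1
  · rw [← hes]
    exact contMDiff_snd.comp_contMDiffOn hesm
  · have h1 : π (ρ (e p).2 (e.symm (π p, 1))) = π p := by rw [h.proj_action, hproj _ hp]
    have h2 : ρ (e p).2 (e.symm (π p, 1)) ∈ e.source := by rw [hes, mem_preimage, h1]; exact hp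
    refine e.injOn h2 (by rw [hes]; exact hp) ?_
    refine Prod.ext ?_ ?_
    · rw [(he _ (hes ▸ h2)).1, h1, (he p hp).1]
    · rw [(he _ (hsrc _ hp 1)).2, e.right_inv (htar _ hp 1), mul_one]

theorem isPrincipalBundle_of_localSections
    (hρ : ContMDiff (IG.prod IP) IP ∞ (fun q : G × P => ρ q.1 q.2)) (hπ : ContMDiff IP IM ∞ π)
    (hinv : ∀ g p, π (ρ g p) = π p) (hs : ∀ m, ∃ s : LocalSection IG IP IM ρ π, m ∈ s.V) :
    IsPrincipalBundle IG IP IM ρ π where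
  smooth_action := hρ
  smooth_proj := hπ
  proj_action := hinv
  locally_trivial m := by
    obtain ⟨s, hm⟩ := hs m
    have h1 : ContMDiffOn IP (IM.prod IG) ∞ (fun p => (π p, s.k p)) (π ⁻¹' s.V) :=
      hπ.contMDiffOn.prodMk s.smooth_k
    have h2 : ContMDiffOn (IM.prod IG) IP ∞ (fun q : M × G => ρ q.2 (s.σ q.1)) (s.V ×ˢ univ) :=
      hρ.comp_contMDiffOn (contMDiff_snd.contMDiffOn.prodMk
        (s.smooth_σ.comp contMDiff_fst.contMDiffOn fun q hq => hq.1))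
    have h3 : ∀ q ∈ s.V ×ˢ (univ : Set G), π (ρ q.2 (s.σ q.1)) = q.1 := fun q hq => by
      rw [hinv, s.proj_σ _ hq.1]
    refine ⟨s.V,
      { toFun := fun p => (π p, s.k p)
        invFun := fun q => ρ q.2 (s.σ q.1)
        source := π ⁻¹' s.V
        target := s.V ×ˢ univ
        map_source' := fun p hp => ⟨hp, mem_univ _⟩
        map_target' := fun q hq => by rw [mem_preimage, h3 q hq]; exact hq.1
        left_inv' := fun p hp => s.k_smul_σ p hp
        right_inv' := fun q hq => by
          refine Prod.ext (h3 q hq) ?_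
          simp only
          rw [s.k_smul _ _ (by rw [s.proj_σ _ hq.1]; exact hq.1), s.k_σ hq.1, mul_one]
        open_source := s.isOpen.preimage hπ.continuous
        open_target := s.isOpen.prod isOpen_univ
        continuousOn_toFun := h1.continuousOn
        continuousOn_invFun := h2.continuousOn },
      s.isOpen, hm, rfl, rfl, h1, h2, fun p hp => ⟨rfl, fun g => s.k_smul g p hp⟩⟩

/-- The action on a principal bundle is free. -/
theorem IsPrincipalBundle.eq_of_smul_eq (h : IsPrincipalBundle IG IP IM ρ π) {g g' : G} {p : P}
    (hg : ρ g p = ρ g' p) : g = g' := by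
  obtain ⟨s, hs⟩ := h.exists_localSection (π p)
  have := congrArg s.k hg
  rw [s.k_smul _ _ hs, s.k_smul _ _ hs] at this
  exact mul_right_cancel this

/-- The action is transitive on the fibres. -/
theorem IsPrincipalBundle.exists_smul_eq (h : IsPrincipalBundle IG IP IM ρ π) {p q : P}
    (hpq : π p = π q) : ∃ g, ρ g p = q := by
  obtain ⟨s, hs⟩ := h.exists_localSection (π p)
  refine ⟨s.k q * (s.k p)⁻¹, ?_⟩
  have h1 := s.k_smul_σ p hs
  have h2 := s.k_smul_σ q (hpq ▸ hs)
  have h3 : (ρ (s.k p))⁻¹ p = s.σ (π p) := Equiv.Perm.inv_eq_iff_eq.2 h1.symm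
  rw [map_mul, map_inv, Equiv.Perm.mul_apply, h3, hpq, h2]

theorem IsPrincipalBundle.surjective (h : IsPrincipalBundle IG IP IM ρ π) : Surjective π := fun m => by
  obtain ⟨s, hs⟩ := h.exists_localSection m
  exact ⟨s.σ m, s.proj_σ m hs⟩

end LocalSections

end CharLift

namespace CharLift

/-! ### The quotient `𝒰` as a manifold and its two principal bundles. -/

section Quotient

variable {EG : Type*} [NormedAddCommGroup EG] [NormedSpace ℝ EG]
  {HG : Type*} [TopologicalSpace HG] {IG : ModelWithCorners ℝ EG HG} [IG.Boundaryless]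
  {G : Type*} [TopologicalSpace G] [ChartedSpace HG G] [Group G] [LieGroup IG ∞ G]
  {EN : Type*} [NormedAddCommGroup EN] [NormedSpace ℝ EN]
  {HN : Type*} [TopologicalSpace HN] {IN : ModelWithCorners ℝ EN HN} [IN.Boundaryless]
  {N : Type*} [TopologicalSpace N] [ChartedSpace HN N] [IsManifold IN ∞ N]
  {EM : Type*} [NormedAddCommGroup EM] [NormedSpace ℝ EM]
  {HM : Type*} [TopologicalSpace HM] {IM : ModelWithCorners ℝ EM HM}
  {M : Type*} [TopologicalSpace M] [ChartedSpace HM M]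
  [MulAction G N] {π : N → M}
  {hπ : IsPrincipalBundle IG IN IM (MulAction.toPermHom G N) π}
  {χ : Z1 IM M →+ UnitAddCircle} {lam : Form IN N ℝ 1} {α : G → N → UnitAddCircle}

namespace PhaseData

set_option linter.unusedSectionVars false

/-- The projection of the quotient onto the base. -/
noncomputable def proj (h : PhaseData IG π hπ χ lam α) : LiftQuot h.lift → M :=
  quotProj h.isLift π hπ.proj_action

@[simp] theorem proj_toQuot (h : PhaseData IG π hπ χ lam α) (q : N × Circle) :
    h.proj (toQuot h.lift q) = π q.1 := rfl

theorem toQuot_lift (h : PhaseData IG π hπ χ lam α) (g : G) (q : N × Circle) :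
    toQuot h.lift (h.lift g q) = toQuot h.lift q :=
  (Quotient.sound (s := orbitSetoid h.lift) ⟨g, rfl⟩).symm

theorem continuous_proj (h : PhaseData IG π hπ χ lam α) : Continuous h.proj :=
  Continuous.quotient_lift (hπ.smooth_proj.continuous.comp continuous_fst) _

theorem isQuotientMap_toQuot (h : PhaseData IG π hπ χ lam α) :
    Topology.IsQuotientMap (toQuot h.lift) := isQuotientMap_quotient_mk'

theorem toQuot_surjective (h : PhaseData IG π hπ χ lam α) : Surjective (toQuot h.lift) :=
  Quotient.mk_surjective

/-- The circle coordinate of `𝒰` with respect to a local section of `N → M`. -/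
noncomputable def circleCoord (h : PhaseData IG π hπ χ lam α)
    (s : LocalSection IG IN IM (MulAction.toPermHom G N) π) : LiftQuot h.lift → Circle :=
  -- The element `(s.k q.1)⁻¹` moves `q` to the one representative of its orbit that lies over the
  -- section, so the result is constant on orbits. The value `1` off `s.V` is arbitrary.
  Quotient.lift (fun q : N × Circle => open Classical in
    if π q.1 ∈ s.V then (h.lift (s.k q.1)⁻¹ q).2 else 1) (by
    rintro q _ ⟨g, rfl⟩
    have h1 : π (h.lift g q).1 = π q.1 := hπ.proj_action g q.1
    rw [h1]
    split_ifs with hq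
    · have h2 : s.k (h.lift g q).1 = g * s.k q.1 := s.k_smul g q.1 hq
      rw [h2, ← Equiv.Perm.mul_apply, ← _root_.map_mul, mul_inv_rev, inv_mul_cancel_right]
    · rfl)

theorem circleCoord_toQuot (h : PhaseData IG π hπ χ lam α)
    (s : LocalSection IG IN IM (MulAction.toPermHom G N) π) {q : N × Circle} (hq : π q.1 ∈ s.V) :
    h.circleCoord s (toQuot h.lift q) = (h.lift (s.k q.1)⁻¹ q).2 :=
  if_pos hq

theorem smul_section (s : LocalSection IG IN IM (MulAction.toPermHom G N) π) {x : N}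
    (hx : π x ∈ s.V) : (s.k x)⁻¹ • x = s.σ (π x) := by
  rw [inv_smul_eq_iff]
  exact (s.k_smul_σ x hx).symm

/-- The local section of `N × U(1) → 𝒰`. -/
noncomputable def quotSection (h : PhaseData IG π hπ χ lam α)
    (s : LocalSection IG IN IM (MulAction.toPermHom G N) π) (q : LiftQuot h.lift) : N × Circle :=
  (s.σ (h.proj q), h.circleCoord s q)

theorem quotSection_toQuot (h : PhaseData IG π hπ χ lam α)
    (s : LocalSection IG IN IM (MulAction.toPermHom G N) π) {q : N × Circle} (hq : π q.1 ∈ s.V) :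
    h.quotSection s (toQuot h.lift q) = h.lift (s.k q.1)⁻¹ q :=
  Prod.ext (smul_section s hq).symm (h.circleCoord_toQuot s hq)

theorem toQuot_quotSection (h : PhaseData IG π hπ χ lam α)
    (s : LocalSection IG IN IM (MulAction.toPermHom G N) π) {q : LiftQuot h.lift}
    (hq : h.proj q ∈ s.V) : toQuot h.lift (h.quotSection s q) = q := by
  obtain ⟨p, rfl⟩ := h.toQuot_surjective q
  rw [h.quotSection_toQuot s hq, h.toQuot_lift]

theorem circleCoord_section (h : PhaseData IG π hπ χ lam α)
    (s : LocalSection IG IN IM (MulAction.toPermHom G N) π) {m : M} (hm : m ∈ s.V) (z : Circle) :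
    h.circleCoord s (toQuot h.lift (s.σ m, z)) = z := by
  rw [h.circleCoord_toQuot s (by rwa [s.proj_σ m hm])]
  simp only
  rw [s.k_σ hm, inv_one, _root_.map_one]
  rfl

theorem contMDiffOn_lift_inv (h : PhaseData IG π hπ χ lam α)
    (s : LocalSection IG IN IM (MulAction.toPermHom G N) π) :
    ContMDiffOn (IN.prod (𝓡 1)) (IN.prod (𝓡 1)) ∞
      (fun q : N × Circle => h.lift (s.k q.1)⁻¹ q) {q | π q.1 ∈ s.V} := by
  refine h.isLift.smooth.comp_contMDiffOn (ContMDiffOn.prodMk ?_ contMDiffOn_id)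
  exact (s.smooth_k.comp contMDiff_fst.contMDiffOn fun q hq => hq).inv

/-- The local trivialization of `𝒰 → M` given by a local section of `N → M`. -/
noncomputable def quotTriv (h : PhaseData IG π hπ χ lam α)
    (s : LocalSection IG IN IM (MulAction.toPermHom G N) π) :
    OpenPartialHomeomorph (LiftQuot h.lift) (M × Circle) where
  toFun q := (h.proj q, h.circleCoord s q)
  invFun q := toQuot h.lift (s.σ q.1, q.2)
  source := h.proj ⁻¹' s.V
  target := s.V ×ˢ univ
  map_source' q hq := ⟨hq, mem_univ _⟩
  map_target' q hq := by
    rw [mem_preimage, h.proj_toQuot, s.proj_σ _ hq.1]; exact hq.1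
  left_inv' q hq := h.toQuot_quotSection s hq
  right_inv' q hq := Prod.ext (s.proj_σ _ hq.1) (h.circleCoord_section s hq.1 q.2)
  open_source := s.isOpen.preimage h.continuous_proj
  open_target := s.isOpen.prod isOpen_univ
  continuousOn_toFun := by
    refine h.continuous_proj.continuousOn.prodMk ?_
    -- By the quotient topology, continuity is checked upstairs, where the coordinate is a smooth
    -- expression in the action.
    rw [h.isQuotientMap_toQuot.continuousOn_isOpen_iff (s.isOpen.preimage h.continuous_proj)]
    exact (continuous_snd.comp_continuousOn (h.contMDiffOn_lift_inv s).continuousOn).congr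
      fun q hq => h.circleCoord_toQuot s hq
  continuousOn_invFun := h.isQuotientMap_toQuot.continuous.comp_continuousOn
    ((s.smooth_σ.continuousOn.comp continuousOn_fst fun q hq => hq.1).prodMk continuousOn_snd)

/-- The transition factors through `N × U(1)`: go up by the section `s`, move by `(s'.k)⁻¹`, read
off the circle component. No differentiable structure on the quotient is involved. -/
theorem contMDiffOn_quotTriv_trans (h : PhaseData IG π hπ χ lam α)
    (s s' : LocalSection IG IN IM (MulAction.toPermHom G N) π) :
    ContMDiffOn (IM.prod (𝓡 1)) (IM.prod (𝓡 1)) ∞ ((h.quotTriv s).symm.trans (h.quotTriv s'))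
      ((h.quotTriv s).symm.trans (h.quotTriv s')).source := by
  have hsrc : ∀ q ∈ ((h.quotTriv s).symm.trans (h.quotTriv s')).source, q.1 ∈ s.V ∧ q.1 ∈ s'.V := by
    rintro q ⟨hq, hq'⟩
    refine ⟨hq.1, ?_⟩
    have : π (s.σ q.1) ∈ s'.V := hq'
    rwa [s.proj_σ _ hq.1] at this
  have h1 : ContMDiffOn (IM.prod (𝓡 1)) (IN.prod (𝓡 1)) ∞ (fun q : M × Circle => (s.σ q.1, q.2))
      ((h.quotTriv s).symm.trans (h.quotTriv s')).source :=
    (s.smooth_σ.comp contMDiff_fst.contMDiffOn fun q hq => (hsrc q hq).1).prodMk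
      contMDiff_snd.contMDiffOn
  have hm : MapsTo (fun q : M × Circle => (s.σ q.1, q.2))
      ((h.quotTriv s).symm.trans (h.quotTriv s')).source {q | π q.1 ∈ s'.V} := fun q hq => by
    change π (s.σ q.1) ∈ s'.V
    rw [s.proj_σ _ (hsrc q hq).1]; exact (hsrc q hq).2
  have h2 := (h.contMDiffOn_lift_inv s').comp h1 hm
  refine (contMDiff_fst.contMDiffOn.prodMk (contMDiff_snd.comp_contMDiffOn h2)).congr fun q hq => ?_
  exact Prod.ext (s.proj_σ _ (hsrc q hq).1) (h.circleCoord_toQuot s' (hm hq))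

/-- A local section around each point. -/
noncomputable def sectionAt (hπ : IsPrincipalBundle IG IN IM (MulAction.toPermHom G N) π) (m : M) :
    LocalSection IG IN IM (MulAction.toPermHom G N) π := (hπ.exists_localSection m).choose

theorem mem_sectionAt (hπ : IsPrincipalBundle IG IN IM (MulAction.toPermHom G N) π) (m : M) :
    m ∈ (sectionAt hπ m).V := (hπ.exists_localSection m).choose_spec

/-- All local sections take part in the gluing, so `quotTriv s` is smooth for every `s`, not only
for the chosen `sectionAt`. -/
noncomputable instance chartedSpace (h : PhaseData IG π hπ χ lam α) :
    ChartedSpace (ModelProd HM (EuclideanSpace ℝ (Fin 1))) (LiftQuot h.lift) :=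
  gluedChartedSpace h.quotTriv (fun q => sectionAt hπ (h.proj q)) fun q => mem_sectionAt hπ (h.proj q)

variable [IsManifold IM ∞ M]

instance isManifold (h : PhaseData IG π hπ χ lam α) :
    IsManifold (IM.prod (𝓡 1)) ∞ (LiftQuot h.lift) :=
  have : IsManifold (𝓡 1) ∞ Circle := IsManifold.of_le (n := ω) le_top
  isManifold_gluedChartedSpace (hidx := fun q => mem_sectionAt hπ (h.proj q))
    h.contMDiffOn_quotTriv_trans

theorem contMDiffOn_quotTriv (h : PhaseData IG π hπ χ lam α)
    (s : LocalSection IG IN IM (MulAction.toPermHom G N) π) :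
    ContMDiffOn (IM.prod (𝓡 1)) (IM.prod (𝓡 1)) ∞ (h.quotTriv s) (h.proj ⁻¹' s.V) :=
  have : IsManifold (𝓡 1) ∞ Circle := IsManifold.of_le (n := ω) le_top
  (contMDiffOn_gluedChartedSpace (hidx := fun q => mem_sectionAt hπ (h.proj q))
    h.contMDiffOn_quotTriv_trans s).1

theorem contMDiffOn_quotTriv_symm (h : PhaseData IG π hπ χ lam α)
    (s : LocalSection IG IN IM (MulAction.toPermHom G N) π) :
    ContMDiffOn (IM.prod (𝓡 1)) (IM.prod (𝓡 1)) ∞ (h.quotTriv s).symm (s.V ×ˢ univ) :=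
  have : IsManifold (𝓡 1) ∞ Circle := IsManifold.of_le (n := ω) le_top
  (contMDiffOn_gluedChartedSpace (hidx := fun q => mem_sectionAt hπ (h.proj q))
    h.contMDiffOn_quotTriv_trans s).2

theorem isOpen_proj_preimage (h : PhaseData IG π hπ χ lam α)
    (s : LocalSection IG IN IM (MulAction.toPermHom G N) π) : IsOpen (h.proj ⁻¹' s.V) :=
  s.isOpen.preimage h.continuous_proj

theorem contMDiff_proj (h : PhaseData IG π hπ χ lam α) :
    ContMDiff (IM.prod (𝓡 1)) IM ∞ h.proj := fun q => by
  have h1 := (h.contMDiffOn_quotTriv (sectionAt hπ (h.proj q))).contMDiffAt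
    ((h.isOpen_proj_preimage _).mem_nhds (mem_sectionAt hπ (h.proj q)))
  exact contMDiffAt_fst.comp q h1

theorem contMDiffOn_circleCoord (h : PhaseData IG π hπ χ lam α)
    (s : LocalSection IG IN IM (MulAction.toPermHom G N) π) :
    ContMDiffOn (IM.prod (𝓡 1)) (𝓡 1) ∞ (h.circleCoord s) (h.proj ⁻¹' s.V) :=
  contMDiff_snd.comp_contMDiffOn (h.contMDiffOn_quotTriv s)

theorem contMDiffOn_quotSection (h : PhaseData IG π hπ χ lam α)
    (s : LocalSection IG IN IM (MulAction.toPermHom G N) π) :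
    ContMDiffOn (IM.prod (𝓡 1)) (IN.prod (𝓡 1)) ∞ (h.quotSection s) (h.proj ⁻¹' s.V) :=
  (s.smooth_σ.comp h.contMDiff_proj.contMDiffOn fun _ hq => hq).prodMk (h.contMDiffOn_circleCoord s)

theorem contMDiff_toQuot (h : PhaseData IG π hπ χ lam α) :
    ContMDiff (IN.prod (𝓡 1)) (IM.prod (𝓡 1)) ∞ (toQuot h.lift) := fun p => by
  set s := sectionAt hπ (π p.1)
  have hs : π p.1 ∈ s.V := mem_sectionAt hπ (π p.1)
  have hn : {q : N × Circle | π q.1 ∈ s.V} ∈ 𝓝 p :=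
    (s.isOpen.preimage (hπ.smooth_proj.continuous.comp continuous_fst)).mem_nhds hs
  have h1 : ContMDiffAt (IN.prod (𝓡 1)) (IM.prod (𝓡 1)) ∞
      (fun q : N × Circle => (π q.1, (h.lift (s.k q.1)⁻¹ q).2)) p :=
    (hπ.smooth_proj.comp contMDiff_fst).contMDiffAt.prodMk
      (contMDiffAt_snd.comp p ((h.contMDiffOn_lift_inv s).contMDiffAt hn))
  have h2 := (h.contMDiffOn_quotTriv_symm s).contMDiffAt
    (x := (π p.1, (h.lift (s.k p.1)⁻¹ p).2))
    ((s.isOpen.prod isOpen_univ).mem_nhds ⟨hs, mem_univ _⟩)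
  refine (h2.comp p h1).congr_of_eventuallyEq ?_
  filter_upwards [hn] with q hq
  have h3 := h.toQuot_quotSection s (q := toQuot h.lift q) hq
  rw [quotSection, h.circleCoord_toQuot s hq] at h3
  exact h3.symm

theorem t2Space [T2Space M] (h : PhaseData IG π hπ χ lam α) : T2Space (LiftQuot h.lift) := by
  refine ⟨fun q q' hqq => ?_⟩
  -- Points of one fibre are separated inside a trivialization, points of different fibres by open
  -- sets of the base.
  by_cases hp : h.proj q = h.proj q'
  · set T := h.quotTriv (sectionAt hπ (h.proj q))
    have hq : q ∈ T.source := mem_sectionAt hπ (h.proj q)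
    have hq' : q' ∈ T.source := by
      have : h.proj q' ∈ (sectionAt hπ (h.proj q)).V := by rw [← hp]; exact hq
      exact this
    have hT : T q ≠ T q' := fun he => hqq (T.injOn hq hq' he)
    obtain ⟨A, B, hA, hB, hqA, hqB, hAB⟩ := t2_separation hT
    exact ⟨T.source ∩ T ⁻¹' A, T.source ∩ T ⁻¹' B, T.isOpen_inter_preimage hA,
      T.isOpen_inter_preimage hB, ⟨hq, hqA⟩, ⟨hq', hqB⟩,
      (hAB.preimage T).mono inter_subset_right inter_subset_right⟩
  · exact separated_by_continuous h.continuous_proj hp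

/-- The action of the circle on the quotient. -/
noncomputable def circleAction (h : PhaseData IG π hπ χ lam α) :
    Circle →* Equiv.Perm (LiftQuot h.lift) := quotCircleAction h.isLift

theorem circleAction_toQuot (h : PhaseData IG π hπ χ lam α) (z : Circle) (q : N × Circle) :
    h.circleAction z (toQuot h.lift q) = toQuot h.lift (q.1, q.2 * z) := rfl

theorem circleCoord_circleAction (h : PhaseData IG π hπ χ lam α)
    (s : LocalSection IG IN IM (MulAction.toPermHom G N) π) (z : Circle) {q : LiftQuot h.lift}
    (hq : h.proj q ∈ s.V) : h.circleCoord s (h.circleAction z q) = z * h.circleCoord s q := by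
  obtain ⟨p, rfl⟩ := h.toQuot_surjective q
  rw [h.circleAction_toQuot, h.circleCoord_toQuot s (q := p) hq,
    h.circleCoord_toQuot s (q := (p.1, p.2 * z)) hq, mul_comm z]
  exact congrArg Prod.snd (h.isLift.equivariant _ p.1 p.2 z)

theorem contMDiff_circleAction (h : PhaseData IG π hπ χ lam α) :
    ContMDiff ((𝓡 1).prod (IM.prod (𝓡 1))) (IM.prod (𝓡 1)) ∞
      (fun q : Circle × LiftQuot h.lift => h.circleAction q.1 q.2) := by
  have : LieGroup (𝓡 1) ∞ Circle := LieGroup.of_le (n := ω) le_top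
  rintro ⟨z, q⟩
  set s := sectionAt hπ (h.proj q)
  have hs : h.proj q ∈ s.V := mem_sectionAt hπ (h.proj q)
  have hn : {w : Circle × LiftQuot h.lift | h.proj w.2 ∈ s.V} ∈ 𝓝 (z, q) :=
    (s.isOpen.preimage (h.continuous_proj.comp continuous_snd)).mem_nhds hs
  have h1 : ContMDiffAt ((𝓡 1).prod (IM.prod (𝓡 1))) (IN.prod (𝓡 1)) ∞
      (fun w : Circle × LiftQuot h.lift => h.quotSection s w.2) (z, q) :=
    ContMDiffAt.comp (I' := IM.prod (𝓡 1)) (g := h.quotSection s) (f := Prod.snd) (z, q)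
      ((h.contMDiffOn_quotSection s).contMDiffAt ((h.isOpen_proj_preimage s).mem_nhds hs))
      contMDiffAt_snd
  have h2 : ContMDiffAt ((𝓡 1).prod (IM.prod (𝓡 1))) (IN.prod (𝓡 1)) ∞
      (fun w : Circle × LiftQuot h.lift => ((h.quotSection s w.2).1, (h.quotSection s w.2).2 * w.1))
      (z, q) := (contMDiffAt_fst.comp _ h1).prodMk ((contMDiffAt_snd.comp _ h1).mul contMDiffAt_fst)
  refine ((h.contMDiff_toQuot _).comp (z, q) h2).congr_of_eventuallyEq ?_
  filter_upwards [hn] with w hw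
  rw [comp_apply, ← h.circleAction_toQuot, h.toQuot_quotSection s hw]

theorem proj_circleAction (h : PhaseData IG π hπ χ lam α) (z : Circle) (q : LiftQuot h.lift) :
    h.proj (h.circleAction z q) = h.proj q := by
  obtain ⟨p, rfl⟩ := h.toQuot_surjective q
  rfl

theorem isPrincipalBundle_proj (h : PhaseData IG π hπ χ lam α) :
    IsPrincipalBundle (𝓡 1) (IM.prod (𝓡 1)) IM h.circleAction h.proj := by
  refine isPrincipalBundle_of_localSections h.contMDiff_circleAction h.contMDiff_proj
    h.proj_circleAction fun m => ?_
  obtain ⟨s, hm⟩ := hπ.exists_localSection m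
  refine ⟨⟨s.V, fun m => toQuot h.lift (s.σ m, 1), h.circleCoord s, s.isOpen,
    h.contMDiff_toQuot.comp_contMDiffOn (s.smooth_σ.prodMk contMDiffOn_const),
    h.contMDiffOn_circleCoord s, s.proj_σ, fun q hq => ?_,
    fun z q hq => h.circleCoord_circleAction s z hq⟩, hm⟩
  rw [h.circleAction_toQuot, one_mul]
  exact h.toQuot_quotSection s hq

/-- A local section `s` of `N → M` serves here too: over `h.proj ⁻¹' s.V` the section is
`quotSection s`, and the position in the orbit is measured by `s.k` on the first component. -/
theorem isPrincipalBundle_toQuot (h : PhaseData IG π hπ χ lam α) :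
    IsPrincipalBundle IG (IN.prod (𝓡 1)) (IM.prod (𝓡 1)) h.lift (toQuot h.lift) := by
  refine isPrincipalBundle_of_localSections h.isLift.smooth h.contMDiff_toQuot h.toQuot_lift
    fun q => ?_
  obtain ⟨s, hm⟩ := hπ.exists_localSection (h.proj q)
  refine ⟨⟨h.proj ⁻¹' s.V, h.quotSection s, fun p => s.k p.1, h.isOpen_proj_preimage s,
    h.contMDiffOn_quotSection s, s.smooth_k.comp contMDiff_fst.contMDiffOn fun p hp => hp,
    fun q hq => h.toQuot_quotSection s hq, fun p hp => ?_, fun g p hp => s.k_smul g p.1 hp⟩, hm⟩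
  rw [h.quotSection_toQuot s hp, ← Equiv.Perm.mul_apply, ← _root_.map_mul, mul_inv_cancel,
    _root_.map_one]
  rfl

end PhaseData

end Quotient

end CharLift

namespace CharLift

/-! ### The connection on `𝒰`. -/

section Connection

variable {EG : Type*} [NormedAddCommGroup EG] [NormedSpace ℝ EG]
  {HG : Type*} [TopologicalSpace HG] {IG : ModelWithCorners ℝ EG HG} [IG.Boundaryless]
  {G : Type*} [TopologicalSpace G] [ChartedSpace HG G] [Group G] [LieGroup IG ∞ G]
  {EN : Type*} [NormedAddCommGroup EN] [NormedSpace ℝ EN]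
  {HN : Type*} [TopologicalSpace HN] {IN : ModelWithCorners ℝ EN HN} [IN.Boundaryless]
  {N : Type*} [TopologicalSpace N] [ChartedSpace HN N] [IsManifold IN ∞ N]
  {EM : Type*} [NormedAddCommGroup EM] [NormedSpace ℝ EM]
  {HM : Type*} [TopologicalSpace HM] {IM : ModelWithCorners ℝ EM HM} [IM.Boundaryless]
  {M : Type*} [TopologicalSpace M] [ChartedSpace HM M] [IsManifold IM ∞ M]
  [MulAction G N] {π : N → M}
  {hπ : IsPrincipalBundle IG IN IM (MulAction.toPermHom G N) π}
  {χ : Z1 IM M →+ UnitAddCircle} {lam : Form IN N ℝ 1} {α : G → N → UnitAddCircle}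
  {E : Type*} [NormedAddCommGroup E] [NormedSpace ℝ E]
  {H : Type*} [TopologicalSpace H] {I : ModelWithCorners ℝ E H}
  {X : Type*} [TopologicalSpace X] [ChartedSpace H X]

namespace PhaseData

set_option linter.unusedSectionVars false

/-- The form on the quotient onto which `Θ` projects. -/
noncomputable def conn (h : PhaseData IG π hπ χ lam α) :
    Form (IM.prod (𝓡 1)) (LiftQuot h.lift) ℂ 1 := fun q =>
  pullback (IN.prod (𝓡 1)) (IM.prod (𝓡 1)) (h.quotSection (sectionAt hπ (h.proj q)))
    (connTheta IN lam) q

theorem mdifferentiableAt_quotSection (h : PhaseData IG π hπ χ lam α)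
    (s : LocalSection IG IN IM (MulAction.toPermHom G N) π) {q : LiftQuot h.lift}
    (hq : h.proj q ∈ s.V) :
    MDifferentiableAt (IM.prod (𝓡 1)) (IN.prod (𝓡 1)) (h.quotSection s) q :=
  ((h.contMDiffOn_quotSection s).contMDiffAt
    ((h.isOpen_proj_preimage s).mem_nhds hq)).mdifferentiableAt (by simp)

/-- Near `x` the map `quotSection s ∘ f` is `g` moved by `(s.k (g y).1)⁻¹`, a group element varying
with the point; invariance under variable elements says that `Θ` does not notice. -/
theorem connTheta_quotSection (h : PhaseData IG π hπ χ lam α)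
    (s : LocalSection IG IN IM (MulAction.toPermHom G N) π) {f : X → LiftQuot h.lift}
    {g : X → N × Circle} {x : X} (hs : π (g x).1 ∈ s.V)
    (hg : MDifferentiableAt I (IN.prod (𝓡 1)) g x)
    (hf : f =ᶠ[𝓝 x] fun y => toQuot h.lift (g y)) (v : TangentSpace I x) :
    connTheta IN lam (h.quotSection s (f x))
        (fun _ => mfderiv I (IN.prod (𝓡 1)) (fun y => h.quotSection s (f y)) x v) =
      connTheta IN lam (g x) (fun _ => mfderiv I (IN.prod (𝓡 1)) g x v) := by
  have hV : {p : N | π p ∈ s.V} ∈ 𝓝 (g x).1 :=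
    (s.isOpen.preimage hπ.smooth_proj.continuous).mem_nhds hs
  have h1 : (fun y => h.quotSection s (f y)) =ᶠ[𝓝 x] fun y => h.lift (s.k (g y).1)⁻¹ (g y) := by
    filter_upwards [hf, hg.fst.continuousAt.preimage_mem_nhds hV] with y hy hy'
    rw [hy]
    exact h.quotSection_toQuot s hy'
  have hk : MDifferentiableAt IN IG (fun p => (s.k p)⁻¹) (g x).1 :=
    ((s.smooth_k.contMDiffAt hV).inv).mdifferentiableAt (by simp)
  rw [← h.connTheta_lift (k := fun y => (s.k (g y).1)⁻¹)
    (MDifferentiableAt.comp (I' := IN) (g := fun p => (s.k p)⁻¹) (f := fun y => (g y).1) x hk hg.fst)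
    hg v]
  refine form_congr (connTheta IN lam) h1.self_of_nhds (funext fun _ => ?_)
  rw [h1.mfderiv_eq]
  rfl

theorem mdifferentiableAt_of_eventuallyEq_toQuot (h : PhaseData IG π hπ χ lam α)
    {f : X → LiftQuot h.lift} {g : X → N × Circle} {x : X}
    (hg : MDifferentiableAt I (IN.prod (𝓡 1)) g x)
    (hf : f =ᶠ[𝓝 x] fun y => toQuot h.lift (g y)) :
    MDifferentiableAt I (IM.prod (𝓡 1)) f x :=
  (MDifferentiableAt.comp (I' := IN.prod (𝓡 1)) (g := toQuot h.lift) x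
    ((h.contMDiff_toQuot _).mdifferentiableAt (by simp)) hg).congr_of_eventuallyEq hf

/-- The form on the quotient may be evaluated through any differentiable local lift. The projection
of `Θ`, invariance, normalization and horizontality are all instances with a suitable `g`. -/
theorem conn_mfderiv (h : PhaseData IG π hπ χ lam α) {f : X → LiftQuot h.lift}
    {g : X → N × Circle} {x : X} (hg : MDifferentiableAt I (IN.prod (𝓡 1)) g x)
    (hf : f =ᶠ[𝓝 x] fun y => toQuot h.lift (g y)) (v : TangentSpace I x) :
    h.conn (f x) (fun _ => mfderiv I (IM.prod (𝓡 1)) f x v) =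
      connTheta IN lam (g x) (fun _ => mfderiv I (IN.prod (𝓡 1)) g x v) := by
  have hp : h.proj (f x) = π (g x).1 := by rw [hf.self_of_nhds]; rfl
  have hs : h.proj (f x) ∈ (sectionAt hπ (h.proj (f x))).V := mem_sectionAt hπ _
  rw [← h.connTheta_quotSection (sectionAt hπ (h.proj (f x))) (hp ▸ hs) hg hf v]
  have h1 : mfderiv I (IN.prod (𝓡 1))
      (fun y => h.quotSection (sectionAt hπ (h.proj (f x))) (f y)) x v = _ :=
    mfderiv_comp_apply (I' := IM.prod (𝓡 1)) x (h.mdifferentiableAt_quotSection _ hs)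
      (h.mdifferentiableAt_of_eventuallyEq_toQuot hg hf) v
  rw [h1]
  rfl

theorem pullback_toQuot_conn (h : PhaseData IG π hπ χ lam α) :
    pullback (IM.prod (𝓡 1)) (IN.prod (𝓡 1)) (toQuot h.lift) h.conn = connTheta IN lam := by
  funext p
  ext v
  have hv : v = fun _ => v 0 := by funext i; rw [Subsingleton.elim i 0]
  have h1 := h.conn_mfderiv (I := IN.prod (𝓡 1)) (f := toQuot h.lift) (g := id) (x := p)
    mdifferentiableAt_id (Filter.Eventually.of_forall fun _ => rfl) (v 0)
  rw [mfderiv_id] at h1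
  rw [hv]
  exact h1

theorem conn_eq_pullback (h : PhaseData IG π hπ χ lam α)
    (s : LocalSection IG IN IM (MulAction.toPermHom G N) π) {q : LiftQuot h.lift}
    (hq : h.proj q ∈ s.V) :
    h.conn q = pullback (IN.prod (𝓡 1)) (IM.prod (𝓡 1)) (h.quotSection s) (connTheta IN lam) q := by
  ext v
  have hv : v = fun _ => v 0 := by funext i; rw [Subsingleton.elim i 0]
  have h1 := h.conn_mfderiv (I := IM.prod (𝓡 1)) (f := id) (x := q)
    (h.mdifferentiableAt_quotSection s hq) (by
      filter_upwards [(h.isOpen_proj_preimage s).mem_nhds hq] with y hy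
      exact (h.toQuot_quotSection s hy).symm) (v 0)
  rw [mfderiv_id] at h1
  rw [hv]
  exact h1

/-- The section used to define `conn` changes from point to point, but near `q` the single section
chosen at `q` computes it. -/
theorem isSmoothForm_conn (h : PhaseData IG π hπ χ lam α) :
    IsSmoothForm (IM.prod (𝓡 1)) h.conn := by
  have : IsManifold (𝓡 1) ∞ Circle := IsManifold.of_le (n := ω) le_top
  refine isSmoothForm_iff.2 fun q => ?_
  have hq := mem_sectionAt hπ (h.proj q)
  have hn := (h.isOpen_proj_preimage (sectionAt hπ (h.proj q))).mem_nhds hq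
  refine (isSmoothForm_iff.1 (isSmoothForm_connTheta h.smooth) _).pullback
    ((h.contMDiffOn_quotSection _).contMDiffAt hn) ?_
  filter_upwards [hn] with q' hq'
  exact h.conn_eq_pullback _ hq'

theorem isConnection_conn (h : PhaseData IG π hπ χ lam α) :
    IsConnection (IM.prod (𝓡 1)) h.circleAction h.conn where
  smooth := h.isSmoothForm_conn
  imaginary q v := connTheta_re lam _ _
  invariant z := by
    have : LieGroup (𝓡 1) ∞ Circle := LieGroup.of_le (n := ω) le_top
    funext q
    have hq := mem_sectionAt hπ (h.proj q)
    have hd := h.mdifferentiableAt_quotSection _ hq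
    have hd' : MDifferentiableAt (IM.prod (𝓡 1)) (IN.prod (𝓡 1)) (fun q' =>
        ((h.quotSection (sectionAt hπ (h.proj q)) q').1,
          (h.quotSection (sectionAt hπ (h.proj q)) q').2 * z)) q := by
      refine hd.fst.prodMk ?_
      have hm : ContMDiff (𝓡 1) (𝓡 1) ∞ (fun w : Circle => w * z) := contMDiff_id.mul contMDiff_const
      exact MDifferentiableAt.comp (I' := 𝓡 1) (g := fun w : Circle => w * z) q
        ((hm _).mdifferentiableAt (by simp)) hd.snd
    rw [h.conn_eq_pullback _ hq]
    ext v
    have hv : v = fun _ => v 0 := by funext i; rw [Subsingleton.elim i 0]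
    have h1 := h.conn_mfderiv (f := h.circleAction z) hd' (by
      filter_upwards [(h.isOpen_proj_preimage (sectionAt hπ (h.proj q))).mem_nhds hq] with y hy
      rw [← h.circleAction_toQuot, h.toQuot_quotSection _ hy]) (v 0)
    rw [hv]
    exact h1.trans (connTheta_mfderiv_mul_const lam z hd hd' (fun _ => rfl) (fun _ => rfl) (v 0))
  fundamental q := by
    obtain ⟨⟨x, u⟩, rfl⟩ := h.toQuot_surjective q
    -- The orbit lifts to `t ↦ (x, u exp(it))`. Its velocity `u i` gives `θ = i`, and the `λ`-term
    -- vanishes because the first component is constant.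
    have he : HasDerivAt (fun t : ℝ => ((u * Circle.exp t : Circle) : ℂ)) ((u : ℂ) * Complex.I) 0 := by
      have h0 : HasDerivAt (fun t : ℝ => Complex.exp ((t : ℂ) * Complex.I)) Complex.I 0 := by
        have := ((Complex.ofRealCLM.hasDerivAt (x := (0 : ℝ))).mul_const Complex.I).cexp
        simpa using this
      simpa [Circle.coe_mul, Circle.coe_exp] using h0.const_mul (u : ℂ)
    have hg : ContMDiff 𝓘(ℝ, ℝ) (IN.prod (𝓡 1)) ∞ (fun t : ℝ => (x, u * Circle.exp t)) := by
      refine contMDiff_const.prodMk (contMDiff_circle_of_coe ?_)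
      rw [contMDiff_iff_contDiff]
      have : ContDiff ℝ ∞ (fun t : ℝ => (u : ℂ) * Complex.exp ((Complex.ofRealCLM t) * Complex.I)) :=
        contDiff_const.mul ((Complex.ofRealCLM.contDiff.mul contDiff_const).cexp)
      simpa [Circle.coe_mul, Circle.coe_exp] using this
    have hg' : MDifferentiableAt 𝓘(ℝ, ℝ) (IN.prod (𝓡 1)) (fun t : ℝ => (x, u * Circle.exp t)) 0 :=
      (hg 0).mdifferentiableAt (by simp)
    have h1 := h.conn_mfderiv (f := fun t : ℝ => h.circleAction (Circle.exp t) (toQuot h.lift (x, u)))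
      hg' (Filter.Eventually.of_forall fun _ => rfl) (1 : ℝ)
    refine h1.trans ((connTheta_mfderiv lam hg' (1 : ℝ)).trans ?_)
    have h2 : mvfderiv 𝓘(ℝ, ℝ) (fun t : ℝ => ((u * Circle.exp t : Circle) : ℂ)) 0 (1 : ℝ) =
        (u : ℂ) * Complex.I := by
      have : fderiv ℝ (fun t : ℝ => ((u * Circle.exp t : Circle) : ℂ)) 0 1 = (u : ℂ) * Complex.I := by
        rw [fderiv_apply_one_eq_deriv, he.deriv]
      rw [← this]
      exact DFunLike.congr_fun (Eq.trans mfderiv_eq_fderiv rfl) (1 : ℝ)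
    have h3 : mfderiv 𝓘(ℝ, ℝ) IN (fun _ : ℝ => x) 0 = 0 := mfderiv_const
    have h4 : (lam x (fun _ => mfderiv 𝓘(ℝ, ℝ) IN (fun _ : ℝ => x) 0 (1 : ℝ)) : ℝ) = 0 := by
      rw [h3]
      exact (lam x).map_zero
    refine (congrArg₂ (fun (a : ℂ) (b : ℝ) => (((u * Circle.exp 0)⁻¹ : Circle) : ℂ) * a -
      2 * Real.pi * Complex.I * (b : ℂ)) h2 h4).trans ?_
    have hu : (u : ℂ) ≠ 0 := Circle.coe_ne_zero u
    simp [hu]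

end PhaseData

end Connection

end CharLift

namespace CharLift

/-! ### Lifting curves to the total space of a principal bundle. -/

section CurveLift

/-- A smooth map equal to the identity on `(-∞, b]` and with values in `[b, b + ε]` after `b`. -/
theorem exists_smooth_stop (b : ℝ) {ε : ℝ} (hε : 0 < ε) : ∃ τ : ℝ → ℝ, ContDiff ℝ ∞ τ ∧
    (∀ t ≤ b, τ t = t) ∧ ∀ t, b ≤ t → τ t ∈ Icc b (b + ε) := by
  let S := Real.smoothTransition
  -- Before `b` the cutoff `S` vanishes; up to `b + ε` the excess over `b` is at most `ε`; beyond
  -- that `S = 1` and the value is `b` again.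
  refine ⟨fun t => b + (t - b) * (1 - S ((t - b) / ε)), ?_, fun t ht => ?_, fun t ht => ?_⟩
  · have hS : ContDiff ℝ ∞ S := Real.smoothTransition.contDiff
    have : ContDiff ℝ ∞ (fun t : ℝ => S ((t - b) / ε)) :=
      hS.comp ((contDiff_id.sub contDiff_const).div_const ε)
    fun_prop
  · have : S ((t - b) / ε) = 0 := Real.smoothTransition.zero_of_nonpos
      (div_nonpos_of_nonpos_of_nonneg (by linarith) hε.le)
    simp only [this]
    ring
  · have h0 : 0 ≤ S ((t - b) / ε) := Real.smoothTransition.nonneg _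
    have h1 : S ((t - b) / ε) ≤ 1 := Real.smoothTransition.le_one _
    refine ⟨le_add_of_nonneg_right (mul_nonneg (by linarith) (by linarith)), ?_⟩
    rcases le_total ε (t - b) with h | h
    · have : S ((t - b) / ε) = 1 := Real.smoothTransition.one_of_one_le ((one_le_div hε).2 h)
      simp only [this]
      linarith
    · simp only
      nlinarith

variable {EG : Type*} [NormedAddCommGroup EG] [NormedSpace ℝ EG]
  {HG : Type*} [TopologicalSpace HG] {IG : ModelWithCorners ℝ EG HG}
  {G : Type*} [TopologicalSpace G] [ChartedSpace HG G] [Group G]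
  {EP : Type*} [NormedAddCommGroup EP] [NormedSpace ℝ EP]
  {HP : Type*} [TopologicalSpace HP] {IP : ModelWithCorners ℝ EP HP}
  {P : Type*} [TopologicalSpace P] [ChartedSpace HP P]
  {EM : Type*} [NormedAddCommGroup EM] [NormedSpace ℝ EM]
  {HM : Type*} [TopologicalSpace HM] {IM : ModelWithCorners ℝ EM HM}
  {M : Type*} [TopologicalSpace M] [ChartedSpace HM M]
  {ρ : G →* Equiv.Perm P} {π : P → M}

/-- `c` has a smooth lift near `K`. -/
def HasLiftNear (IP : ModelWithCorners ℝ EP HP) (π : P → M) (c : ℝ → M) (K : Set ℝ) : Prop :=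
  ∃ (F : ℝ → P) (W : Set ℝ), IsOpen W ∧ K ⊆ W ∧ ContMDiffOn 𝓘(ℝ, ℝ) IP ∞ F W ∧
    ∀ t ∈ W, π (F t) = c t

theorem LocalSection.hasLiftNear (s : LocalSection IG IP IM ρ π) {c : ℝ → M} {W K : Set ℝ}
    (hW : IsOpen W) (hc : ContMDiffOn 𝓘(ℝ, ℝ) IM ∞ c W) (hK : K ⊆ W) (hKs : K ⊆ c ⁻¹' s.V) :
    HasLiftNear IP π c K :=
  ⟨fun t => s.σ (c t), W ∩ c ⁻¹' s.V, hc.continuousOn.isOpen_inter_preimage hW s.isOpen,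
    subset_inter hK hKs, s.smooth_σ.comp (hc.mono inter_subset_left) fun _ ht => ht.2,
    fun _ ht => s.proj_σ _ ht.2⟩

/-- Any smooth `G`-valued factor times `s.σ (c t)` lifts `c`. Taking the factor `s.k (F (τ t))`,
with `τ` the identity up to `b` and confined near `b` afterwards, yields a lift that agrees with `F`
before `b` and exists as long as `c` stays in `s.V`. -/
theorem IsPrincipalBundle.hasLiftNear_extend (h : IsPrincipalBundle IG IP IM ρ π)
    (s : LocalSection IG IP IM ρ π) {c : ℝ → M} {W : Set ℝ}
    (hW : IsOpen W) (hc : ContMDiffOn 𝓘(ℝ, ℝ) IM ∞ c W) {a b b' : ℝ} (hab : a ≤ b) (hbb' : b ≤ b')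
    (hbW : Icc b b' ⊆ W) (hbs : Icc b b' ⊆ c ⁻¹' s.V) (h1 : HasLiftNear IP π c (Icc a b)) :
    HasLiftNear IP π c (Icc a b') := by
  obtain ⟨F, W₁, hW₁, hKW₁, hF, hπF⟩ := h1
  set W₂ := W ∩ c ⁻¹' s.V
  have hW₂ : IsOpen W₂ := hc.continuousOn.isOpen_inter_preimage hW s.isOpen
  have hbW₂ : Icc b b' ⊆ W₂ := subset_inter hbW hbs
  obtain ⟨ε, hε, hball⟩ := Metric.isOpen_iff.1 (hW₁.inter hW₂) b
    ⟨hKW₁ (right_mem_Icc.2 hab), hbW₂ (left_mem_Icc.2 hbb')⟩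
  obtain ⟨τ, hτ, hτ1, hτ2⟩ := exists_smooth_stop b (half_pos hε)
  have hτm : ∀ t, b - ε < t → τ t ∈ W₁ ∩ W₂ := fun t ht => by
    refine hball ?_
    rw [Real.ball_eq_Ioo]
    rcases le_total t b with h | h
    · rw [hτ1 t h]; exact ⟨ht, by linarith⟩
    · exact ⟨by linarith [(hτ2 t h).1], by linarith [(hτ2 t h).2]⟩
  let F' : ℝ → P := fun t => ρ (s.k (F (τ t))) (s.σ (c t))
  have hF' : ContMDiffOn 𝓘(ℝ, ℝ) IP ∞ F' (W₂ ∩ Ioi (b - ε)) := by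
    refine h.smooth_action.comp_contMDiffOn (ContMDiffOn.prodMk ?_ ?_)
    · refine s.smooth_k.comp (hF.comp hτ.contMDiff.contMDiffOn fun t ht => (hτm t ht.2).1)
        fun t ht => ?_
      have h2 := (hτm t ht.2).2.2
      rwa [mem_preimage, ← hπF _ (hτm t ht.2).1] at h2
    · exact s.smooth_σ.comp (hc.mono fun t ht => ht.1.1) fun t ht => ht.1.2
  have hFF' : ∀ t ∈ W₂ ∩ Ioi (b - ε), t ≤ b → F t = F' t := fun t ht htb => by
    have ht1 := hτm t ht.2
    rw [hτ1 t htb] at ht1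
    have h2 := s.k_smul_σ (F t) (by rw [hπF t ht1.1]; exact ht1.2.2)
    rw [hπF t ht1.1] at h2
    simp only [F', hτ1 t htb, h2]
  -- The second piece is already smooth across `b`, so it is enough that the pieces agree on the
  -- overlap to the left of `b`.
  let Fn : ℝ → P := fun t => if t < b then F t else F' t
  have e1 : EqOn Fn F (W₁ ∩ Iio b) := fun t ht => if_pos ht.2
  have e2 : EqOn Fn F' (W₂ ∩ Ioi (b - ε)) := fun t ht => by
    by_cases htb : t < b
    · exact (if_pos htb).trans (hFF' t ht htb.le)
    · exact if_neg htb
  have o1 : IsOpen (W₁ ∩ Iio b) := hW₁.inter isOpen_Iio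
  have o2 : IsOpen (W₂ ∩ Ioi (b - ε)) := hW₂.inter isOpen_Ioi
  refine ⟨Fn, (W₁ ∩ Iio b) ∪ (W₂ ∩ Ioi (b - ε)), o1.union o2, fun t ht => ?_, ?_, ?_⟩
  · rcases lt_or_ge t b with htb | htb
    · exact Or.inl ⟨hKW₁ ⟨ht.1, htb.le⟩, htb⟩
    · exact Or.inr ⟨hbW₂ ⟨htb, ht.2⟩, by rw [mem_Ioi]; linarith⟩
  · exact ((hF.mono inter_subset_left).congr e1).union_of_isOpen (hF'.congr e2) o1 o2
  · rintro t (ht | ht)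
    · rw [e1 ht, hπF t ht.1]
    · rw [e2 ht]
      simp only [F']
      rw [h.proj_action, s.proj_σ _ ht.1.2]

/-- By compactness the interval is subdivided into pieces mapped into domains of local sections; the
lift is extended over one piece at a time, starting from the degenerate interval at `a`. -/
theorem IsPrincipalBundle.hasLiftNear_Icc (h : IsPrincipalBundle IG IP IM ρ π) {c : ℝ → M}
    {W : Set ℝ} (hW : IsOpen W) (hc : ContMDiffOn 𝓘(ℝ, ℝ) IM ∞ c W) {a b : ℝ} (hab : a ≤ b)
    (hK : Icc a b ⊆ W) : HasLiftNear IP π c (Icc a b) := by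
  choose s hs using h.exists_localSection
  have ho : ∀ m, IsOpen {t : Icc a b | c t ∈ (s m).V} := fun m =>
    (s m).isOpen.preimage ((hc.continuousOn.mono hK).domRestrict)
  obtain ⟨t, ht0, htm, ⟨n, hn⟩, htc⟩ := exists_monotone_Icc_subset_open_cover_Icc hab ho
    fun x _ => mem_iUnion.2 ⟨c x, hs _⟩
  have key : ∀ k, HasLiftNear IP π c (Icc a (t k)) := by
    intro k
    induction k with
    | zero =>
      rw [ht0, Icc_self]
      refine (s (c a)).hasLiftNear hW hc ?_ ?_
      · exact singleton_subset_iff.2 (hK (left_mem_Icc.2 hab))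
      · exact singleton_subset_iff.2 (hs _)
    | succ k ih =>
      obtain ⟨m, hm⟩ := htc k
      have hsub : Icc (t k : ℝ) (t (k + 1)) ⊆ Icc a b := Icc_subset_Icc (t k).2.1 (t (k + 1)).2.2
      exact h.hasLiftNear_extend (s m) hW hc (t k).2.1 (htm (Nat.le_succ k)) (hsub.trans hK)
        (fun r hr => hm (a := ⟨r, hsub hr⟩) ⟨hr.1, hr.2⟩) ih
  have := key n
  rwa [hn n le_rfl] at this

/-- Curves lift to the total space of a principal bundle. -/
theorem IsPrincipalBundle.exists_curve_lift (h : IsPrincipalBundle IG IP IM ρ π) (γ : Curve IM M)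
    {p : P} (hp : π p = γ.source) :
    ∃ γ' : Curve IP P, γ'.postcomp π h.smooth_proj = γ ∧ γ'.source = p := by
  obtain ⟨W, hW, hKW, hs⟩ := γ.exists_open_contMDiffOn_ext
  obtain ⟨F, W', hW', hK', hF, hπF⟩ := h.hasLiftNear_Icc hW hs zero_le_one hKW
  have h0 : π (F 0) = π p := by
    rw [hp, hπF 0 (hK' (left_mem_Icc.2 zero_le_one))]
    exact γ.ext_apply ⟨0, left_mem_Icc.2 zero_le_one⟩
  obtain ⟨g, hg⟩ := h.exists_smul_eq h0
  have hsm : ContMDiffOn 𝓘(ℝ, ℝ) IP ∞ (fun t => ρ g (F t)) W' :=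
    h.smooth_action.comp_contMDiffOn (contMDiffOn_const.prodMk hF)
  refine ⟨SmoothMapOn.ofContMDiffOn (fun t => ρ g (F t)) W' hW' hK' hsm,
    SmoothMapOn.toFun_injective (funext fun t => ?_), hg⟩
  change π (ρ g (F t)) = _
  rw [h.proj_action, hπF t (hK' t.2), γ.ext_apply]

end CurveLift

end CharLift

/-! ### Horizontal lifts and the log-holonomy of the connection. -/

namespace CharLift

theorem exists_smooth_primitive {f : ℝ → ℝ} {W : Set ℝ} (hW : IsOpen W) (hK : Icc 0 1 ⊆ W)
    (hf : ContDiffOn ℝ ∞ f W) : ∃ W' : Set ℝ, IsOpen W' ∧ Icc 0 1 ⊆ W' ∧ W' ⊆ W ∧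
      ContDiffOn ℝ ∞ (fun t => ∫ r in (0 : ℝ)..t, f r) W' ∧
      ∀ t ∈ W', HasDerivAt (fun t => ∫ r in (0 : ℝ)..t, f r) (f t) t := by
  obtain ⟨ε₁, hε₁, h₁⟩ := Metric.isOpen_iff.1 hW 0 (hK (left_mem_Icc.2 zero_le_one))
  obtain ⟨ε₂, hε₂, h₂⟩ := Metric.isOpen_iff.1 hW 1 (hK (right_mem_Icc.2 zero_le_one))
  rw [Real.ball_eq_Ioo] at h₁ h₂
  -- The set `W` need not be connected; an interval around `[0,1]` inside it contains the path of
  -- integration from `0` to each of its points.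
  have hsub : Ioo (-ε₁) (1 + ε₂) ⊆ W := fun t ht => by
    rcases lt_or_ge t 0 with h0 | h0
    · exact h₁ ⟨by linarith [ht.1], by linarith⟩
    · rcases le_or_gt t 1 with h1 | h1
      · exact hK ⟨h0, h1⟩
      · exact h₂ ⟨by linarith, ht.2⟩
  have hd : ∀ t ∈ Ioo (-ε₁) (1 + ε₂), HasDerivAt (fun t => ∫ r in (0 : ℝ)..t, f r) (f t) t := by
    intro t ht
    have hu : uIcc 0 t ⊆ W := (ordConnected_Ioo.uIcc_subset
      (⟨by linarith, by linarith⟩ : (0 : ℝ) ∈ Ioo (-ε₁) (1 + ε₂)) ht).trans hsub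
    exact intervalIntegral.integral_hasDerivAt_right
      (hf.continuousOn.mono hu).intervalIntegrable
      (hf.continuousOn.stronglyMeasurableAtFilter hW t (hsub ht))
      (hf.continuousOn.continuousAt (hW.mem_nhds (hsub ht)))
  refine ⟨Ioo (-ε₁) (1 + ε₂), isOpen_Ioo, Icc_subset_Ioo (by linarith) (by linarith), hsub, ?_, hd⟩
  rw [contDiffOn_infty_iff_deriv_of_isOpen isOpen_Ioo]
  exact ⟨fun t ht => (hd t ht).differentiableAt.differentiableWithinAt,
    (hf.mono hsub).congr fun t ht => (hd t ht).deriv⟩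

theorem contDiffAt_curveIntegrand {E : Type*} [NormedAddCommGroup E] [NormedSpace ℝ E]
    {H : Type*} [TopologicalSpace H] {I : ModelWithCorners ℝ E H} [I.Boundaryless]
    {X : Type*} [TopologicalSpace X] [ChartedSpace H X] [IsManifold I ∞ X]
    {lam : Form I X ℝ 1} (hlam : IsSmoothForm I lam) {c : ℝ → X}
    {t : ℝ} (hc : ContMDiffAt 𝓘(ℝ, ℝ) I ∞ c t) :
    ContDiffAt ℝ ∞ (fun t => lam (c t) (fun _ => mfderiv 𝓘(ℝ, ℝ) I c t (1 : ℝ))) t := by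
  let e := ContinuousAlternatingMap.ofSubsingletonLIE (𝕜 := ℝ) (E := ℝ) (F := ℝ) (0 : Fin 1)
  have h2 : ContDiffAt ℝ ∞ (fun t => e.symm (pullbackVec c lam t)) t :=
    e.symm.contDiff.contDiffAt.comp t (contDiffAt_pullbackVec hlam hc)
  exact h2.clm_apply (contDiffAt_const (c := (1 : ℝ)))

theorem hasDerivAt_exp_phase {J : ℝ → ℝ} {j t : ℝ} (hJ : HasDerivAt J j t) :
    HasDerivAt (fun t => Complex.exp (2 * Real.pi * Complex.I * (J t : ℝ)))
      (Complex.exp (2 * Real.pi * Complex.I * (J t : ℝ)) * (2 * Real.pi * Complex.I * j)) t :=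
  (hJ.ofReal_comp.const_mul (2 * Real.pi * Complex.I)).cexp

section Transport

variable {EG : Type*} [NormedAddCommGroup EG] [NormedSpace ℝ EG]
  {HG : Type*} [TopologicalSpace HG] {IG : ModelWithCorners ℝ EG HG} [IG.Boundaryless]
  {G : Type*} [TopologicalSpace G] [ChartedSpace HG G] [Group G] [LieGroup IG ∞ G]
  {EN : Type*} [NormedAddCommGroup EN] [NormedSpace ℝ EN]
  {HN : Type*} [TopologicalSpace HN] {IN : ModelWithCorners ℝ EN HN} [IN.Boundaryless]
  {N : Type*} [TopologicalSpace N] [ChartedSpace HN N] [IsManifold IN ∞ N]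
  {EM : Type*} [NormedAddCommGroup EM] [NormedSpace ℝ EM]
  {HM : Type*} [TopologicalSpace HM] {IM : ModelWithCorners ℝ EM HM} [IM.Boundaryless]
  {M : Type*} [TopologicalSpace M] [ChartedSpace HM M] [IsManifold IM ∞ M]
  [MulAction G N] {π : N → M}
  {hπ : IsPrincipalBundle IG IN IM (MulAction.toPermHom G N) π}
  {χ : Z1 IM M →+ UnitAddCircle} {lam : Form IN N ℝ 1} {α : G → N → UnitAddCircle}

set_option linter.unusedSectionVars false

/-- The form `Θ` on the velocity of a curve. -/
theorem connTheta_velocity (lam : Form IN N ℝ 1) {g : ℝ → N × Circle} {t : ℝ} {z : ℂ}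
    (hg : MDifferentiableAt 𝓘(ℝ, ℝ) (IN.prod (𝓡 1)) g t)
    (hz : HasDerivAt (fun r => ((g r).2 : ℂ)) z t) :
    connTheta IN lam (g t) (fun _ => mfderiv 𝓘(ℝ, ℝ) (IN.prod (𝓡 1)) g t (1 : ℝ)) =
      (((g t).2⁻¹ : Circle) : ℂ) * z - 2 * Real.pi * Complex.I *
        ((lam (g t).1 (fun _ => mfderiv 𝓘(ℝ, ℝ) IN (fun r => (g r).1) t (1 : ℝ)) : ℝ) : ℂ) := by
  refine (connTheta_mfderiv lam hg (1 : ℝ)).trans ?_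
  have h : fderiv ℝ (fun r => ((g r).2 : ℂ)) t 1 = z := by
    rw [fderiv_apply_one_eq_deriv, hz.deriv]
  have h2 : mvfderiv 𝓘(ℝ, ℝ) (fun r => ((g r).2 : ℂ)) t (1 : ℝ) = z :=
    (DFunLike.congr_fun (Eq.trans mfderiv_eq_fderiv rfl) (1 : ℝ)).trans h
  exact congrArg (fun w : ℂ => (((g t).2⁻¹ : Circle) : ℂ) * w - 2 * Real.pi * Complex.I *
    ((lam (g t).1 (fun _ => mfderiv 𝓘(ℝ, ℝ) IN (fun r => (g r).1) t (1 : ℝ)) : ℝ) : ℂ)) h2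

namespace PhaseData

/-- Along `t ↦ (γ t, exp(2πi J(t)) u)`, with `J` the integral of `λ` over `γ` up to time `t`, the
form `θ` equals `2πi λ(γ')`. So `Θ` vanishes there, and the image in the quotient is horizontal. -/
theorem exists_horizontal (h : PhaseData IG π hπ χ lam α) (γ : Curve IN N) (u : Circle) :
    ∃ γ' : Curve (IM.prod (𝓡 1)) (LiftQuot h.lift),
      (∀ t, h.proj (γ'.toFun t) = π (γ.toFun t)) ∧ IsHorizontal h.conn γ' ∧
      γ'.source = toQuot h.lift (γ.source, u) ∧
      γ'.target = toQuot h.lift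
        (γ.target, AddCircle.toCircle (curveIntegral lam γ : UnitAddCircle) * u) := by
  obtain ⟨W, hW, hKW, hs⟩ := γ.exists_open_contMDiffOn_ext
  have hsa : ∀ t ∈ W, ContMDiffAt 𝓘(ℝ, ℝ) IN ∞ γ.ext t := fun t ht =>
    hs.contMDiffAt (hW.mem_nhds ht)
  let f : ℝ → ℝ := fun t => lam (γ.ext t) (fun _ => mfderiv 𝓘(ℝ, ℝ) IN γ.ext t (1 : ℝ))
  have hf : ContDiffOn ℝ ∞ f W := fun t ht =>
    (contDiffAt_curveIntegrand h.smooth (hsa t ht)).contDiffWithinAt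
  obtain ⟨W', hW', hK', hWW', hJ, hJd⟩ := exists_smooth_primitive hW hKW hf
  let J : ℝ → ℝ := fun t => ∫ r in (0 : ℝ)..t, f r
  let z : ℝ → Circle := fun t => AddCircle.toCircle (J t : UnitAddCircle) * u
  have hz : ∀ t, (z t : ℂ) = Complex.exp (2 * Real.pi * Complex.I * (J t : ℝ)) * u := fun t => by
    rw [Circle.coe_mul, toCircle_coe]
  have hzs : ContMDiffOn 𝓘(ℝ, ℝ) (𝓡 1) ∞ z W' := by
    have hE : ContMDiff 𝓘(ℝ, ℝ) (𝓡 1) ∞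
        (fun r : ℝ => AddCircle.toCircle (r : UnitAddCircle) * u) := by
      refine contMDiff_circle_of_coe ?_
      simp only [Circle.coe_mul, toCircle_coe]
      rw [contMDiff_iff_contDiff]
      exact ((contDiff_const.mul Complex.ofRealCLM.contDiff).cexp).mul contDiff_const
    exact hE.comp_contMDiffOn (contMDiffOn_iff_contDiffOn.2 hJ)
  let g : ℝ → N × Circle := fun t => (γ.ext t, z t)
  have hg : ContMDiffOn 𝓘(ℝ, ℝ) (IN.prod (𝓡 1)) ∞ g W' := (hs.mono hWW').prodMk hzs
  have hgd : ∀ t ∈ W', MDifferentiableAt 𝓘(ℝ, ℝ) (IN.prod (𝓡 1)) g t := fun t ht =>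
    (hg.contMDiffAt (hW'.mem_nhds ht)).mdifferentiableAt (by simp)
  have hQ : ContMDiffOn 𝓘(ℝ, ℝ) (IM.prod (𝓡 1)) ∞ (fun t => toQuot h.lift (g t)) W' :=
    h.contMDiff_toQuot.comp_contMDiffOn hg
  let γ' := SmoothMapOn.ofContMDiffOn _ W' hW' hK' hQ
  refine ⟨γ', fun t => ?_, fun t ht => ?_, ?_, ?_⟩
  · change π (γ.ext t) = _
    rw [γ.ext_apply]
  · have hm : MDifferentiableAt 𝓘(ℝ, ℝ) (IM.prod (𝓡 1)) (fun t => toQuot h.lift (g t)) t :=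
      (hQ.contMDiffAt (hW'.mem_nhds (hK' ht))).mdifferentiableAt (by simp)
    have h1 := h.conn_mfderiv (f := fun t => toQuot h.lift (g t)) (hgd t (hK' ht))
      (Filter.Eventually.of_forall fun _ => rfl) (1 : ℝ)
    have h2 : HasDerivAt (fun r => ((g r).2 : ℂ))
        (Complex.exp (2 * Real.pi * Complex.I * (J t : ℝ)) * (2 * Real.pi * Complex.I * f t) * u) t := by
      refine ((hasDerivAt_exp_phase (hJd t (hK' ht))).mul_const (u : ℂ)).congr_of_eventuallyEq ?_
      exact Filter.Eventually.of_forall hz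
    have h3 := connTheta_velocity lam (hgd t (hK' ht)) h2
    have h4 : (((g t).2⁻¹ : Circle) : ℂ) * (Complex.exp (2 * Real.pi * Complex.I * (J t : ℝ)) *
        (2 * Real.pi * Complex.I * f t) * u) - 2 * Real.pi * Complex.I * (f t : ℂ) = 0 := by
      have h5 : (((g t).2⁻¹ : Circle) : ℂ) =
          (Complex.exp (2 * Real.pi * Complex.I * (J t : ℝ)) * u)⁻¹ := by
        rw [Circle.coe_inv, ← hz]
      have hu : (u : ℂ) ≠ 0 := Circle.coe_ne_zero u
      have he := Complex.exp_ne_zero (2 * Real.pi * Complex.I * (J t : ℝ))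
      rw [h5]
      field_simp
      ring
    refine Eq.trans ?_ (h1.trans (h3.trans h4))
    exact form_congr h.conn (γ'.ext_apply ⟨t, ht⟩)
      (funext fun _ => Curve.mfderiv_ext_eq γ' (fun _ => rfl) ht hm)
  · change toQuot h.lift (γ.ext 0, AddCircle.toCircle (J 0 : UnitAddCircle) * u) = _
    have hJ0 : J 0 = 0 := intervalIntegral.integral_same
    rw [hJ0, AddCircle.coe_zero, AddCircle.toCircle_zero, one_mul]
    rw [show γ.ext 0 = γ.source from γ.ext_apply ⟨0, left_mem_Icc.2 zero_le_one⟩]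
  · change toQuot h.lift (γ.ext 1, AddCircle.toCircle (J 1 : UnitAddCircle) * u) = _
    rw [show γ.ext 1 = γ.target from γ.ext_apply ⟨1, right_mem_Icc.2 zero_le_one⟩]
    rfl

/-- A coboundary vanishes on cycles. This absorbs the dependence of the transport on the circle
components of the chosen points of the fibres. -/
theorem linearCombination_source_sub_target (w : M → UnitAddCircle) (z : Z1 IM M) :
    Finsupp.linearCombination ℤ (fun γ : Curve IM M => w γ.source - w γ.target) (z : C1 IM M) = 0 := by
  have h : Finsupp.linearCombination ℤ (fun γ : Curve IM M => w γ.source - w γ.target) =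
      -((Finsupp.linearCombination ℤ w).comp (bdry1 IM M)) := by
    refine Finsupp.lhom_ext' fun γ => LinearMap.ext_ring ?_
    simp
  rw [h, LinearMap.neg_apply, LinearMap.comp_apply, LinearMap.mem_ker.1 z.2, map_zero, neg_zero]

theorem isLogHolonomy_conn (h : PhaseData IG π hπ χ lam α) :
    IsLogHolonomy (IM.prod (𝓡 1)) IM h.circleAction h.proj h.conn χ := by
  intro s hs
  choose p hp using fun m => h.toQuot_surjective (s m)
  have hpm : ∀ m, π (p m).1 = m := fun m => by
    rw [← h.proj_toQuot, hp, hs]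
  choose L hL hLs using fun γ : Curve IM M => hπ.exists_curve_lift γ (hpm γ.source)
  have hLt : ∀ γ, π (L γ).target = γ.target := fun γ =>
    congrArg Curve.target (hL γ)
  choose k hk using fun γ : Curve IM M =>
    hπ.exists_smul_eq ((hpm γ.target).trans (hLt γ).symm)
  have hk' : ∀ γ, k γ • (p γ.target).1 = (L γ).target := hk
  have hv' : ∀ u : Circle, ∃ a : UnitAddCircle, AddCircle.toCircle a = u := fun u => by
    obtain ⟨a, ha⟩ := (AddCircle.homeomorphCircle (T := (1 : ℝ)) one_ne_zero).surjective u
    exact ⟨a, by rw [← ha, AddCircle.homeomorphCircle_apply]⟩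
  choose v hv using hv'
  -- The horizontal lift over `L γ` ends at `(L γ).target = k γ • (p γ.target).1`. Moving back by `k
  -- γ` costs the phase `a γ`, so `b γ` is the transport between representatives with circle
  -- component `1`; `w` accounts for the actual components of `p`.
  let a : Curve IM M → UnitAddCircle := fun γ => α (k γ) (p γ.target).1
  let b : Curve IM M → UnitAddCircle := fun γ => (curveIntegral lam (L γ) : UnitAddCircle) - a γ
  let w : M → UnitAddCircle := fun m => v (p m).2
  refine ⟨fun γ => b γ + (w γ.source - w γ.target), fun γ => ?_, fun z => ?_⟩
  · obtain ⟨γ', h1, h2, h3, h4⟩ := h.exists_horizontal (L γ) (p γ.source).2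
    refine ⟨γ', fun t => (h1 t).trans ?_, h2, ?_, ?_⟩
    · exact congrFun (congrArg SmoothMapOn.toFun (hL γ)) t
    · rw [h3, hLs, hp]
    · rw [h4, ← hp γ.target, h.circleAction_toQuot, ← h.toQuot_lift (k γ) ((p γ.target).1, _),
        h.lift_apply, hk']
      congr 2
      change _ = AddCircle.toCircle (a γ) * _
      conv_lhs => rw [← hv (p γ.source).2]
      conv_rhs => rw [← hv (p γ.target).2]
      rw [← AddCircle.toCircle_add, ← AddCircle.toCircle_add, ← AddCircle.toCircle_add]
      congr 1
      change _ = a γ + (w γ.target + (b γ + (w γ.source - w γ.target)))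
      simp only [b]
      change _ + w γ.source = _
      abel
  · have h1 : Finsupp.linearCombination ℤ (fun γ : Curve IM M => b γ + (w γ.source - w γ.target)) =
        Finsupp.linearCombination ℤ b +
          Finsupp.linearCombination ℤ (fun γ : Curve IM M => w γ.source - w γ.target) := by
      refine Finsupp.lhom_ext' fun γ => LinearMap.ext_ring ?_
      simp
    rw [h1, LinearMap.add_apply, linearCombination_source_sub_target, add_zero]
    refine h.compat.eq_linearCombination L hL (fun m => (p m).1) hLs a (fun γ => ?_) z
    have := h.phase (k γ) (p γ.target).1
    rwa [hk'] at this

end PhaseData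

end Transport

end CharLift

namespace CharLift

/-! ### Uniqueness of the lift. -/

section Division

variable {EG : Type*} [NormedAddCommGroup EG] [NormedSpace ℝ EG]
  {HG : Type*} [TopologicalSpace HG] {IG : ModelWithCorners ℝ EG HG}
  {G : Type*} [TopologicalSpace G] [ChartedSpace HG G] [Group G] [LieGroup IG ∞ G]
  {EP : Type*} [NormedAddCommGroup EP] [NormedSpace ℝ EP]
  {HP : Type*} [TopologicalSpace HP] {IP : ModelWithCorners ℝ EP HP}
  {P : Type*} [TopologicalSpace P] [ChartedSpace HP P]
  {EM : Type*} [NormedAddCommGroup EM] [NormedSpace ℝ EM]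
  {HM : Type*} [TopologicalSpace HM] {IM : ModelWithCorners ℝ EM HM}
  {M : Type*} [TopologicalSpace M] [ChartedSpace HM M]
  {ρ : G →* Equiv.Perm P} {π : P → M}
  {E : Type*} [NormedAddCommGroup E] [NormedSpace ℝ E]
  {H : Type*} [TopologicalSpace H] {I : ModelWithCorners ℝ E H}
  {X : Type*} [TopologicalSpace X] [ChartedSpace H X]

/-- Two smooth maps with the same projection differ by a smooth map to the structure group. -/
theorem IsPrincipalBundle.exists_contMDiff_div (h : IsPrincipalBundle IG IP IM ρ π) {a b : X → P}
    (ha : ContMDiff I IP ∞ a) (hb : ContMDiff I IP ∞ b) (hab : ∀ x, π (a x) = π (b x)) :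
    ∃ k : X → G, ContMDiff I IG ∞ k ∧ ∀ x, ρ (k x) (a x) = b x := by
  choose k hk using fun x => h.exists_smul_eq (hab x)
  refine ⟨k, fun x => ?_, hk⟩
  obtain ⟨s, hs⟩ := h.exists_localSection (π (a x))
  have hV : ∀ p, π p ∈ s.V → π ⁻¹' s.V ∈ 𝓝 p := fun p hp =>
    (s.isOpen.preimage h.smooth_proj.continuous).mem_nhds hp
  -- The chosen `k` is forced by `s.k (b y) = k y * s.k (a y)`, so it coincides locally with this
  -- smooth quotient.
  have h1 : ContMDiffAt I IG ∞ (fun y => s.k (b y) * (s.k (a y))⁻¹) x :=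
    ((s.smooth_k.contMDiffAt (hV _ (hab x ▸ hs))).comp x (hb x)).mul
      ((s.smooth_k.contMDiffAt (hV _ hs)).comp x (ha x)).inv
  refine h1.congr_of_eventuallyEq ?_
  filter_upwards [ha.continuous.continuousAt.preimage_mem_nhds (hV _ hs)] with y hy
  have h2 := s.k_smul (k y) (a y) hy
  rw [hk] at h2
  rw [h2, mul_inv_cancel_right]

end Division

section Uniqueness

variable {EG : Type*} [NormedAddCommGroup EG] [NormedSpace ℝ EG]
  {HG : Type*} [TopologicalSpace HG] {IG : ModelWithCorners ℝ EG HG}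
  {G : Type*} [TopologicalSpace G] [ChartedSpace HG G] [Group G] [LieGroup IG ∞ G]
  {EN : Type*} [NormedAddCommGroup EN] [NormedSpace ℝ EN]
  {HN : Type*} [TopologicalSpace HN] {IN : ModelWithCorners ℝ EN HN} [IN.Boundaryless]
  {N : Type*} [TopologicalSpace N] [ChartedSpace HN N] [IsManifold IN ∞ N]
  {EM : Type*} [NormedAddCommGroup EM] [NormedSpace ℝ EM]
  {HM : Type*} [TopologicalSpace HM] {IM : ModelWithCorners ℝ EM HM}
  {M : Type*} [TopologicalSpace M] [ChartedSpace HM M]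
  [MulAction G N] {π : N → M}

set_option linter.unusedSectionVars false

/-- A map `t ↦ (γ (τ t), u (t))` to `N × U(1)` that is horizontal for `Θ`. -/
theorem coe_eq_of_connTheta_eq_zero {lam : Form IN N ℝ 1} (hlam : IsSmoothForm IN lam)
    (γ : Curve IN N) {τ : ℝ → ℝ} (hτ : ContDiff ℝ ∞ τ) (hτm : ∀ t, τ t ∈ Icc (0 : ℝ) 1)
    (hτ0 : τ 0 = 0) (hτ1 : τ 1 = 1) {g : ℝ → N × Circle}
    (hg : ContMDiff 𝓘(ℝ, ℝ) (IN.prod (𝓡 1)) ∞ g) (hgγ : ∀ t, (g t).1 = γ.ext (τ t))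
    (h0 : ∀ t, connTheta IN lam (g t)
      (fun _ => mfderiv 𝓘(ℝ, ℝ) (IN.prod (𝓡 1)) g t (1 : ℝ)) = 0) :
    (g 1).2 = AddCircle.toCircle (curveIntegral lam γ : UnitAddCircle) * (g 0).2 := by
  obtain ⟨W, hW, hKW, hs⟩ := γ.exists_open_contMDiffOn_ext
  let f : ℝ → ℝ := fun t => lam (γ.ext t) (fun _ => mfderiv 𝓘(ℝ, ℝ) IN γ.ext t (1 : ℝ))
  have hf : ContDiffOn ℝ ∞ f W := fun t ht =>
    (contDiffAt_curveIntegrand hlam (hs.contMDiffAt (hW.mem_nhds ht))).contDiffWithinAt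
  obtain ⟨W', hW', hK', hWW', hJ, hJd⟩ := exists_smooth_primitive hW hKW hf
  let J : ℝ → ℝ := fun t => ∫ r in (0 : ℝ)..t, f r
  have hτd : ∀ t, HasDerivAt τ (deriv τ t) t := fun t =>
    (hτ.differentiable (by simp) t).hasDerivAt
  have hz : ContDiff ℝ ∞ (fun t => ((g t).2 : ℂ)) :=
    (contMDiff_circle_coe.comp (contMDiff_snd.comp hg)).contDiff
  have hzd : ∀ t, HasDerivAt (fun t => ((g t).2 : ℂ)) (deriv (fun t => ((g t).2 : ℂ)) t) t :=
    fun t => (hz.differentiable (by simp) t).hasDerivAt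
  have hlamg : ∀ t, (lam (g t).1 (fun _ => mfderiv 𝓘(ℝ, ℝ) IN (fun r => (g r).1) t (1 : ℝ)) : ℝ) =
      deriv τ t * f (τ t) := by
    intro t
    have e1 : (fun r => (g r).1) = fun r => γ.ext (τ r) := funext hgγ
    have e2 : mfderiv 𝓘(ℝ, ℝ) IN (fun r => γ.ext (τ r)) t (1 : ℝ) =
        mfderiv 𝓘(ℝ, ℝ) IN γ.ext (τ t) (mfderiv 𝓘(ℝ, ℝ) 𝓘(ℝ, ℝ) τ t (1 : ℝ)) :=
      mfderiv_comp_apply t (γ.mdifferentiableAt_ext (hτm t))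
        (hτ.differentiable (by simp) t).mdifferentiableAt (1 : ℝ)
    have e3 : (mfderiv 𝓘(ℝ, ℝ) 𝓘(ℝ, ℝ) τ t (1 : ℝ) : ℝ) = deriv τ t * 1 := by
      have e0 : (fderiv ℝ τ t (1 : ℝ) : ℝ) = deriv τ t * 1 := by
        rw [mul_one, fderiv_apply_one_eq_deriv]
      exact (DFunLike.congr_fun mfderiv_eq_fderiv (1 : ℝ)).trans e0
    have e4 : (mfderiv 𝓘(ℝ, ℝ) IN γ.ext (τ t) (deriv τ t * 1 : ℝ) : EN) =
        deriv τ t • mfderiv 𝓘(ℝ, ℝ) IN γ.ext (τ t) (1 : ℝ) :=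
      (mfderiv 𝓘(ℝ, ℝ) IN γ.ext (τ t)).map_smul (deriv τ t) (1 : ℝ)
    have e5 : (mfderiv 𝓘(ℝ, ℝ) IN (fun r => (g r).1) t (1 : ℝ) : EN) =
        deriv τ t • mfderiv 𝓘(ℝ, ℝ) IN γ.ext (τ t) (1 : ℝ) := by
      rw [e1]
      exact e2.trans ((congrArg _ e3).trans e4)
    refine (form_congr lam (hgγ t) (funext fun _ => e5)).trans ?_
    exact ((ContinuousAlternatingMap.ofSubsingletonLIE (𝕜 := ℝ) (E := EN) (F := ℝ)
      (0 : Fin 1)).symm (lam (γ.ext (τ t)))).map_smul _ _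
  -- Horizontality is the equation `u' = 2πi τ' f(τ) u` for the circle component `u`. The factor
  -- `exp(-2πi J(τ))` makes the product constant.
  let R : ℝ → ℂ := fun t =>
    ((g t).2 : ℂ) * Complex.exp (2 * Real.pi * Complex.I * ((-J (τ t) : ℝ) : ℂ))
  have hR : ∀ t, HasDerivAt R 0 t := by
    intro t
    have h1 : HasDerivAt (fun t => -J (τ t)) (-(f (τ t) * deriv τ t)) t :=
      ((hJd (τ t) (hK' (hτm t))).comp t (hτd t)).neg
    have h2 := (hzd t).mul (hasDerivAt_exp_phase h1)
    refine h2.congr_deriv ?_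
    have h3 := (connTheta_velocity lam ((hg t).mdifferentiableAt (by simp)) (hzd t)).symm.trans (h0 t)
    rw [hlamg, Circle.coe_inv] at h3
    have hu : ((g t).2 : ℂ) ≠ 0 := Circle.coe_ne_zero _
    have h4 : deriv (fun t => ((g t).2 : ℂ)) t =
        2 * Real.pi * Complex.I * ((deriv τ t * f (τ t) : ℝ) : ℂ) * ((g t).2 : ℂ) := by
      rw [sub_eq_zero] at h3
      rw [← h3]
      field_simp
    rw [h4]
    push_cast
    ring
  have hc := is_const_of_deriv_eq_zero (fun t => (hR t).differentiableAt) (fun t => (hR t).deriv) 1 0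
  have hJ0 : J 0 = 0 := intervalIntegral.integral_same
  have hJ1 : J 1 = curveIntegral lam γ := rfl
  simp only [R, hτ0, hτ1, hJ0, hJ1] at hc
  refine Circle.ext ?_
  rw [Circle.coe_mul, toCircle_coe]
  have h5 : Complex.exp (2 * Real.pi * Complex.I * ((-curveIntegral lam γ : ℝ) : ℂ)) =
      (Complex.exp (2 * Real.pi * Complex.I * (curveIntegral lam γ : ℝ)))⁻¹ := by
    rw [← Complex.exp_neg]
    congr 1
    push_cast
    ring
  rw [h5] at hc
  have he := Complex.exp_ne_zero (2 * Real.pi * Complex.I * (curveIntegral lam γ : ℝ))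
  simp only [neg_zero, Complex.ofReal_zero, mul_zero, Complex.exp_zero, mul_one] at hc
  rw [← hc]
  field_simp

theorem toQuot_eq_iff {Φ : G →* Equiv.Perm (N × Circle)} {p q : N × Circle} :
    toQuot Φ p = toQuot Φ q ↔ ∃ g, Φ g p = q :=
  Quotient.eq (r := orbitSetoid Φ)

/-- A lift with the required properties is given by the phase. -/
theorem ProjectsToHolonomy.lift_apply {hπ : IsPrincipalBundle IG IN IM (MulAction.toPermHom G N) π}
    {χ : Z1 IM M →+ UnitAddCircle} {lam : Form IN N ℝ 1} (hlam : IsSmoothForm IN lam)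
    {Φ : G →* Equiv.Perm (N × Circle)} {hΦ : IsLift IG IN Φ}
    (h : ProjectsToHolonomy IG IN IM π hπ.proj_action lam χ Φ hΦ) (φ : G) (γ : Curve IN N)
    (hγ : γ.target = φ • γ.source)
    (hc : mapC1 IM π hπ.smooth_proj (Finsupp.single γ 1) ∈ Z1 IM M) (u : Circle) :
    Φ φ (γ.source, u) = (φ • γ.source, AddCircle.toCircle ((curveIntegral lam γ : UnitAddCircle) -
      χ ⟨mapC1 IM π hπ.smooth_proj (Finsupp.single γ 1), hc⟩) * u) := by
  obtain ⟨cs, hman, -, hT, hU, Ξ, -, hpull, hhol⟩ := h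
  have hfree : ∀ {g g' : G} {x : N}, g • x = g' • x → g = g' := fun hg => hπ.eq_of_smul_eq hg
  set γ₀ : Curve IM M := γ.postcomp π hπ.smooth_proj with hγ₀
  have hγt : γ₀.target = γ₀.source := by
    change π γ.target = π γ.source
    rw [hγ]
    exact hπ.proj_action φ _
  -- The holonomy condition holds for every choice of points in the fibres; one is taken through
  -- `[x, u]`, so that the transport around the closed curve starts there.
  obtain ⟨s, hs, hsx⟩ : ∃ s : M → LiftQuot Φ, (∀ m, quotProj hΦ π hπ.proj_action (s m) = m) ∧
      s γ₀.source = toQuot Φ (γ.source, u) := by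
    classical
    choose s hs using hU.surjective
    refine ⟨Function.update s γ₀.source (toQuot Φ (γ.source, u)), fun m => ?_,
      Function.update_self _ _ _⟩
    by_cases hm : m = γ₀.source
    · subst hm
      rw [Function.update_self]
      rfl
    · rw [Function.update_of_ne hm, hs]
  obtain ⟨hol, hhol1, hhol2⟩ := hhol s hs
  obtain ⟨γ', hγ'p, hγ'h, hγ's, hγ't⟩ := hhol1 γ₀
  have hχ : χ ⟨mapC1 IM π hπ.smooth_proj (Finsupp.single γ 1), hc⟩ = hol γ₀ := by
    rw [hhol2]
    simp only [mapC1_single]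
    rw [Finsupp.linearCombination_single, one_smul]
  rw [hsx] at hγ's
  rw [hγt, hsx] at hγ't
  obtain ⟨w, hw, -⟩ := hT.exists_curve_lift γ' (p := (γ.source, u)) hγ's.symm
  -- Extensions of curves are smooth only near `[0,1]`. Composition with a smooth `τ : ℝ → [0,1]`
  -- fixing `0` and `1` gives maps smooth on all of `ℝ`, as the division by the group requires.
  let τ := Real.smoothTransition
  have hτ : ContDiff ℝ ∞ τ := Real.smoothTransition.contDiff
  have hτm : ∀ t, τ t ∈ Icc (0 : ℝ) 1 := fun t =>
    ⟨Real.smoothTransition.nonneg t, Real.smoothTransition.le_one t⟩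
  have hτ0 : τ 0 = 0 := Real.smoothTransition.zero
  have hτ1 : τ 1 = 1 := Real.smoothTransition.one
  have hwτ : ContMDiff 𝓘(ℝ, ℝ) (IN.prod (𝓡 1)) ∞ (fun t => w.ext (τ t)) := fun t =>
    ContMDiffAt.comp (I' := 𝓘(ℝ, ℝ)) t (w.contMDiffAt_ext (hτm t)) (hτ.contMDiff t)
  have hγτ : ContMDiff 𝓘(ℝ, ℝ) IN ∞ (fun t => γ.ext (τ t)) := fun t =>
    ContMDiffAt.comp (I' := 𝓘(ℝ, ℝ)) t (γ.contMDiffAt_ext (hτm t)) (hτ.contMDiff t)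
  have hwγ' : ∀ t, toQuot Φ (w.ext (τ t)) = γ'.ext (τ t) := fun t => by
    rw [w.ext_apply ⟨τ t, hτm t⟩, γ'.ext_apply ⟨τ t, hτm t⟩]
    exact congrFun (congrArg SmoothMapOn.toFun hw) _
  have hpr : ∀ t, π (w.ext (τ t)).1 = π (γ.ext (τ t)) := fun t => by
    have h1 := hγ'p ⟨τ t, hτm t⟩
    rw [← γ'.ext_apply ⟨τ t, hτm t⟩, ← hwγ' t] at h1
    rw [γ.ext_apply ⟨τ t, hτm t⟩]
    exact h1
  -- The lift `w` of the horizontal curve need not lie over `γ`, but both first components have the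
  -- same projection to `M`. A smooth path in `G` moves one to the other without changing the class
  -- in the quotient.
  obtain ⟨k, hk, hkγ⟩ := hπ.exists_contMDiff_div (contMDiff_fst.comp hwτ) hγτ hpr
  let g : ℝ → N × Circle := fun t => Φ (k t) (w.ext (τ t))
  have hg : ContMDiff 𝓘(ℝ, ℝ) (IN.prod (𝓡 1)) ∞ g := hΦ.smooth.comp (hk.prodMk hwτ)
  have hg1 : ∀ t, (g t).1 = γ.ext (τ t) := fun t => (hΦ.covers _ _).trans (hkγ t)
  have hgQ : (fun t => toQuot Φ (g t)) = fun t => γ'.ext (τ t) := funext fun t => by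
    rw [← hwγ' t]
    exact (toQuot_eq_iff.2 ⟨k t, rfl⟩).symm
  have hg0 : ∀ t, connTheta IN lam (g t)
      (fun _ => mfderiv 𝓘(ℝ, ℝ) (IN.prod (𝓡 1)) g t (1 : ℝ)) = 0 := by
    intro t
    have e1 : mfderiv 𝓘(ℝ, ℝ) (IM.prod (𝓡 1)) (fun t => toQuot Φ (g t)) t (1 : ℝ) =
        mfderiv (IN.prod (𝓡 1)) (IM.prod (𝓡 1)) (toQuot Φ) (g t)
          (mfderiv 𝓘(ℝ, ℝ) (IN.prod (𝓡 1)) g t (1 : ℝ)) :=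
      mfderiv_comp_apply t ((hT.smooth_proj _).mdifferentiableAt (by simp))
        ((hg t).mdifferentiableAt (by simp)) (1 : ℝ)
    have e2 : mfderiv 𝓘(ℝ, ℝ) (IM.prod (𝓡 1)) (fun r => γ'.ext (τ r)) t (1 : ℝ) =
        mfderiv 𝓘(ℝ, ℝ) (IM.prod (𝓡 1)) γ'.ext (τ t) (mfderiv 𝓘(ℝ, ℝ) 𝓘(ℝ, ℝ) τ t (1 : ℝ)) :=
      mfderiv_comp_apply t (γ'.mdifferentiableAt_ext (hτm t))
        (hτ.differentiable (by simp) t).mdifferentiableAt (1 : ℝ)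
    -- The velocity of `toQuot Φ ∘ g = γ'.ext ∘ τ` is `d` times a horizontal vector, hence killed by
    -- `Ξ`; since `Θ` is the pullback of `Ξ`, it vanishes on the velocity of `g`.
    let d : ℝ := mfderiv 𝓘(ℝ, ℝ) 𝓘(ℝ, ℝ) τ t (1 : ℝ)
    have e3 : (mfderiv 𝓘(ℝ, ℝ) (IM.prod (𝓡 1)) γ'.ext (τ t) d : EM × EuclideanSpace ℝ (Fin 1)) =
        d • mfderiv 𝓘(ℝ, ℝ) (IM.prod (𝓡 1)) γ'.ext (τ t) (1 : ℝ) := by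
      have := (mfderiv 𝓘(ℝ, ℝ) (IM.prod (𝓡 1)) γ'.ext (τ t)).map_smul d (1 : ℝ)
      refine Eq.trans ?_ this
      exact congrArg _ (mul_one d).symm
    have e4 : (mfderiv (IN.prod (𝓡 1)) (IM.prod (𝓡 1)) (toQuot Φ) (g t)
        (mfderiv 𝓘(ℝ, ℝ) (IN.prod (𝓡 1)) g t (1 : ℝ)) : EM × EuclideanSpace ℝ (Fin 1)) =
        d • mfderiv 𝓘(ℝ, ℝ) (IM.prod (𝓡 1)) γ'.ext (τ t) (1 : ℝ) := by
      rw [← e3, ← e1, hgQ]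
      exact e2
    have e5 : connTheta IN lam (g t) (fun _ => mfderiv 𝓘(ℝ, ℝ) (IN.prod (𝓡 1)) g t (1 : ℝ)) =
        Ξ (toQuot Φ (g t)) (fun _ => mfderiv (IN.prod (𝓡 1)) (IM.prod (𝓡 1)) (toQuot Φ) (g t)
          (mfderiv 𝓘(ℝ, ℝ) (IN.prod (𝓡 1)) g t (1 : ℝ))) := by
      rw [← hpull]
      rfl
    refine e5.trans ((form_congr Ξ (congrFun hgQ t) (funext fun _ => e4)).trans ?_)
    have e6 := ((ContinuousAlternatingMap.ofSubsingletonLIE (𝕜 := ℝ)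
      (E := EM × EuclideanSpace ℝ (Fin 1)) (F := ℂ) (0 : Fin 1)).symm (Ξ (γ'.ext (τ t)))).map_smul d
        (mfderiv 𝓘(ℝ, ℝ) (IM.prod (𝓡 1)) γ'.ext (τ t) (1 : ℝ))
    refine e6.trans ?_
    refine (congrArg (d • ·) (hγ'h (τ t) (hτm t))).trans (smul_zero d)
  have hfin := coe_eq_of_connTheta_eq_zero hlam γ hτ hτm hτ0 hτ1 hg hg1 hg0
  have hx0 : (g 0).1 = γ.source := by
    rw [hg1, hτ0]
    exact γ.ext_apply ⟨0, left_mem_Icc.2 zero_le_one⟩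
  have hx1 : (g 1).1 = φ • γ.source := by
    rw [hg1, hτ1, ← hγ]
    exact γ.ext_apply ⟨1, right_mem_Icc.2 zero_le_one⟩
  have hu0 : (g 0).2 = u := by
    have h1 : toQuot Φ (γ.source, u) = toQuot Φ (g 0) := by
      rw [congrFun hgQ 0, hτ0, ← hγ's]
      exact (γ'.ext_apply ⟨0, left_mem_Icc.2 zero_le_one⟩).symm
    obtain ⟨ψ, hψ⟩ := toQuot_eq_iff.1 h1
    have h2 : ψ • γ.source = (1 : G) • γ.source := by
      rw [one_smul, ← hΦ.covers ψ (γ.source, u), hψ, hx0]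
    rw [hfree h2, map_one] at hψ
    exact (congrArg Prod.snd hψ).symm
  have h1 : toQuot Φ (γ.source, u * AddCircle.toCircle (hol γ₀)) = toQuot Φ (g 1) := by
    rw [congrFun hgQ 1, hτ1]
    refine Eq.trans ?_ (hγ't.symm.trans (γ'.ext_apply ⟨1, right_mem_Icc.2 zero_le_one⟩).symm)
    rfl
  -- Both points represent the end of the horizontal curve, so some `ψ` carries one to the other.
  -- Their first components are `x` and `φ x`, and freeness on `N` gives `ψ = φ`.
  obtain ⟨ψ, hψ⟩ := toQuot_eq_iff.1 h1
  have h2 : ψ • γ.source = φ • γ.source := by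
    rw [← hx1, ← hψ, hΦ.covers]
  rw [hfree h2, hΦ.equivariant] at hψ
  have h3 : (Φ φ (γ.source, u)).2 * AddCircle.toCircle (hol γ₀) = (g 1).2 := congrArg Prod.snd hψ
  refine Prod.ext (hΦ.covers _ _) ?_
  simp only
  rw [hχ, sub_eq_add_neg, AddCircle.toCircle_add, AddCircle.toCircle_neg,
    mul_right_comm, ← hu0, ← hfin, ← h3, hu0, mul_inv_cancel_right]

end Uniqueness

end CharLift

/-! ### Existence, uniqueness and the formula for the phase. -/

open CharLift
theorem mainTheorem2
    {EG : Type*} [NormedAddCommGroup EG] [NormedSpace ℝ EG] [CompleteSpace EG]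
    {HG : Type*} [TopologicalSpace HG] (IG : ModelWithCorners ℝ EG HG) [IG.Boundaryless]
    {G : Type*} [TopologicalSpace G] [ChartedSpace HG G] [Group G] [LieGroup IG ∞ G]
    {EN : Type*} [NormedAddCommGroup EN] [NormedSpace ℝ EN] [CompleteSpace EN]
    {HN : Type*} [TopologicalSpace HN] (IN : ModelWithCorners ℝ EN HN) [IN.Boundaryless]
    {N : Type*} [TopologicalSpace N] [T2Space N] [ChartedSpace HN N] [IsManifold IN ∞ N]
    {EM : Type*} [NormedAddCommGroup EM] [NormedSpace ℝ EM] [CompleteSpace EM]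
    {HM : Type*} [TopologicalSpace HM] (IM : ModelWithCorners ℝ EM HM) [IM.Boundaryless]
    {M : Type*} [TopologicalSpace M] [T2Space M] [ChartedSpace HM M] [IsManifold IM ∞ M]
    [ConnectedSpace N] (hH1 : Subsingleton (H1 IN N))
    [MulAction G N] (π : N → M)
    (hπ : IsPrincipalBundle IG IN IM (MulAction.toPermHom G N) π)
    (χ : Z1 IM M →+ UnitAddCircle) (η : Form IM M ℝ 2) (hχ : IsDiffCharacter χ η)
    (lam : Form IN N ℝ 1) (hlam : IsSmoothForm IN lam)
    (hη : pullback IM IN π η = dForm IN lam) :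
    (∃! Φ : G →* Equiv.Perm (N × Circle), ∃ hΦ : IsLift IG IN Φ,
      ProjectsToHolonomy IG IN IM π hπ.proj_action lam χ Φ hΦ) ∧
    ∃ α : G → N → UnitAddCircle,
      (∀ (φ : G) (x : N),
        (∃ γ : Curve IN N, γ.source = x ∧ γ.target = φ • x) ∧
        ∀ c : C1 IN N, bdry1 IN N c = Finsupp.single (φ • x) 1 - Finsupp.single x 1 →
          ∃ hc : mapC1 IM π hπ.smooth_proj c ∈ Z1 IM M,
            α φ x = (chainIntegral1 lam c : UnitAddCircle) -
              χ ⟨mapC1 IM π hπ.smooth_proj c, hc⟩) ∧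
      ∀ (Φ : G →* Equiv.Perm (N × Circle)) (hΦ : IsLift IG IN Φ),
        ProjectsToHolonomy IG IN IM π hπ.proj_action lam χ Φ hΦ →
        ∀ (φ : G) (x : N) (u : Circle),
          Φ φ (x, u) = (φ • x, AddCircle.toCircle (α φ x) * u) := by
  have hsm : ∀ (φ : G) (x : N), π x = π (φ • x) := fun φ x => (hπ.proj_action φ x).symm
  have hex : ∀ (φ : G) (x : N), ∃ a, IsPhase lam π hπ.smooth_proj χ x (φ • x) a := fun φ x => by
    obtain ⟨γ, hγs, hγt⟩ := exists_curve (I := IN) x (φ • x)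
    have := isPhase_of_curve (lam := lam) (hf := hπ.smooth_proj) (χ := χ) γ
      (by rw [hγs, hγt]; exact hsm φ x)
    rwa [hγs, hγt] at this
  -- The phase is picked from some chain for each `φ` and `x`; `IsPhase.unique` later identifies it
  -- with the value on any other chain.
  choose α hα using hex
  have hcompat : CycleCompatible lam π hπ.smooth_proj χ :=
    hχ.cycleCompatible hH1 hlam π hπ.smooth_proj hη
  have h : PhaseData IG π hπ χ lam α := ⟨hlam, hcompat, hα⟩
  -- This formula for an arbitrary admissible lift gives both the uniqueness, since `h.lift` is
  -- defined by the same expression, and the last assertion.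
  have huniq : ∀ (Φ : G →* Equiv.Perm (N × Circle)) (hΦ : IsLift IG IN Φ),
      ProjectsToHolonomy IG IN IM π hπ.proj_action lam χ Φ hΦ →
      ∀ (φ : G) (x : N) (u : Circle),
        Φ φ (x, u) = (φ • x, AddCircle.toCircle (α φ x) * u) := by
    intro Φ hΦ hP φ x u
    obtain ⟨γ, rfl, hγt⟩ := exists_curve (I := IN) x (φ • x)
    have hb : bdry1 IN N (Finsupp.single γ 1) =
        Finsupp.single (φ • γ.source) 1 - Finsupp.single γ.source 1 := by simp [hγt]
    have hc := mapC1_mem_Z1 π hπ.smooth_proj hb (hsm φ γ.source)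
    rw [hP.lift_apply (hπ := hπ) hlam φ γ hγt hc u]
    have ha : IsPhase lam π hπ.smooth_proj χ γ.source (φ • γ.source)
        ((curveIntegral lam γ : UnitAddCircle) -
          χ ⟨mapC1 IM π hπ.smooth_proj (Finsupp.single γ 1), hc⟩) :=
      ⟨Finsupp.single γ 1, hb, hc, by rw [chainIntegral1_single, one_smul]⟩
    rw [ha.unique hcompat (hα φ γ.source)]
  refine ⟨⟨h.lift, ⟨h.isLift, h.chartedSpace, h.isManifold, h.t2Space, h.isPrincipalBundle_toQuot,
    h.isPrincipalBundle_proj, h.conn, h.isConnection_conn, h.pullback_toQuot_conn,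
    h.isLogHolonomy_conn⟩, ?_⟩, α, fun φ x => ⟨exists_curve x (φ • x), fun c hc => ?_⟩, huniq⟩
  · rintro Φ ⟨hΦ, hP⟩
    ext1 φ
    ext1 ⟨x, u⟩
    exact huniq Φ hΦ hP φ x u
  · have hcz := mapC1_mem_Z1 π hπ.smooth_proj hc (hsm φ x)
    exact ⟨hcz, (hα φ x).unique hcompat ⟨c, hc, hcz, rfl⟩⟩
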